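/- Let $\mathbf{k}$ be an algebraically closed field (of arbitrary characteristic). An algebra is a $\mathbf{k}$-vector space with a bilinear multiplication (not necessarily associative). An algebra $A$ is anticommutative if $a^2=0$ for all $a\in A$, and Engel if there is $m>0$ with $(L_a)^m=0$ for all $a\in A$, where $L_a(b)=ab$. Let $V$ be an $n$-dimensional vector space with basis $e_1,\dots,e_n$. The $n$-dimensional algebra structures, i.e. the bilinear maps $\mu:V\times V\to V$, form the affine space $\mathbf{k}^{n^3}$ (via structure constants), on which $GL(V)$ acts by $(g*\mu)(x,y)=g\mu(g^{-1}x,g^{-1}y)$; an algebra is represented by $\mu$ if it is isomorphic to $(V,\mu)$. If $A$ and $B$ are represented by $\mu$ and $\chi$, then $A$ degenerates to $B$ if $\chi$ lies in the Zariski closure of the orbit of $\mu$; the degeneration is non-trivial if $A\not\cong B$. The level of $A$ is the maximal $m$ for which there is a sequence of non-trivial degenerations $A\to A_{m-1}\to\dots\to A_1\to A_0$ of $n$-dimensional algebras. Consider the following anticommutative $n$-dimensional structures (products $e_ie_j$, $i<j$, that are not listed are zero): - $\eta_4$ ($n\ge 9$): $e_1e_2=e_3e_4=e_5e_6=e_7e_8=e_9$;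 - $T^4$ ($n=5$): $e_1e_2=e_3,\ e_1e_3=e_4,\ e_1e_4=e_5$; - $T^3(\epsilon_{23}^{n-1})$ ($n\ge5$): $e_1e_2=e_3,\ e_1e_3=e_n,\ e_2e_3=e_{n-1}$; - $T^3(\epsilon_{24}^{n})$ ($n\ge5$): $e_1e_2=e_3,\ e_1e_3=e_2e_4=e_n$; - $T^{2,2}(\epsilon_{34}^{n})$ ($n\ge6$): $e_1e_2=e_{n-1},\ e_1e_3=e_3e_4=e_n$; - $T^{3,2}$ ($n\ge6$): $e_1e_2=e_{n-1},\ e_1e_3=e_4,\ e_1e_4=e_n$; - $T^{2,2,2}(\epsilon_{23}^{n})$ ($n\ge7$): $e_1e_2=e_{n-2},\ e_1e_3=e_{n-1},\ e_1e_4=e_2e_3=e_n$; - $T^{2,2,2,2}$ ($n\ge9$): $e_1e_{i+1}=e_{i+n-4}$ for $1\le i\le4$. Let $A$ be an $n$-dimensional anticommutative Engel algebra over $\mathbf{k}$. - If $n=5$, then $A$ has level $4$ if and only if it can be represented by $T^3(\epsilon_{23}^{4})$, $T^3(\epsilon_{24}^{5})$ or $T^4$. - If $n=6$, then $A$ has level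 $4$ if and only if it can be represented by $T^{2,2}(\epsilon_{34}^{6})$, $T^3(\epsilon_{23}^{5})$, $T^3(\epsilon_{24}^{6})$ or $T^{3,2}$. - If $n=7$ or $n=8$, then $A$ has level $4$ if and only if it can be represented by $T^{2,2}(\epsilon_{34}^{n})$, $T^3(\epsilon_{23}^{n-1})$, $T^3(\epsilon_{24}^{n})$, $T^{2,2,2}(\epsilon_{23}^{n})$ or $T^{3,2}$. - If $n\ge9$, then $A$ has level $4$ if and only if it can be represented by $\eta_4$, $T^{2,2}(\epsilon_{34}^{n})$, $T^3(\epsilon_{23}^{n-1})$, $T^3(\epsilon_{24}^{n})$, $T^{2,2,2}(\epsilon_{23}^{n})$, $T^{3,2}$ or $T^{2,2,2,2}$. -/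

import Mathlib

open Module

noncomputable section

/-- The `n`-dimensional algebra structures on `V = k ^ n`: bilinear maps `V × V → V`. -/
abbrev AlgStr (k : Type*) [Field k] (n : ℕ) : Type _ :=
  (Fin n → k) →ₗ[k] (Fin n → k) →ₗ[k] (Fin n → k)

/-- The structure constants of `μ` in the standard basis: the coordinate `(i, j, l)` is the
coefficient of `e_l` in `μ (e_i, e_j)`. This identifies `AlgStr k n` with the affine space of
dimension `n ^ 3`. -/
def AlgStr.coords {k : Type*} [Field k] {n : ℕ} (μ : AlgStr k n) : Fin n × Fin n × Fin n → k :=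
  fun p => μ (Pi.single p.1 1) (Pi.single p.2.1 1) p.2.2

/-- The action of `GL(V)` on structures: `(g * μ)(x, y) = g (μ (g⁻¹ x, g⁻¹ y))`. -/
def AlgStr.act {k : Type*} [Field k] {n : ℕ} (g : (Fin n → k) ≃ₗ[k] (Fin n → k))
    (μ : AlgStr k n) : AlgStr k n :=
  (μ.compl₁₂ g.symm.toLinearMap g.symm.toLinearMap).compr₂ g.toLinearMap

/-- The orbit of `μ` under `GL(V)`. Two structures represent isomorphic algebras if and only if
they have the same orbit. -/
def AlgStr.orbit {k : Type*} [Field k] {n : ℕ} (μ : AlgStr k n) : Set (AlgStr k n) :=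
  Set.range fun g : (Fin n → k) ≃ₗ[k] (Fin n → k) => AlgStr.act g μ

/-- `μ` degenerates to `χ`: the structure `χ` lies in the Zariski closure (the zero locus of the
vanishing ideal) of the orbit of `μ`. -/
def AlgStr.Degenerates {k : Type*} [Field k] {n : ℕ} (μ χ : AlgStr k n) : Prop :=
  χ.coords ∈ MvPolynomial.zeroLocus k
    (MvPolynomial.vanishingIdeal k (AlgStr.coords '' μ.orbit))

/-- `μ` degenerates to `χ` non-trivially, that is, the two are not isomorphic. -/
def AlgStr.ProperlyDegenerates {k : Type*} [Field k] {n : ℕ} (μ χ : AlgStr k n) : Prop :=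
  μ.Degenerates χ ∧ χ ∉ μ.orbit

/-- The algebra `A` can be represented by the structure `μ`. -/
def IsRepresentedBy {k : Type*} [Field k] (A : Type*) [NonUnitalNonAssocRing A] [Module k A]
    {n : ℕ} (μ : AlgStr k n) : Prop :=
  ∃ e : A ≃ₗ[k] (Fin n → k), ∀ a b : A, e (a * b) = μ (e a) (e b)

/-- There is a sequence of `m` non-trivial degenerations of algebras, of the same dimension as `A`,
that starts at `A`. -/
def HasDegenerationChain (k : Type*) [Field k] (A : Type*) [NonUnitalNonAssocRing A] [Module k A]
    (m : ℕ) : Prop :=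
  ∃ f : Fin (m + 1) → AlgStr k (finrank k A),
    IsRepresentedBy A (f 0) ∧ ∀ i : Fin m, (f i.castSucc).ProperlyDegenerates (f i.succ)

/-- The algebra `A` has level `m`: the maximal length of a sequence of non-trivial degenerations
that starts at `A` is `m`. -/
def HasLevel (k : Type*) [Field k] (A : Type*) [NonUnitalNonAssocRing A] [Module k A]
    (m : ℕ) : Prop :=
  IsGreatest {l : ℕ | HasDegenerationChain k A l} m

/-- `A` is anticommutative: all squares are zero. -/
def IsAnticommutative (A : Type*) [NonUnitalNonAssocRing A] : Prop :=
  ∀ a : A, a * a = 0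

/-- `A` is Engel: for some `m > 0`, the `m`-th power of every left multiplication is zero. -/
def IsEngel (k : Type*) [Field k] (A : Type*) [NonUnitalNonAssocRing A] [Module k A]
    [SMulCommClass k A A] [IsScalarTower k A A] : Prop :=
  ∃ m : ℕ, 0 < m ∧ ∀ a : A, LinearMap.mulLeft k a ^ m = 0

/-- The anticommutative structure with the multiplication table `T`. Basis vectors are numbered
`e_1, …, e_n`; a triple `(i, j, l)` in `T`, with `i < j`, stands for `e_i e_j = e_l` (and
`e_j e_i = - e_l`), and products that are not determined in this way are zero. -/
def ofTable (k : Type*) [Field k] (n : ℕ) (T : Finset (ℕ × ℕ × ℕ)) : AlgStr k n :=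
  (Pi.basisFun k (Fin n)).constr k fun i =>
    (Pi.basisFun k (Fin n)).constr k fun j => fun l =>
      if ((i : ℕ) + 1, (j : ℕ) + 1, (l : ℕ) + 1) ∈ T then (1 : k)
      else if ((j : ℕ) + 1, (i : ℕ) + 1, (l : ℕ) + 1) ∈ T then -1
      else 0

/-- `η₄`, for `n ≥ 9`: `e₁e₂ = e₃e₄ = e₅e₆ = e₇e₈ = e₉`. -/
def eta4 (k : Type*) [Field k] (n : ℕ) : AlgStr k n :=
  ofTable k n {(1, 2, 9), (3, 4, 9), (5, 6, 9), (7, 8, 9)}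

/-- `T⁴`, for `n = 5`: `e₁e₂ = e₃`, `e₁e₃ = e₄`, `e₁e₄ = e₅`. -/
def T4 (k : Type*) [Field k] : AlgStr k 5 :=
  ofTable k 5 {(1, 2, 3), (1, 3, 4), (1, 4, 5)}

/-- `T³(ε₂₃ⁿ⁻¹)`, for `n ≥ 5`: `e₁e₂ = e₃`, `e₁e₃ = e_n`, `e₂e₃ = e_{n-1}`. -/
def T3eps23 (k : Type*) [Field k] (n : ℕ) : AlgStr k n :=
  ofTable k n {(1, 2, 3), (1, 3, n), (2, 3, n - 1)}

/-- `T³(ε₂₄ⁿ)`, for `n ≥ 5`: `e₁e₂ = e₃`, `e₁e₃ = e₂e₄ = e_n`. -/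
def T3eps24 (k : Type*) [Field k] (n : ℕ) : AlgStr k n :=
  ofTable k n {(1, 2, 3), (1, 3, n), (2, 4, n)}

/-- `T²²(ε₃₄ⁿ)`, for `n ≥ 6`: `e₁e₂ = e_{n-1}`, `e₁e₃ = e₃e₄ = e_n`. -/
def T22eps34 (k : Type*) [Field k] (n : ℕ) : AlgStr k n :=
  ofTable k n {(1, 2, n - 1), (1, 3, n), (3, 4, n)}

/-- `T³²`, for `n ≥ 6`: `e₁e₂ = e_{n-1}`, `e₁e₃ = e₄`, `e₁e₄ = e_n`. -/
def T32 (k : Type*) [Field k] (n : ℕ) : AlgStr k n :=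
  ofTable k n {(1, 2, n - 1), (1, 3, 4), (1, 4, n)}

/-- `T²²²(ε₂₃ⁿ)`, for `n ≥ 7`: `e₁e₂ = e_{n-2}`, `e₁e₃ = e_{n-1}`, `e₁e₄ = e_n`, `e₂e₃ = e_n`. -/
def T222eps23 (k : Type*) [Field k] (n : ℕ) : AlgStr k n :=
  ofTable k n {(1, 2, n - 2), (1, 3, n - 1), (1, 4, n), (2, 3, n)}

/-- `T²²²²`, for `n ≥ 9`: `e₁e₂ = e_{n-3}`, `e₁e₃ = e_{n-2}`, `e₁e₄ = e_{n-1}`, `e₁e₅ = e_n`. -/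
def T2222 (k : Type*) [Field k] (n : ℕ) : AlgStr k n :=
  ofTable k n {(1, 2, n - 3), (1, 3, n - 2), (1, 4, n - 1), (1, 5, n)}

end

/-! Degeneration is a preorder on structures, and it is antisymmetric up to isomorphism
(`Degenerates.mem_orbit`): by Chevalley's theorem an orbit contains a dense open part of its
closure, so two orbits with the same closure meet. The level is therefore a height in a partial
order. The proof fixes an explicit list of structures, sorted by their expected level 0 to 4
(`IsLevel`), and rests on three facts.

Descent (`IsLevel.exists_step`): each listed structure of level d + 1 degenerates properly to a
listed one of level d. Degenerations come from weights: multiply the basis vectors by powers of t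
and let t tend to 0, which keeps exactly the products whose weight is the sum of the weights of the
factors (`degenerates_of_weights`).

Separation (`IsLevel.mem_orbit_of_degenerates`): listed structures of the same level do not
degenerate to each other unless they are isomorphic. Each pair is separated by a closed,
GL-invariant condition: ranks of left multiplications, of the span of products or of the forms f ∘
μ, Pfaffians of these forms, dependence of xy, yz, zx, or vanishing of triple products.

Exhaustion (`level_of_nilpotent`): for n ≥ 5, an alternating structure with nilpotent left
multiplications either degenerates to a listed structure of level 4 or is isomorphic to a listed one
of level at most 3. If all squares of left multiplications vanish, then either some a(bc) ≠ 0, which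
already yields level 4, or the product is two-step nilpotent; the latter case is split by the
maximal rank of a left multiplication: at least 4, or 3, 2, 1, 0. If some square is non-zero, a
generic left multiplication of rank at least 3 contains the Jordan pattern of T³² (or of T⁴ when n =
5; a sixth dimension makes such a string degenerate to T³², which is why T⁴ is listed only for n =
5), while rank at most 2 is pinned down by nilpotency to T³ or yields level 4.

The alternating Engel condition with a fixed exponent is closed, so it is inherited along chains.
Hence the listed levels bound the lengths of chains (`IsLevel.le_of_hasChain`), and an unlisted
structure that degenerates to level 4 starts a chain of length 5. The small-dimensional cases drop
those tables that need more than n basis vectors. -/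

namespace AlgStr

variable {k : Type*} [Field k] {n : ℕ}

/-! ### Orbits, polynomial functions of structures, and degeneration as a preorder -/

@[simp] lemma act_apply (g : (Fin n → k) ≃ₗ[k] (Fin n → k)) (μ : AlgStr k n) (x y : Fin n → k) :
    act g μ x y = g (μ (g.symm x) (g.symm y)) := rfl

lemma ext_coords {μ χ : AlgStr k n} (h : ∀ i j l, μ.coords (i, j, l) = χ.coords (i, j, l)) :
    μ = χ := by
  refine (Pi.basisFun k (Fin n)).ext fun i => (Pi.basisFun k (Fin n)).ext fun j => ?_
  ext l
  simpa [coords] using h i j l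

lemma coords_injective : Function.Injective (coords : AlgStr k n → _) := fun _ _ h =>
  ext_coords fun i j l => congrFun h (i, j, l)

lemma mem_orbit_self (μ : AlgStr k n) : μ ∈ μ.orbit :=
  ⟨LinearEquiv.refl k _, by ext; simp⟩

lemma act_mem_orbit (g : (Fin n → k) ≃ₗ[k] (Fin n → k)) (μ : AlgStr k n) : act g μ ∈ μ.orbit :=
  ⟨g, rfl⟩

lemma mem_orbit_symm {μ χ : AlgStr k n} (h : χ ∈ μ.orbit) : μ ∈ χ.orbit := by
  obtain ⟨g, rfl⟩ := h
  refine ⟨g.symm, ?_⟩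
  refine LinearMap.ext fun _ => LinearMap.ext fun _ => ?_
  simp

lemma mem_orbit_trans {μ ν χ : AlgStr k n} (h : ν ∈ μ.orbit) (h' : χ ∈ ν.orbit) :
    χ ∈ μ.orbit := by
  obtain ⟨g, rfl⟩ := h
  obtain ⟨g', rfl⟩ := h'
  exact ⟨g.trans g', rfl⟩

/-- A function on structures that is polynomial in the structure constants. -/
def IsPoly (F : AlgStr k n → k) : Prop :=
  ∃ p : MvPolynomial (Fin n × Fin n × Fin n) k, ∀ ν, F ν = MvPolynomial.eval ν.coords p

namespace IsPoly

variable {F G : AlgStr k n → k}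

lemma const (c : k) : IsPoly (fun _ : AlgStr k n => c) := ⟨MvPolynomial.C c, by simp⟩

lemma add (hF : IsPoly F) (hG : IsPoly G) : IsPoly (fun ν => F ν + G ν) := by
  obtain ⟨p, hp⟩ := hF
  obtain ⟨q, hq⟩ := hG
  exact ⟨p + q, by simp [hp, hq]⟩

lemma sub (hF : IsPoly F) (hG : IsPoly G) : IsPoly (fun ν => F ν - G ν) := by
  obtain ⟨p, hp⟩ := hF
  obtain ⟨q, hq⟩ := hG
  exact ⟨p - q, by simp [hp, hq]⟩

lemma mul (hF : IsPoly F) (hG : IsPoly G) : IsPoly (fun ν => F ν * G ν) := by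
  obtain ⟨p, hp⟩ := hF
  obtain ⟨q, hq⟩ := hG
  exact ⟨p * q, by simp [hp, hq]⟩

lemma sum {ι : Type*} (s : Finset ι) {F : ι → AlgStr k n → k} (h : ∀ i, IsPoly (F i)) :
    IsPoly (fun ν => ∑ i ∈ s, F i ν) := by
  choose p hp using h
  exact ⟨∑ i ∈ s, p i, by simp [hp]⟩

lemma prod {ι : Type*} (s : Finset ι) {F : ι → AlgStr k n → k} (h : ∀ i, IsPoly (F i)) :
    IsPoly (fun ν => ∏ i ∈ s, F i ν) := by
  choose p hp using h
  exact ⟨∏ i ∈ s, p i, by simp [hp]⟩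

lemma det {m : ℕ} {F : Fin m → Fin m → AlgStr k n → k} (h : ∀ i j, IsPoly (F i j)) :
    IsPoly (fun ν => (Matrix.of fun i j => F i j ν).det) := by
  simp only [Matrix.det_apply', Matrix.of_apply]
  exact sum _ fun σ => (const _).mul (prod _ fun i => h _ _)

lemma coords (i j l : Fin n) : IsPoly (fun ν : AlgStr k n => ν.coords (i, j, l)) :=
  ⟨MvPolynomial.X (i, j, l), by simp⟩

lemma eval {q : Fin n × Fin n × Fin n → AlgStr k n → k} (h : ∀ s, IsPoly (q s))
    (p : MvPolynomial (Fin n × Fin n × Fin n) k) :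
    IsPoly (fun ν => MvPolynomial.eval (fun s => q s ν) p) := by
  choose r hr using h
  refine ⟨MvPolynomial.bind₁ r p, fun ν => ?_⟩
  show MvPolynomial.eval (fun s => q s ν) p = MvPolynomial.aeval ν.coords _
  rw [MvPolynomial.aeval_bind₁]
  simp only [hr]
  rfl

lemma comp_smul (ν : AlgStr k n) (f : (Fin n → k) →ₗ[k] k) (x y : Fin n → k) :
    f (ν x y) = ∑ i, ∑ j, ∑ l, x i * y j * f (Pi.single l 1) * ν.coords (i, j, l) := by
  have hx : ∀ z : Fin n → k, z = ∑ i, z i • (Pi.single i 1 : Fin n → k) := fun z => by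
    simpa using ((Pi.basisFun k (Fin n)).sum_repr z).symm
  conv_lhs => rw [hx x, hx y]
  simp only [map_sum, map_smul, LinearMap.sum_apply, LinearMap.smul_apply, smul_eq_mul]
  simp only [Finset.mul_sum]
  rw [Finset.sum_comm]
  refine Finset.sum_congr rfl fun i _ => Finset.sum_congr rfl fun j _ => ?_
  conv_lhs => rw [hx (ν (Pi.single i 1) (Pi.single j 1))]
  simp only [map_sum, map_smul, smul_eq_mul, Finset.mul_sum, AlgStr.coords]
  refine Finset.sum_congr rfl fun l _ => ?_
  ring

lemma apply (f : (Fin n → k) →ₗ[k] k) (x y : Fin n → k) :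
    IsPoly (fun ν : AlgStr k n => f (ν x y)) := by
  simp only [comp_smul]
  exact sum _ fun i => sum _ fun j => sum _ fun l => (const _).mul (coords _ _ _)

lemma apply_apply (f : (Fin n → k) →ₗ[k] k) (x y z : Fin n → k) :
    IsPoly (fun ν : AlgStr k n => f (ν x (ν y z))) := by
  have h : ∀ ν : AlgStr k n, f (ν x (ν y z)) =
      ∑ l, LinearMap.proj (R := k) l (ν y z) * f (ν x (Pi.single l 1)) := fun ν => by
    conv_lhs => rw [show ν y z = ∑ i, (ν y z) i • (Pi.single i 1 : Fin n → k) by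
      simpa using ((Pi.basisFun k (Fin n)).sum_repr (ν y z)).symm]
    simp
  simp only [h]
  exact sum _ fun l => (apply _ _ _).mul (apply _ _ _)

lemma comp_act (hF : IsPoly F) (g : (Fin n → k) ≃ₗ[k] (Fin n → k)) :
    IsPoly (fun ν => F (act g ν)) := by
  obtain ⟨p, hp⟩ := hF
  simp only [hp]
  exact eval (q := fun s ν => (act g ν).coords s)
    (fun s => apply ((LinearMap.proj s.2.2).comp g.toLinearMap) _ _) p

end IsPoly

lemma degenerates_iff {μ χ : AlgStr k n} :
    μ.Degenerates χ ↔ ∀ F : AlgStr k n → k, IsPoly F → (∀ ν ∈ μ.orbit, F ν = 0) → F χ = 0 := by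
  simp only [Degenerates, MvPolynomial.mem_zeroLocus_iff, MvPolynomial.mem_vanishingIdeal_iff,
    Set.forall_mem_image]
  constructor
  · rintro h F ⟨p, hp⟩ hF
    rw [hp]
    exact h p fun ν hν => by simpa [hp] using hF ν hν
  · intro h p hp
    exact h _ ⟨p, fun _ => rfl⟩ fun ν hν => hp hν

lemma Degenerates.eq_zero {μ χ : AlgStr k n} (h : μ.Degenerates χ) {F : AlgStr k n → k}
    (hF : IsPoly F) (h0 : ∀ ν ∈ μ.orbit, F ν = 0) : F χ = 0 :=
  degenerates_iff.1 h F hF h0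

lemma degenerates_of_mem_orbit {μ χ : AlgStr k n} (h : χ ∈ μ.orbit) : μ.Degenerates χ :=
  degenerates_iff.2 fun _ _ h0 => h0 _ h

/-- Orbit closures are stable under GL(V), because a polynomial function composed with the action of
a fixed g is again polynomial. So the closure of the orbit of `μ` contains the whole orbit of `ν`,
hence its closure. -/
lemma Degenerates.trans {μ ν χ : AlgStr k n} (h : μ.Degenerates ν) (h' : ν.Degenerates χ) :
    μ.Degenerates χ := by
  refine degenerates_iff.2 fun F hF h0 => h'.eq_zero hF ?_
  rintro _ ⟨g, rfl⟩
  exact h.eq_zero (hF.comp_act g) fun ν' hν' => h0 _ (mem_orbit_trans hν' (act_mem_orbit g ν'))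

/-- The value at `0` of a polynomial family whose members over `t ≠ 0` lie in the orbit of `μ` is
a degeneration of `μ`. -/
lemma degenerates_of_family [Infinite k] {μ χ : AlgStr k n}
    (P : Fin n × Fin n × Fin n → Polynomial k)
    (h : ∀ t : k, t ≠ 0 → ∃ ν ∈ μ.orbit, ∀ s, ν.coords s = (P s).eval t)
    (h0 : ∀ s, χ.coords s = (P s).eval 0) : μ.Degenerates χ := by
  refine degenerates_iff.2 ?_
  rintro F ⟨p, hp⟩ hF
  have key : ∀ t, (MvPolynomial.aeval P p).eval t = MvPolynomial.eval (fun s => (P s).eval t) p := by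
    intro t
    rw [← Polynomial.coe_evalRingHom, MvPolynomial.aeval_def, MvPolynomial.hom_eval₂,
      MvPolynomial.eval, MvPolynomial.coe_eval₂Hom]
    congr 1
    ext
    simp
  -- Along the family, `p` becomes a polynomial in t that vanishes at every non-zero t; over an
  -- infinite field it is zero, so it vanishes at t = 0 as well.
  have hz : MvPolynomial.aeval P p = 0 := by
    refine Polynomial.eq_zero_of_infinite_isRoot _ (Set.Infinite.mono ?_
      (Set.Finite.infinite_compl (Set.finite_singleton (0 : k))))
    intro t ht
    obtain ⟨ν, hν, hs⟩ := h t (by simpa using ht)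
    show Polynomial.eval t _ = 0
    rw [key, ← hF ν hν, hp]
    congr 2
    funext s
    rw [hs]
  rw [hp, show χ.coords = fun s => (P s).eval 0 from funext h0, ← key, hz, Polynomial.eval_zero]

/-- The structure constants of `μ` in the basis `b` form a structure in the orbit of `μ`. -/
lemma coords_act_equivFun (μ : AlgStr k n) (b : Basis (Fin n) k (Fin n → k)) (i j l : Fin n) :
    (act b.equivFun μ).coords (i, j, l) = b.repr (μ (b i) (b j)) l := by
  simp [coords]

end AlgStr

/-! ### Orbits are locally closed: antisymmetry of degeneration -/

/-- Chevalley's theorem for a polynomial map between affine spaces: the image of a nonempty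
principal open set contains a nonempty principal open subset of its closure. -/
lemma MvPolynomial.exists_open_subset_image {k σ τ : Type*} [Field k] [IsAlgClosed k]
    [Finite σ] [Finite τ] (ψ : MvPolynomial σ k →ₐ[k] MvPolynomial τ k) {d : MvPolynomial τ k}
    (hd : d ≠ 0) :
    ∃ f, ψ f ≠ 0 ∧ ∀ x : σ → k, (∀ p, ψ p = 0 → eval x p = 0) → eval x f ≠ 0 →
      ∃ y : τ → k, eval y d ≠ 0 ∧ ∀ s, x s = eval y (ψ (X s)) := by
  have hfin : (ψ : MvPolynomial σ k →+* MvPolynomial τ k).FinitePresentation := by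
    refine RingHom.FinitePresentation.of_finiteType.1
      (RingHom.FiniteType.of_comp_finiteType (f := (C : k →+* MvPolynomial σ k)) ?_)
    have : (ψ : MvPolynomial σ k →+* MvPolynomial τ k).comp C = algebraMap k _ := by
      ext; simp
    rw [this, RingHom.finiteType_algebraMap]
    infer_instance
  have hc := PrimeSpectrum.isConstructible_comap_image hfin
    (PrimeSpectrum.isCompact_basicOpen d |>.isConstructible
      (PrimeSpectrum.basicOpen d).isOpen)
  obtain ⟨S, hS⟩ := PrimeSpectrum.exists_constructibleSetData_iff.2 hc
  -- The image of the generic point lies in the image of the open set. The basic constructible piece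
  -- that contains it supplies `f`: its closed conditions hold on the whole closure of the image,
  -- since they lie in the kernel of `ψ`, so only `D.f ≠ 0` remains to be checked at a closed point.
  have hgen : PrimeSpectrum.comap (ψ : MvPolynomial σ k →+* MvPolynomial τ k) ⊥ ∈ S.toSet := by
    rw [hS]
    exact ⟨⊥, by simpa using hd, rfl⟩
  simp only [PrimeSpectrum.ConstructibleSetData.toSet, Set.mem_iUnion] at hgen
  obtain ⟨D, hDS, hD⟩ := hgen
  simp only [PrimeSpectrum.BasicConstructibleSetData.toSet, Set.mem_sdiff,
    PrimeSpectrum.mem_zeroLocus, Set.singleton_subset_iff] at hD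
  have hker : ∀ p, p ∈ (PrimeSpectrum.comap (ψ : MvPolynomial σ k →+* MvPolynomial τ k)
      ⊥).asIdeal ↔ ψ p = 0 := fun p => by
    rw [PrimeSpectrum.comap_asIdeal, Ideal.mem_comap]
    exact Ideal.mem_bot
  refine ⟨D.f, fun h => hD.2 ((hker _).2 h), fun x hx hf => ?_⟩
  let m : PrimeSpectrum (MvPolynomial σ k) :=
    ⟨vanishingIdeal k {x}, Ideal.IsMaximal.isPrime inferInstance⟩
  have hm : m ∈ S.toSet := by
    simp only [PrimeSpectrum.ConstructibleSetData.toSet, Set.mem_iUnion]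
    refine ⟨D, hDS, ?_⟩
    simp only [PrimeSpectrum.BasicConstructibleSetData.toSet, Set.mem_sdiff,
      PrimeSpectrum.mem_zeroLocus, Set.singleton_subset_iff]
    refine ⟨fun p hp => ?_, fun h => hf ?_⟩
    · exact (mem_vanishingIdeal_singleton_iff x p).2 (hx p ((hker _).1 (hD.1 hp)))
    · exact (mem_vanishingIdeal_singleton_iff x _).1 h
  rw [hS] at hm
  obtain ⟨q, hq, hqm⟩ := hm
  have hq : d ∉ q.asIdeal := hq
  -- The preimage `q` of the closed point need not be closed. As polynomial rings are Jacobson, `q`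
  -- lies in a maximal ideal that still avoids `d`, and by the Nullstellensatz this is a point `y`.
  have hj : q.asIdeal.jacobson = q.asIdeal := IsJacobsonRing.out' _ q.2.isRadical
  obtain ⟨M, ⟨hMq, hM⟩, hdM⟩ : ∃ M : Ideal (MvPolynomial τ k),
      (q.asIdeal ≤ M ∧ M.IsMaximal) ∧ d ∉ M := by
    by_contra! hcon
    refine hq (hj ▸ ?_)
    exact Submodule.mem_sInf.2 fun M hM => hcon M hM
  obtain ⟨y, rfl⟩ := isMaximal_iff_eq_vanishingIdeal_singleton.1 hM
  refine ⟨y, fun h => hdM ((mem_vanishingIdeal_singleton_iff y d).2 h), fun s => ?_⟩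
  have h1 : X s - C (x s) ∈ m.asIdeal := (mem_vanishingIdeal_singleton_iff x _).2 (by simp)
  rw [← hqm] at h1
  have h2 := (mem_vanishingIdeal_singleton_iff y _).1 (hMq h1)
  simp only [RingHom.coe_coe, map_sub, algHom_C, algebraMap_eq] at h2
  exact (sub_eq_zero.1 h2).symm

namespace AlgStr

variable {k : Type*} [Field k] {n : ℕ}

/-- The structure constants of `det g • (g⁻¹ * μ)`, as polynomials in the entries of `g`. -/
def twist {R : Type*} [CommRing R] (g : Matrix (Fin n) (Fin n) R)
    (c : Fin n × Fin n × Fin n → R) (s : Fin n × Fin n × Fin n) : R :=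
  ∑ a, ∑ b, ∑ l, g.adjugate s.2.2 l * (g a s.1 * g b s.2.1 * c (a, b, l))

lemma map_twist {R S : Type*} [CommRing R] [CommRing S] (φ : R →+* S)
    (g : Matrix (Fin n) (Fin n) R) (c : Fin n × Fin n × Fin n → R) (s) :
    φ (twist g c s) = twist (φ.mapMatrix g) (φ ∘ c) s := by
  simp only [twist, map_sum, map_mul, ← RingHom.map_adjugate]
  rfl

lemma apply_eq_sum_coords (μ : AlgStr k n) (x y : Fin n → k) (l : Fin n) :
    μ x y l = ∑ a, ∑ b, x a * y b * μ.coords (a, b, l) := by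
  have := IsPoly.comp_smul μ (LinearMap.proj l) x y
  simp only [LinearMap.proj_apply] at this
  rw [this]
  refine Finset.sum_congr rfl fun a _ => Finset.sum_congr rfl fun b _ => ?_
  simp [Pi.single_apply]

lemma coords_act_symm (μ : AlgStr k n) (e : (Fin n → k) ≃ₗ[k] (Fin n → k)) (s) :
    (LinearMap.toMatrix' e.toLinearMap).det * (act e.symm μ).coords s =
      twist (LinearMap.toMatrix' e.toLinearMap) μ.coords s := by
  obtain ⟨i, j, l⟩ := s
  set G := LinearMap.toMatrix' e.toLinearMap with hG
  have h1 : ∀ w : Fin n → k, G.det • e.symm w = G.adjugate.mulVec w := by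
    intro w
    obtain ⟨v, rfl⟩ := e.surjective w
    have : e v = G.mulVec v := by
      rw [hG, ← Matrix.toLin'_apply, Matrix.toLin'_toMatrix']; rfl
    rw [e.symm_apply_apply, this, Matrix.mulVec_mulVec, Matrix.adjugate_mul, Matrix.smul_mulVec,
      Matrix.one_mulVec]
  have h2 := congrFun (h1 (μ (e (Pi.single i 1)) (e (Pi.single j 1)))) l
  have h3 : ∀ i a, e (Pi.single i 1) a = G a i := fun i a => by
    rw [hG, LinearMap.toMatrix'_apply]; simp
  simp only [Pi.smul_apply, smul_eq_mul, Matrix.mulVec, dotProduct, apply_eq_sum_coords, h3] at h2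
  simp only [twist, coords, act_apply, LinearEquiv.symm_symm] at h2 ⊢
  rw [h2]
  simp only [Finset.mul_sum]
  rw [Finset.sum_comm]
  refine Finset.sum_congr rfl fun a _ => ?_
  rw [Finset.sum_comm]

/-- A product has two arguments and one value, so the homothety by `c⁻¹` multiplies it by `c`. Hence
the factor det g in `twist` does not leave the orbit, and orbits can be parametrized by polynomials
without dividing by the determinant. -/
lemma smul_mem_orbit (μ : AlgStr k n) {c : k} (hc : c ≠ 0) : c • μ ∈ μ.orbit := by
  refine ⟨LinearEquiv.smulOfNeZero k _ c⁻¹ (inv_ne_zero hc), ?_⟩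
  refine LinearMap.ext fun x => LinearMap.ext fun y => ?_
  have : (LinearEquiv.smulOfNeZero k (Fin n → k) c⁻¹ (inv_ne_zero hc)).symm.toLinearMap =
      c • LinearMap.id := by
    refine LinearMap.ext fun z => ?_
    rw [LinearEquiv.coe_coe, LinearEquiv.symm_apply_eq]
    simp [hc]
  have h2 : ∀ z, (LinearEquiv.smulOfNeZero k (Fin n → k) c⁻¹ (inv_ne_zero hc)).symm z = c • z :=
    fun z => LinearMap.congr_fun this z
  simp [h2, hc]

lemma exists_coords_eq_twist (μ : AlgStr k n) {g : Matrix (Fin n) (Fin n) k} (hg : g.det ≠ 0) :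
    ∃ ν ∈ μ.orbit, ν.coords = twist g μ.coords := by
  have hu : IsUnit (LinearMap.toMatrix' (Matrix.toLin' g)).det := by simpa using hg
  let e := LinearEquiv.ofIsUnitDet (f := Matrix.toLin' g) (v := Pi.basisFun k _)
    (v' := Pi.basisFun k _) (by simpa [LinearMap.toMatrix_eq_toMatrix'] using hu)
  have he : LinearMap.toMatrix' e.toLinearMap = g := by
    have : e.toLinearMap = Matrix.toLin' g := LinearMap.ext fun _ => rfl
    rw [this, LinearMap.toMatrix'_toLin']
  refine ⟨g.det • act e.symm μ, mem_orbit_trans (act_mem_orbit _ _) (smul_mem_orbit _ hg), ?_⟩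
  funext s
  rw [← he, ← coords_act_symm]
  simp [coords]

lemma exists_twist_eq_coords [IsAlgClosed k] {μ ν : AlgStr k n} (hν : ν ∈ μ.orbit) :
    ∃ g : Matrix (Fin n) (Fin n) k, g.det ≠ 0 ∧ twist g μ.coords = ν.coords := by
  obtain ⟨h, rfl⟩ := hν
  set H := LinearMap.toMatrix' h.symm.toLinearMap with hH
  have hdet : H.det ≠ 0 := by
    rw [hH, LinearMap.det_toMatrix']
    exact (LinearEquiv.isUnit_det' h.symm).ne_zero
  -- Replacing `H` by `c • H` multiplies `twist` by `c ^ (n - 1 + 2)`: degree n - 1 from the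
  -- adjugate and 2 from the arguments. Here `c` is chosen so that this cancels the determinant.
  obtain ⟨c, hc⟩ := IsAlgClosed.exists_pow_nat_eq H.det⁻¹ (n := n - 1 + 2) (by omega)
  have hc0 : c ≠ 0 := by
    rintro rfl
    rw [zero_pow (by omega)] at hc
    exact inv_ne_zero hdet hc.symm
  refine ⟨c • H, ?_, ?_⟩
  · rw [Matrix.det_smul]
    exact mul_ne_zero (pow_ne_zero _ hc0) hdet
  · funext s
    have h1 := coords_act_symm μ h.symm s
    rw [← hH, LinearEquiv.symm_symm] at h1
    have h2 : twist (c • H) μ.coords s = c ^ (n - 1 + 2) * twist H μ.coords s := by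
      simp only [twist, Matrix.adjugate_smul, Matrix.smul_apply, smul_eq_mul, Finset.mul_sum,
        Fintype.card_fin]
      refine Finset.sum_congr rfl fun a _ => Finset.sum_congr rfl fun b _ =>
        Finset.sum_congr rfl fun l _ => ?_
      ring
    rw [h2, hc, ← h1, inv_mul_cancel_left₀ hdet]

/-- Structures that degenerate to each other are isomorphic. -/
theorem Degenerates.mem_orbit [IsAlgClosed k] {μ χ : AlgStr k n} (h : μ.Degenerates χ)
    (h' : χ.Degenerates μ) : χ ∈ μ.orbit := by
  let gen := Matrix.mvPolynomialX (Fin n) (Fin n) k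
  let ψ : MvPolynomial (Fin n × Fin n × Fin n) k →ₐ[k] MvPolynomial (Fin n × Fin n) k :=
    MvPolynomial.aeval (twist gen (MvPolynomial.C ∘ μ.coords))
  have hψ : ∀ (g : Matrix (Fin n) (Fin n) k) p, MvPolynomial.eval (fun s => g s.1 s.2) (ψ p) =
      MvPolynomial.eval (twist g μ.coords) p := by
    intro g p
    have := MvPolynomial.aeval_def (R := k) (twist gen (MvPolynomial.C ∘ μ.coords)) p
    simp only [ψ]
    rw [this, MvPolynomial.hom_eval₂, MvPolynomial.eval, MvPolynomial.coe_eval₂Hom]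
    congr 1
    · ext; simp
    · funext s
      change MvPolynomial.eval (fun s : Fin n × Fin n => g s.1 s.2) _ = _
      rw [map_twist]
      congr 1
      · ext i j; simp [gen]
      · ext s; simp
  obtain ⟨f, hf, hx⟩ := MvPolynomial.exists_open_subset_image ψ
    (Matrix.det_mvPolynomialX_ne_zero (Fin n) k)
  have hdet : ∀ y : Fin n × Fin n → k, MvPolynomial.eval y gen.det =
      (Matrix.of fun i j => y (i, j)).det := fun y => by
    rw [RingHom.map_det]
    congr 1
    ext i j
    simp [gen]
  -- The kernel of `ψ` is the vanishing ideal of the orbit: matrices with non-zero determinant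
  -- suffice to test `ψ p`, because the generic determinant is not a zero divisor.
  have hker : ∀ p, ψ p = 0 ↔ ∀ ν ∈ μ.orbit, MvPolynomial.eval ν.coords p = 0 := by
    intro p
    constructor
    · intro hp ν hν
      obtain ⟨g, -, hg⟩ := exists_twist_eq_coords hν
      rw [← hg, ← hψ, hp, map_zero]
    · intro hp
      have : gen.det * ψ p = 0 := by
        refine MvPolynomial.funext fun y => ?_
        rw [map_mul, map_zero, mul_eq_zero, or_iff_not_imp_left]
        intro hy
        rw [hdet] at hy
        obtain ⟨ν, hν, hc⟩ := exists_coords_eq_twist μ hy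
        have := hψ (Matrix.of fun i j => y (i, j)) p
        simp only [Matrix.of_apply, Prod.mk.eta] at this
        rw [this, ← hc, hp ν hν]
      exact (mul_eq_zero.1 this).resolve_left (Matrix.det_mvPolynomialX_ne_zero (Fin n) k)
  -- Otherwise `f` would vanish on the orbit of `χ`, hence on the orbit of `μ` that lies in its
  -- closure, contrary to `ψ f ≠ 0`. The structure found here lies in the closure of the orbit of
  -- `μ` and in its open part, so in the orbit itself.
  have : ∃ ν ∈ χ.orbit, MvPolynomial.eval ν.coords f ≠ 0 := by
    by_contra! hcon
    refine hf ((hker f).2 fun ν hν => ?_)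
    exact (h'.trans (degenerates_of_mem_orbit hν)).eq_zero ⟨f, fun _ => rfl⟩ hcon
  obtain ⟨ν, hν, hνf⟩ := this
  obtain ⟨y, hy, hys⟩ := hx ν.coords (fun p hp =>
    (h.trans (degenerates_of_mem_orbit hν)).eq_zero ⟨p, fun _ => rfl⟩ ((hker p).1 hp)) hνf
  rw [hdet] at hy
  obtain ⟨ν', hν', hc⟩ := exists_coords_eq_twist μ hy
  have : ν' = ν := by
    refine coords_injective (hc.trans (funext fun s => ?_))
    rw [hys s]
    have := hψ (Matrix.of fun i j => y (i, j)) (MvPolynomial.X s)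
    simp only [Matrix.of_apply, Prod.mk.eta, MvPolynomial.eval_X] at this
    exact this.symm
  exact mem_orbit_trans (this ▸ hν') (mem_orbit_symm hν)

end AlgStr

/-! ### Degenerations from weighted bases, and structures given by multiplication tables -/

lemma LinearIndependent.exists_basis_extend {k V α : Type*} [Field k] [AddCommGroup V] [Module k V]
    {v : α → V} (hv : LinearIndependent k v) (N : Submodule k V)
    (hN : Submodule.span k (Set.range v) ⊔ N = ⊤) :
    ∃ (γ : Set V) (B : Basis (α ⊕ γ) k V), (∀ i, B (.inl i) = v i) ∧ ∀ c, B (.inr c) ∈ N := by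
  obtain ⟨b, hbt, hsb, htb, hb⟩ := exists_linearIndepOn_id_extension
    (hv.linearIndepOn_id) (Set.subset_union_left (t := (N : Set V)))
  have hγ : LinearIndependent k (Sum.elim v ((↑) : ↥(b \ Set.range v) → V)) := by
    have h1 : LinearIndepOn k id (Set.range v ∪ b \ Set.range v) := by
      rwa [Set.union_sdiff_cancel hsb]
    have h2 := (linearIndepOn_id_union_iff Set.disjoint_sdiff_right).1 h1
    exact hv.sum_type h2.2.1 (by rw [Subtype.range_coe]; exact h2.2.2)
  have hsp : ⊤ ≤ Submodule.span k
      (Set.range (Sum.elim v ((↑) : ↥(b \ Set.range v) → V))) := by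
    rw [Set.Sum.elim_range, Subtype.range_coe, Set.union_sdiff_cancel hsb, ← hN,
      ← Submodule.span_eq N, ← Submodule.span_union]
    exact Submodule.span_le.2 htb
  refine ⟨b \ Set.range v, Basis.mk hγ hsp, fun i => by rw [Basis.mk_apply]; rfl, fun c => ?_⟩
  rw [Basis.mk_apply]
  exact (hbt c.2.1).resolve_left c.2.2

namespace AlgStr

variable {k : Type*} [Field k] {n m : ℕ}

/-- A structure on whose orbit closure lies `χ`: if the structure constants of `μ` in the basis `b`
are bounded by the weights `W`, those of weight zero are the structure constants of `χ`. -/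
lemma degenerates_of_basis [Infinite k] {μ χ : AlgStr k n} (b : Basis (Fin n) k (Fin n → k))
    (W : Fin n → ℕ)
    (h : ∀ i j l, W i + W j ≤ W l → b.repr (μ (b i) (b j)) l = χ.coords (i, j, l))
    (h' : ∀ i j l, χ.coords (i, j, l) ≠ 0 → W l = W i + W j) : μ.Degenerates χ := by
  classical
  refine degenerates_of_family (fun s => if W s.2.2 ≤ W s.1 + W s.2.1 then
    Polynomial.C (b.repr (μ (b s.1) (b s.2.1)) s.2.2) *
      Polynomial.X ^ (W s.1 + W s.2.1 - W s.2.2) else 0) (fun t ht => ?_) ?_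
  -- In the rescaled basis t^(W i) b_i each structure constant acquires the factor t^(W i + W j - W
  -- l). Negative exponents occur only at zero constants, and positive ones disappear at t = 0.
  · let b' := b.isUnitSMul (w := fun i => t ^ W i) fun i => (pow_ne_zero _ ht).isUnit
    have hb' : ∀ i, b' i = t ^ W i • b i := fun i =>
      Basis.isUnitSMul_apply _ i
    have hr : ∀ x l, t ^ W l * b'.repr x l = b.repr x l := fun x l => by
      have := b'.sum_repr x
      conv_rhs => rw [← this]
      simp [hb', Finsupp.single_apply, mul_comm]
    refine ⟨act b'.equivFun μ, act_mem_orbit _ _, ?_⟩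
    rintro ⟨i, j, l⟩
    rw [coords_act_equivFun]
    refine mul_left_cancel₀ (pow_ne_zero (W l) ht) ?_
    rw [hr, hb', hb']
    simp only [map_smul, LinearMap.smul_apply, Finsupp.smul_apply, smul_eq_mul]
    split_ifs with hl
    · simp only [Polynomial.eval_mul, Polynomial.eval_C, Polynomial.eval_pow, Polynomial.eval_X]
      rw [← mul_assoc, ← pow_add, mul_comm (b.repr _ l), ← mul_assoc, ← pow_add]
      congr 2
      omega
    · have h0 : χ.coords (i, j, l) = 0 := by
        by_contra hne
        exact hl (h' i j l hne).le
      rw [h i j l (by omega), h0]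
      simp
  · rintro ⟨i, j, l⟩
    dsimp only
    split_ifs with hl
    · rcases hl.eq_or_lt with he | hlt
      · rw [← h i j l he.ge]
        simp [he]
      · have h0 : χ.coords (i, j, l) = 0 := by
          by_contra hne
          exact hlt.ne (h' i j l hne)
        rw [h0]
        simp [show W i + W j - W l ≠ 0 by omega]
    · rw [Polynomial.eval_zero]
      by_contra hne
      exact hl (h' i j l hne).le

/-- The structure constants of the multiplication table `T`: a triple `(i, j, l)` in `T` stands for
`e_i e_j = e_l = - e_j e_i`. -/
def tableCoeff (k : Type*) [Field k] (T : Finset (Fin m × Fin m × Fin m)) (i j l : Fin m) : k :=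
  if (i, j, l) ∈ T then 1 else if (j, i, l) ∈ T then -1 else 0

/-- `χ` has the multiplication table `T` on the basis vectors at the positions `pos`, and all
other products of basis vectors are zero. -/
structure IsTable (χ : AlgStr k n) (pos : Fin m → Fin n) (T : Finset (Fin m × Fin m × Fin m)) :
    Prop where
  inj : Function.Injective pos
  antisymm : ∀ i j l, (i, j, l) ∈ T → (j, i, l) ∉ T
  coords_pos : ∀ i j l, χ.coords (pos i, pos j, pos l) = tableCoeff k T i j l
  mem_range : ∀ a b c, χ.coords (a, b, c) ≠ 0 →
    a ∈ Set.range pos ∧ b ∈ Set.range pos ∧ c ∈ Set.range pos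

lemma tableCoeff_swap {T : Finset (Fin m × Fin m × Fin m)}
    (hT : ∀ i j l, (i, j, l) ∈ T → (j, i, l) ∉ T) (i j l : Fin m) :
    tableCoeff k T j i l = -tableCoeff k T i j l := by
  unfold tableCoeff
  by_cases h1 : (i, j, l) ∈ T
  · simp [h1, hT i j l h1]
  · by_cases h2 : (j, i, l) ∈ T <;> simp [h1, h2]

lemma tableCoeff_self {T : Finset (Fin m × Fin m × Fin m)}
    (hT : ∀ i j l, (i, j, l) ∈ T → (j, i, l) ∉ T) (i l : Fin m) :
    tableCoeff k T i i l = 0 := by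
  unfold tableCoeff
  have h : (i, i, l) ∉ T := fun h => hT i i l h h
  simp [h]

lemma coords_ofTable (T : Finset (ℕ × ℕ × ℕ)) (i j l : Fin n) :
    (ofTable k n T).coords (i, j, l) =
      if ((i : ℕ) + 1, (j : ℕ) + 1, (l : ℕ) + 1) ∈ T then (1 : k)
      else if ((j : ℕ) + 1, (i : ℕ) + 1, (l : ℕ) + 1) ∈ T then -1 else 0 := by
  have h : ∀ i : Fin n, (Pi.single i 1 : Fin n → k) = Pi.basisFun k (Fin n) i := fun i => by simp
  simp only [coords, ofTable, h, Basis.constr_basis]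

/-- Tables live on `Fin m` for a fixed small `m`, and `pos` places them among the n basis vectors.
Properties of tables can then be verified by `decide` although n is arbitrary. -/
lemma isTable_ofTable {pos : Fin m → Fin n} (hpos : Function.Injective pos)
    {T : Finset (Fin m × Fin m × Fin m)} (hT : ∀ i j l, (i, j, l) ∈ T → (j, i, l) ∉ T)
    {T' : Finset (ℕ × ℕ × ℕ)}
    (h : T' = T.image fun t => ((pos t.1 : ℕ) + 1, (pos t.2.1 : ℕ) + 1, (pos t.2.2 : ℕ) + 1)) :
    IsTable (ofTable k n T') pos T := by
  have key : ∀ i j l, ((pos i : ℕ) + 1, (pos j : ℕ) + 1, (pos l : ℕ) + 1) ∈ T' ↔ (i, j, l) ∈ T := by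
    intro i j l
    rw [h, Finset.mem_image]
    constructor
    · rintro ⟨⟨i', j', l'⟩, ht, he⟩
      simp only [Prod.mk.injEq, Nat.add_right_cancel_iff, Fin.val_inj, hpos.eq_iff] at he
      obtain ⟨rfl, rfl, rfl⟩ := he
      exact ht
    · intro ht
      exact ⟨_, ht, rfl⟩
  have key2 : ∀ a b c : Fin n, ((a : ℕ) + 1, (b : ℕ) + 1, (c : ℕ) + 1) ∈ T' →
      a ∈ Set.range pos ∧ b ∈ Set.range pos ∧ c ∈ Set.range pos := by
    intro a b c hm
    rw [h, Finset.mem_image] at hm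
    obtain ⟨⟨i, j, l⟩, -, he⟩ := hm
    simp only [Prod.mk.injEq, Nat.add_right_cancel_iff, Fin.val_inj] at he
    exact ⟨⟨i, he.1⟩, ⟨j, he.2.1⟩, ⟨l, he.2.2⟩⟩
  refine ⟨hpos, hT, fun i j l => ?_, fun a b c hne => ?_⟩
  · simp only [coords_ofTable, key, tableCoeff]
  · rw [coords_ofTable] at hne
    split_ifs at hne with h1 h2
    · exact key2 _ _ _ h1
    · obtain ⟨hb, ha, hc⟩ := key2 _ _ _ h2
      exact ⟨ha, hb, hc⟩
    · exact absurd rfl hne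

lemma swap_eq_neg {μ : AlgStr k n} (hμ : ∀ x, μ x x = 0) (x y : Fin n → k) :
    μ y x = -μ x y := by
  have := hμ (x + y)
  simp only [map_add, LinearMap.add_apply, hμ, zero_add, add_zero] at this
  exact eq_neg_of_add_eq_zero_right (by rw [add_comm]; exact this)

lemma exists_equiv_of_injective {α : Type*} [Fintype α] {pos : Fin m → Fin n}
    (hpos : Function.Injective pos) (e : Fin m ⊕ α ≃ Fin n) :
    ∃ e' : Fin m ⊕ α ≃ Fin n, ∀ i, e' (.inl i) = pos i := by
  classical
  let f : Fin m ≃ Set.range pos := Equiv.ofInjective pos hpos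
  have hc : Fintype.card α = Fintype.card ↥(Set.range pos)ᶜ := by
    have h1 := Fintype.card_congr e
    rw [Fintype.card_compl_set, ← Fintype.card_congr f]
    simp only [Fintype.card_sum, Fintype.card_fin] at h1 ⊢
    omega
  exact ⟨(Equiv.sumCongr f (Fintype.equivOfCardEq hc)).trans (Equiv.Set.sumCompl _), fun i => rfl⟩

/-- The vectors that complete `v` to a basis can be taken in `N`, where they annihilate everything.
The structure constants in this basis are then those of `χ`, once the vectors `v` are indexed by
`pos`. -/
lemma mem_orbit_of_table {μ χ : AlgStr k n} (hμ : ∀ x, μ x x = 0) {pos : Fin m → Fin n}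
    {T : Finset (Fin m × Fin m × Fin m)} (hχ : IsTable χ pos T) {v : Fin m → Fin n → k}
    (hv : LinearIndependent k v) (N : Submodule k (Fin n → k))
    (hN : Submodule.span k (Set.range v) ⊔ N = ⊤) (hz : ∀ u ∈ N, ∀ x, μ u x = 0)
    (h : ∀ i j, i < j → μ (v i) (v j) = ∑ l, tableCoeff k T i j l • v l) : χ ∈ μ.orbit := by
  classical
  obtain ⟨γ, B, hB, hBN⟩ := hv.exists_basis_extend N hN
  have : Finite (Fin m ⊕ γ) := Module.Finite.finite_basis B
  have : Finite γ := Finite.of_injective (Sum.inr : γ → Fin m ⊕ γ) Sum.inr_injective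
  have := Fintype.ofFinite γ
  obtain ⟨e, he⟩ := exists_equiv_of_injective hχ.inj (B.indexEquiv (Pi.basisFun k (Fin n)))
  let b := B.reindex e
  have hbi : ∀ p, b (e p) = B p := fun p => by simp [b]
  have hz' : ∀ u ∈ N, ∀ x, μ x u = 0 := fun u hu x => by
    rw [swap_eq_neg hμ u x, hz u hu, neg_zero]
  have h2 : ∀ i j, μ (v i) (v j) = ∑ l, tableCoeff k T i j l • v l := by
    intro i j
    rcases lt_trichotomy i j with hij | rfl | hij
    · exact h i j hij
    · simp [hμ, tableCoeff_self hχ.antisymm]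
    · rw [swap_eq_neg hμ (v j), h j i hij]
      simp [tableCoeff_swap hχ.antisymm j i]
  have hzero : ∀ a b c : Fin m ⊕ γ, (∀ i, a ≠ .inl i) ∨ (∀ i, b ≠ .inl i) ∨ (∀ i, c ≠ .inl i) →
      χ.coords (e a, e b, e c) = 0 := by
    intro a b c habc
    by_contra hne
    obtain ⟨⟨i, hi⟩, ⟨j, hj⟩, ⟨l, hl⟩⟩ := hχ.mem_range _ _ _ hne
    rw [← he, e.apply_eq_iff_eq] at hi hj hl
    rcases habc with h | h | h
    exacts [h i hi.symm, h j hj.symm, h l hl.symm]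
  have : χ = act b.equivFun μ := by
    refine ext_coords fun a b' c => ?_
    obtain ⟨p, rfl⟩ := e.surjective a
    obtain ⟨q, rfl⟩ := e.surjective b'
    obtain ⟨r, rfl⟩ := e.surjective c
    rw [coords_act_equivFun, hbi, hbi]
    rcases p with i | p
    · rcases q with j | q
      · rw [hB, hB, h2]
        simp only [map_sum, map_smul, ← hB, Basis.repr_reindex, b, Finsupp.coe_finsetSum,
          Finset.sum_apply, Finsupp.smul_apply, Finsupp.mapDomain_equiv_apply, e.symm_apply_apply,
          Basis.repr_self, smul_eq_mul]
        rcases r with l | r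
        · rw [he, he, he, hχ.coords_pos]
          simp [Finsupp.single_apply]
        · rw [hzero _ _ _ (by simp)]
          simp
      · rw [hz' _ (hBN q), hzero _ _ _ (by simp)]
        simp
    · rw [hz _ (hBN p), hzero _ _ _ (by simp)]
      simp
  rw [this]
  exact act_mem_orbit _ _

/-- The main tool for the construction of degenerations. If linearly independent vectors `v` with
positive weights multiply according to the table of `χ` up to terms of lower weight, as far as the
weight of the product does not exceed `W`, then `μ` degenerates to `χ`. -/
theorem degenerates_of_weights' [Infinite k] {μ χ : AlgStr k n} (hμ : ∀ x, μ x x = 0)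
    {pos : Fin m → Fin n} {T : Finset (Fin m × Fin m × Fin m)} (hχ : IsTable χ pos T)
    {β : Type*} [Finite β] {v : Fin m ⊕ β → Fin n → k} (hv : LinearIndependent k v)
    (w : Fin m ⊕ β → ℕ) (W : ℕ) (hW : 1 ≤ W) (hw : ∀ p, 1 ≤ w p ∧ w p ≤ W)
    (hT : ∀ i j l, (i, j, l) ∈ T → w (.inl l) = w (.inl i) + w (.inl j))
    (h₁ : ∀ i j, i < j → w (.inl i) + w (.inl j) ≤ W →
      μ (v (.inl i)) (v (.inl j)) - ∑ l, tableCoeff k T i j l • v (.inl l) ∈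
        Submodule.span k (v '' {r | w r < w (.inl i) + w (.inl j)}))
    (h₂ : ∀ i q, w (.inl i) + w (.inr q) ≤ W → μ (v (.inl i)) (v (.inr q)) ∈
        Submodule.span k (v '' {r | w r < w (.inl i) + w (.inr q)}))
    (h₃ : ∀ p q, w (.inr p) + w (.inr q) ≤ W → μ (v (.inr p)) (v (.inr q)) ∈
        Submodule.span k (v '' {r | w r < w (.inr p) + w (.inr q)})) : μ.Degenerates χ := by
  classical
  have := Fintype.ofFinite β
  obtain ⟨γ, B, hB, -⟩ := hv.exists_basis_extend ⊤ (by simp)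
  have : Finite ((Fin m ⊕ β) ⊕ γ) := Module.Finite.finite_basis B
  have : Finite γ := Finite.of_injective (Sum.inr : γ → (Fin m ⊕ β) ⊕ γ) Sum.inr_injective
  have := Fintype.ofFinite γ
  obtain ⟨e', he'⟩ := exists_equiv_of_injective hχ.inj
    ((Equiv.sumAssoc (Fin m) β γ).symm.trans (B.indexEquiv (Pi.basisFun k (Fin n))))
  let e := (Equiv.sumAssoc (Fin m) β γ).trans e'
  have he : ∀ i, e (.inl (.inl i)) = pos i := fun i => by simp [e, he']
  let b := B.reindex e
  have hbi : ∀ p, b (e p) = B p := fun p => by simp [b]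
  -- The completing vectors get the maximal weight `W`. All weights are at least 1, so a product
  -- that involves such a vector has weight above `W` and is never constrained. The vectors indexed
  -- by `β` only take part in the spans of lower weight; `χ` multiplies them trivially.
  let Wt : Fin n → ℕ := fun a => Sum.elim w (fun _ => W) (e.symm a)
  have hWt : ∀ p, Wt (e p) = Sum.elim w (fun _ => W) p := fun p => by simp [Wt]
  have hWt1 : ∀ a, 1 ≤ Wt a ∧ Wt a ≤ W := by
    intro a
    obtain ⟨p, rfl⟩ := e.surjective a
    rw [hWt]
    rcases p with p | p
    exacts [hw p, ⟨hW, le_rfl⟩]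
  let c : Fin m ⊕ β → Fin m ⊕ β → Fin m → k := fun p q l =>
    match p, q with
    | .inl i, .inl j => tableCoeff k T i j l
    | _, _ => 0
  have hc : ∀ p q l, c p q l ≠ 0 → w (.inl l) = w p + w q := by
    rintro (i | p) (j | q) l hne <;> simp only [c, ne_eq, not_true_eq_false] at hne
    unfold tableCoeff at hne
    split_ifs at hne with h1 h2
    · exact hT _ _ _ h1
    · rw [hT _ _ _ h2, add_comm]
    · exact absurd rfl hne
  have key : ∀ p q, w p + w q ≤ W → μ (v p) (v q) - ∑ l, c p q l • v (.inl l) ∈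
      Submodule.span k (v '' {r | w r < w p + w q}) := by
    rintro (i | p) (j | q) hle
    · rcases lt_trichotomy i j with hij | rfl | hij
      · exact h₁ i j hij hle
      · simp [hμ, c, tableCoeff_self hχ.antisymm]
      · have := Submodule.neg_mem _ (h₁ j i hij (by omega))
        rw [swap_eq_neg hμ (v (.inl j)), add_comm (w _)]
        convert! this using 1
        simp [c, tableCoeff_swap hχ.antisymm j i]
        abel
    · simpa [c] using h₂ i q hle
    · have := Submodule.neg_mem _ (h₂ j p (by omega))
      rw [swap_eq_neg hμ (v (.inl j)), add_comm (w _)]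
      simpa [c] using this
    · simpa [c] using h₃ p q hle
  -- Terms of weight below `w p + w q` have no coordinate at a basis vector of weight at least that
  -- sum, so only the table entries remain.
  have hrepr : ∀ p q r, w p + w q ≤ Wt (e r) → w p + w q ≤ W →
      b.repr (μ (v p) (v q)) (e r) = ∑ l, c p q l * if r = .inl (.inl l) then 1 else 0 := by
    intro p q r hr hW
    have h0 : ∀ x ∈ Submodule.span k (v '' {r | w r < w p + w q}), b.repr x (e r) = 0 := by
      intro x hx
      induction hx using Submodule.span_induction with
      | mem x hx =>
        obtain ⟨s, hs, rfl⟩ := hx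
        rw [← hB, ← hbi, Basis.repr_self, Finsupp.single_apply, if_neg]
        intro he2
        rw [← he2, hWt] at hr
        exact absurd hs (by simpa using hr)
      | zero => simp
      | add x y _ _ hx hy => simp [hx, hy]
      | smul a x _ hx => simp [hx]
    have h3 := h0 _ (key p q hW)
    rw [map_sub, Finsupp.sub_apply, sub_eq_zero] at h3
    rw [h3]
    simp only [map_sum, map_smul, ← hB, ← hbi, Basis.repr_self, Finsupp.coe_finsetSum,
      Finset.sum_apply, Finsupp.smul_apply, smul_eq_mul, Finsupp.single_apply,
      e.apply_eq_iff_eq, eq_comm]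
  have hzero : ∀ a b c : (Fin m ⊕ β) ⊕ γ, (∀ i, a ≠ .inl (.inl i)) ∨ (∀ i, b ≠ .inl (.inl i)) ∨
      (∀ i, c ≠ .inl (.inl i)) → χ.coords (e a, e b, e c) = 0 := by
    intro a b c habc
    by_contra hne
    obtain ⟨⟨i, hi⟩, ⟨j, hj⟩, ⟨l, hl⟩⟩ := hχ.mem_range _ _ _ hne
    rw [← he, e.apply_eq_iff_eq] at hi hj hl
    rcases habc with h | h | h
    exacts [h i hi.symm, h j hj.symm, h l hl.symm]
  refine degenerates_of_basis b Wt (fun a₁ a₂ a₃ hle => ?_) (fun a₁ a₂ a₃ hne => ?_)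
  · obtain ⟨p, rfl⟩ := e.surjective a₁
    obtain ⟨q, rfl⟩ := e.surjective a₂
    obtain ⟨r, rfl⟩ := e.surjective a₃
    rw [hbi, hbi]
    have hr := (hWt1 (e r)).2
    rcases p with p | p
    · rcases q with q | q
      · rw [hWt, hWt, Sum.elim_inl, Sum.elim_inl] at hle
        rw [hB, hB, hrepr p q r hle (hle.trans hr)]
        rcases p with i | p
        · rcases q with j | q
          · by_cases hrl : ∃ l, r = .inl (.inl l)
            · obtain ⟨l, rfl⟩ := hrl
              rw [he, he, he, hχ.coords_pos]
              simp [c]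
            · push Not at hrl
              rw [hzero _ _ _ (.inr (.inr hrl))]
              simp [hrl]
          · rw [hzero _ _ _ (by simp)]
            simp [c]
        · rw [hzero _ _ _ (by simp)]
          simp [c]
      · have := (hw p).1
        rw [hWt, hWt, Sum.elim_inl, Sum.elim_inr] at hle
        omega
    · have := (hWt1 (e q)).1
      rw [hWt (.inr p), Sum.elim_inr] at hle
      omega
  · obtain ⟨⟨i, rfl⟩, ⟨j, rfl⟩, ⟨l, rfl⟩⟩ := hχ.mem_range _ _ _ hne
    rw [hχ.coords_pos] at hne
    have := hc (.inl i) (.inl j) l hne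
    simpa only [← he, hWt, Sum.elim_inl] using this

theorem degenerates_of_weights [Infinite k] {μ χ : AlgStr k n} (hμ : ∀ x, μ x x = 0)
    {pos : Fin m → Fin n} {T : Finset (Fin m × Fin m × Fin m)} (hχ : IsTable χ pos T)
    {v : Fin m → Fin n → k} (hv : LinearIndependent k v)
    (w : Fin m → ℕ) (W : ℕ) (hW : 1 ≤ W) (hw : ∀ p, 1 ≤ w p ∧ w p ≤ W)
    (hT : ∀ i j l, (i, j, l) ∈ T → w l = w i + w j)
    (h : ∀ i j, i < j → w i + w j ≤ W → μ (v i) (v j) - ∑ l, tableCoeff k T i j l • v l ∈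
        Submodule.span k (v '' {r | w r < w i + w j})) : μ.Degenerates χ := by
  have hv' : LinearIndependent k (Sum.elim v (Empty.elim : Empty → Fin n → k)) :=
    hv.sum_type (v' := (Empty.elim : Empty → Fin n → k)) linearIndependent_empty_type
      (by rw [Set.range_eq_empty (Empty.elim : Empty → Fin n → k), Submodule.span_empty]
          exact disjoint_bot_right)
  refine degenerates_of_weights' hμ hχ (β := Empty) hv' (Sum.elim w Empty.elim) W hW ?_ hT
    (fun i j hij hle => ?_) (fun i q => q.elim) (fun p => p.elim)
  · rintro (p | ⟨⟨⟩⟩)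
    exact hw p
  · refine Submodule.span_mono ?_ (h i j hij hle)
    rintro _ ⟨r, hr, rfl⟩
    exact ⟨.inl r, hr, rfl⟩

end AlgStr

namespace AlgStr

variable {k : Type*} [Field k] {n m : ℕ}

section Table

variable {χ : AlgStr k n} {pos : Fin m → Fin n} {T : Finset (Fin m × Fin m × Fin m)}

lemma tableCoeff_eq_sub (hT : ∀ i j l, (i, j, l) ∈ T → (j, i, l) ∉ T) (i j l : Fin m) :
    tableCoeff k T i j l = (if (i, j, l) ∈ T then 1 else 0) - (if (j, i, l) ∈ T then 1 else 0) := by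
  unfold tableCoeff
  by_cases h1 : (i, j, l) ∈ T
  · simp [h1, hT i j l h1]
  · by_cases h2 : (j, i, l) ∈ T <;> simp [h1, h2]

lemma IsTable.single_apply (h : IsTable χ pos T) (i j : Fin m) :
    χ (Pi.single (pos i) 1) (Pi.single (pos j) 1) =
      ∑ l, tableCoeff k T i j l • (Pi.single (pos l) 1 : Fin n → k) := by
  ext c
  simp only [Finset.sum_apply, Pi.smul_apply, smul_eq_mul]
  by_cases hc : c ∈ Set.range pos
  · obtain ⟨l, rfl⟩ := hc
    have := h.coords_pos i j l
    simp only [coords] at this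
    rw [this]
    simp [Pi.single_apply, h.inj.eq_iff]
  · have h0 : χ.coords (pos i, pos j, c) = 0 := by
      by_contra hne
      exact hc (h.mem_range _ _ _ hne).2.2
    simp only [coords] at h0
    rw [h0]
    refine (Finset.sum_eq_zero fun l _ => ?_).symm
    rw [Pi.single_eq_of_ne (fun he => hc ⟨l, he.symm⟩), mul_zero]

/-- With the product written as a sum over the table entries, polynomial identities that hold on a
table structure become consequences of `ring`. -/
lemma IsTable.apply (h : IsTable χ pos T) (x y : Fin n → k) :
    χ x y = ∑ t ∈ T, (x (pos t.1) * y (pos t.2.1) - x (pos t.2.1) * y (pos t.1)) •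
      (Pi.single (pos t.2.2) 1 : Fin n → k) := by
  ext c
  have h0 : ∀ a b, (a ∉ Set.range pos ∨ b ∉ Set.range pos ∨ c ∉ Set.range pos) →
      χ.coords (a, b, c) = 0 := by
    intro a b hab
    by_contra hne
    have := h.mem_range _ _ _ hne
    tauto
  simp only [Finset.sum_apply, Pi.smul_apply, smul_eq_mul]
  rw [apply_eq_sum_coords]
  by_cases hc : c ∈ Set.range pos
  · obtain ⟨l, rfl⟩ := hc
    have h1 : ∑ a, ∑ b, x a * y b * χ.coords (a, b, pos l) =
        ∑ i, ∑ j, x (pos i) * y (pos j) * tableCoeff k T i j l := by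
      refine (Fintype.sum_of_injective pos h.inj _ _ (fun a ha => ?_) fun i => ?_).symm
      · exact Finset.sum_eq_zero fun b _ => by rw [h0 a b (.inl ha), mul_zero]
      · refine Fintype.sum_of_injective pos h.inj _ _ (fun b hb => ?_) fun j => ?_
        · rw [h0 _ b (.inr (.inl hb)), mul_zero]
        · rw [h.coords_pos]
    have h2 : ∀ F : Fin m × Fin m × Fin m → k, ∑ t ∈ T, F t * (Pi.single (pos t.2.2) 1 : Fin n → k)
        (pos l) = ∑ i, ∑ j, F (i, j, l) * if (i, j, l) ∈ T then 1 else 0 := by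
      intro F
      have : ∀ t : Fin m × Fin m × Fin m, (Pi.single (pos t.2.2) 1 : Fin n → k) (pos l) =
          if l = t.2.2 then 1 else 0 := fun t => by simp [Pi.single_apply, h.inj.eq_iff]
      simp only [this]
      have h3 : ∀ G : Fin m × Fin m × Fin m → k, ∑ t ∈ T, G t =
          ∑ i, ∑ j, ∑ l, if (i, j, l) ∈ T then G (i, j, l) else 0 := fun G => by
        simp only [← Fintype.sum_prod_type', Finset.sum_ite_mem,
          Finset.univ_inter]
      rw [h3]
      refine Finset.sum_congr rfl fun i _ => Finset.sum_congr rfl fun j _ => ?_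
      rw [Finset.sum_eq_single l (fun l' _ hl => by simp [hl.symm]) (by simp)]
      simp
    rw [h1, h2]
    simp only [tableCoeff_eq_sub h.antisymm, mul_sub, sub_mul, Finset.sum_sub_distrib]
    congr 1
    rw [Finset.sum_comm]
  · rw [Finset.sum_eq_zero fun a _ => Finset.sum_eq_zero fun b _ => by
      rw [h0 a b (.inr (.inr hc)), mul_zero]]
    refine (Finset.sum_eq_zero fun t _ => ?_).symm
    rw [Pi.single_eq_of_ne (fun he => hc ⟨_, he.symm⟩), mul_zero]

lemma IsTable.alternating (h : IsTable χ pos T) (x : Fin n → k) : χ x x = 0 := by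
  rw [h.apply]
  exact Finset.sum_eq_zero fun t _ => by rw [mul_comm, sub_self, zero_smul]

lemma linearIndependent_single_comp {α : Type*} {f : α → Fin n} (hf : Function.Injective f) :
    LinearIndependent k fun a => (Pi.single (f a) 1 : Fin n → k) := by
  have := (Pi.basisFun k (Fin n)).linearIndependent.comp f hf
  convert! this using 1
  ext a : 1
  simp

/-- A degeneration between structures with multiplication tables, given by a weighting of some of
the basis vectors. -/
lemma IsTable.degenerates [Infinite k] {m' : ℕ} {μ : AlgStr k n} {pos' : Fin m' → Fin n}
    {T' : Finset (Fin m' × Fin m' × Fin m')} (hμ : IsTable μ pos' T') (hχ : IsTable χ pos T)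
    (σ : Fin m → Fin m') (w : Fin m → ℕ) (W : ℕ) (hσ : Function.Injective σ) (hW : 1 ≤ W)
    (hw : ∀ p, 1 ≤ w p ∧ w p ≤ W)
    (hT : ∀ i j l, (i, j, l) ∈ T → w l = w i + w j)
    (h₁ : ∀ i j l, w i + w j ≤ W → ((σ i, σ j, σ l) ∈ T' ↔ (i, j, l) ∈ T))
    (h₂ : ∀ i j l', (∀ l, σ l ≠ l') → (σ i, σ j, l') ∈ T' → W < w i + w j) :
    μ.Degenerates χ := by
  refine degenerates_of_weights hμ.alternating hχ
    (linearIndependent_single_comp (hμ.inj.comp hσ)) w W hW hw hT fun i j _ hle => ?_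
  have key : ∀ i j, w i + w j ≤ W → ∀ l', (if (σ i, σ j, l') ∈ T' then (1 : k) else 0) =
      ∑ l, (if (i, j, l) ∈ T then 1 else 0) * (if σ l = l' then (1 : k) else 0) := by
    intro i j hle l'
    by_cases hl : l' ∈ Set.range σ
    · obtain ⟨l, rfl⟩ := hl
      have := h₁ i j l hle
      simp [this, hσ.eq_iff]
    · have : (σ i, σ j, l') ∉ T' := by
        exact fun hm => hle.not_gt (h₂ i j l' (fun l he => hl ⟨l, he⟩) hm)
      rw [if_neg this]
      refine (Finset.sum_eq_zero fun l _ => ?_).symm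
      rw [if_neg (fun he => hl ⟨l, he⟩), mul_zero]
  have h1 : ∀ l', tableCoeff k T' (σ i) (σ j) l' =
      ∑ l, tableCoeff k T i j l * if σ l = l' then 1 else 0 := by
    intro l'
    rw [tableCoeff_eq_sub hμ.antisymm, key i j hle, key j i (by omega)]
    simp only [tableCoeff_eq_sub hχ.antisymm, sub_mul, Finset.sum_sub_distrib]
  rw [Function.comp_apply, Function.comp_apply, hμ.single_apply]
  simp only [h1, Finset.sum_smul, Function.comp_apply]
  rw [Finset.sum_comm]
  simp

/-- Structures with the same multiplication table are isomorphic. -/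
lemma IsTable.mem_orbit {χ' : AlgStr k n} {pos' : Fin m → Fin n} (h : IsTable χ pos T)
    (h' : IsTable χ' pos' T) : χ' ∈ χ.orbit := by
  refine mem_orbit_of_table h.alternating h' (linearIndependent_single_comp h.inj)
    (Submodule.span k ((fun a => Pi.single a (1 : k)) '' (Set.range pos)ᶜ)) ?_ ?_
    fun i j _ => h.single_apply i j
  · rw [eq_top_iff, ← (Pi.basisFun k (Fin n)).span_eq, Submodule.span_le]
    rintro _ ⟨a, rfl⟩
    rw [Pi.basisFun_apply]
    by_cases ha : a ∈ Set.range pos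
    · obtain ⟨i, rfl⟩ := ha
      exact Submodule.mem_sup_left (Submodule.subset_span ⟨i, rfl⟩)
    · exact Submodule.mem_sup_right (Submodule.subset_span ⟨a, ha, rfl⟩)
  · intro u hu x
    have hu' : ∀ i, u (pos i) = 0 := by
      intro i
      induction hu using Submodule.span_induction with
      | mem u hu =>
        obtain ⟨a, ha, rfl⟩ := hu
        exact Pi.single_eq_of_ne (fun he => ha ⟨i, he⟩) _
      | zero => rfl
      | add u v _ _ hu hv => simp [hu, hv]
      | smul c u _ hu => simp [hu]
    rw [h.apply]
    exact Finset.sum_eq_zero fun t _ => by simp [hu']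

end Table

end AlgStr

/-! ### Closed invariant conditions that separate orbits -/

namespace AlgStr

variable {k : Type*} [Field k] {n m : ℕ}

/-- The Pfaffian of the alternating form `f ∘ μ` on four vectors. -/
def pf (μ : AlgStr k n) (f : (Fin n → k) →ₗ[k] k) (x y z w : Fin n → k) : k :=
  f (μ x y) * f (μ z w) - f (μ x z) * f (μ y w) + f (μ x w) * f (μ y z)

/-- The polarization of `pf` in the functional. -/
def pfPolar (μ : AlgStr k n) (f g : (Fin n → k) →ₗ[k] k) (x y z w : Fin n → k) : k :=
  f (μ x y) * g (μ z w) - f (μ x z) * g (μ y w) + f (μ x w) * g (μ y z) +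
    (g (μ x y) * f (μ z w) - g (μ x z) * f (μ y w) + g (μ x w) * f (μ y z))

/-- All Pfaffians vanish. -/
def PfZero (μ : AlgStr k n) : Prop := ∀ f x y z w, μ.pf f x y z w = 0

/-- The Pfaffian is a square of a linear form (up to a scalar) on every pencil of functionals. -/
def PfSquare (μ : AlgStr k n) : Prop :=
  ∀ f g x y z w, μ.pfPolar f g x y z w * μ.pfPolar f g x y z w -
    4 * μ.pf f x y z w * μ.pf g x y z w = 0

/-- All products of three elements vanish. -/
def TwoStep (μ : AlgStr k n) : Prop :=
  ∀ (f : (Fin n → k) →ₗ[k] k) x y z, f (μ x (μ y z)) = 0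

/-- The products `xy`, `yz`, `zx` are always linearly dependent. -/
def TriangleDependent (μ : AlgStr k n) : Prop :=
  ∀ (f : Fin 3 → (Fin n → k) →ₗ[k] k) (x : Fin 3 → Fin n → k),
    (Matrix.of fun i j => f i (μ (x j) (x (j + 1)))).det = 0

/-- Any `d + 1` products are linearly dependent. -/
def SqRankLE (d : ℕ) (μ : AlgStr k n) : Prop :=
  ∀ (f : Fin (d + 1) → (Fin n → k) →ₗ[k] k) (x y : Fin (d + 1) → Fin n → k),
    (Matrix.of fun i j => f i (μ (x j) (y j))).det = 0

/-- Left multiplications have rank at most `d`. -/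
def LeftRankLE (d : ℕ) (μ : AlgStr k n) : Prop :=
  ∀ (f : Fin (d + 1) → (Fin n → k) →ₗ[k] k) (x : Fin n → k) (y : Fin (d + 1) → Fin n → k),
    (Matrix.of fun i j => f i (μ x (y j))).det = 0

/-- The forms `f ∘ μ` have rank at most `d`. -/
def FormRankLE (d : ℕ) (μ : AlgStr k n) : Prop :=
  ∀ (f : (Fin n → k) →ₗ[k] k) (x y : Fin (d + 1) → Fin n → k),
    (Matrix.of fun i j => f (μ (x i) (y j))).det = 0

section Closed

variable {μ χ : AlgStr k n}

lemma isPoly_pf (f : (Fin n → k) →ₗ[k] k) (x y z w : Fin n → k) :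
    IsPoly (fun ν : AlgStr k n => ν.pf f x y z w) :=
  ((((IsPoly.apply _ _ _).mul (IsPoly.apply _ _ _)).sub
    ((IsPoly.apply _ _ _).mul (IsPoly.apply _ _ _))).add
    ((IsPoly.apply _ _ _).mul (IsPoly.apply _ _ _)))

lemma isPoly_pfPolar (f g : (Fin n → k) →ₗ[k] k) (x y z w : Fin n → k) :
    IsPoly (fun ν : AlgStr k n => ν.pfPolar f g x y z w) :=
  ((((IsPoly.apply _ _ _).mul (IsPoly.apply _ _ _)).sub
    ((IsPoly.apply _ _ _).mul (IsPoly.apply _ _ _))).add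
    ((IsPoly.apply _ _ _).mul (IsPoly.apply _ _ _))).add
  ((((IsPoly.apply _ _ _).mul (IsPoly.apply _ _ _)).sub
    ((IsPoly.apply _ _ _).mul (IsPoly.apply _ _ _))).add
    ((IsPoly.apply _ _ _).mul (IsPoly.apply _ _ _)))

lemma PfZero.of_degenerates (hμ : μ.PfZero) (h : μ.Degenerates χ) : χ.PfZero := by
  intro f x y z w
  refine h.eq_zero (isPoly_pf f x y z w) ?_
  rintro _ ⟨g, rfl⟩
  exact hμ (f.comp g.toLinearMap) (g.symm x) (g.symm y) (g.symm z) (g.symm w)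

lemma PfSquare.of_degenerates (hμ : μ.PfSquare) (h : μ.Degenerates χ) : χ.PfSquare := by
  intro f f' x y z w
  refine h.eq_zero (F := fun χ => χ.pfPolar f f' x y z w * χ.pfPolar f f' x y z w -
    4 * χ.pf f x y z w * χ.pf f' x y z w) (((isPoly_pfPolar ..).mul (isPoly_pfPolar ..)).sub
    (((IsPoly.const 4).mul (isPoly_pf ..)).mul (isPoly_pf ..))) ?_
  rintro _ ⟨g, rfl⟩
  exact hμ (f.comp g.toLinearMap) (f'.comp g.toLinearMap) (g.symm x) (g.symm y) (g.symm z)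
    (g.symm w)

lemma TwoStep.of_degenerates (hμ : μ.TwoStep) (h : μ.Degenerates χ) : χ.TwoStep := by
  intro f x y z
  refine h.eq_zero (IsPoly.apply_apply f x y z) ?_
  rintro _ ⟨g, rfl⟩
  simpa using hμ (f.comp g.toLinearMap) (g.symm x) (g.symm y) (g.symm z)

lemma TriangleDependent.of_degenerates (hμ : μ.TriangleDependent) (h : μ.Degenerates χ) :
    χ.TriangleDependent := by
  intro f x
  refine h.eq_zero (IsPoly.det fun i j => IsPoly.apply (f i) (x j) (x (j + 1))) ?_
  rintro _ ⟨g, rfl⟩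
  exact hμ (fun i => (f i).comp g.toLinearMap) (fun i => g.symm (x i))

lemma SqRankLE.of_degenerates {d : ℕ} (hμ : μ.SqRankLE d) (h : μ.Degenerates χ) :
    χ.SqRankLE d := by
  intro f x y
  refine h.eq_zero (IsPoly.det fun i j => IsPoly.apply (f i) (x j) (y j)) ?_
  rintro _ ⟨g, rfl⟩
  exact hμ (fun i => (f i).comp g.toLinearMap) (fun i => g.symm (x i)) (fun i => g.symm (y i))

lemma LeftRankLE.of_degenerates {d : ℕ} (hμ : μ.LeftRankLE d) (h : μ.Degenerates χ) :
    χ.LeftRankLE d := by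
  intro f x y
  refine h.eq_zero (IsPoly.det fun i j => IsPoly.apply (f i) x (y j)) ?_
  rintro _ ⟨g, rfl⟩
  exact hμ (fun i => (f i).comp g.toLinearMap) (g.symm x) (fun i => g.symm (y i))

lemma FormRankLE.of_degenerates {d : ℕ} (hμ : μ.FormRankLE d) (h : μ.Degenerates χ) :
    χ.FormRankLE d := by
  intro f x y
  refine h.eq_zero (IsPoly.det fun i j => IsPoly.apply f (x i) (y j)) ?_
  rintro _ ⟨g, rfl⟩
  exact hμ (f.comp g.toLinearMap) (fun i => g.symm (x i)) (fun i => g.symm (y i))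

end Closed

section Criteria

variable {χ : AlgStr k n} {pos : Fin m → Fin n} {T : Finset (Fin m × Fin m × Fin m)}

lemma IsTable.coord (h : IsTable χ pos T) (i j l : Fin m) :
    χ (Pi.single (pos i) 1) (Pi.single (pos j) 1) (pos l) = tableCoeff k T i j l :=
  h.coords_pos i j l

lemma IsTable.map_apply (h : IsTable χ pos T) (f : (Fin n → k) →ₗ[k] k) (x y : Fin n → k) :
    f (χ x y) = ∑ t ∈ T, (x (pos t.1) * y (pos t.2.1) - x (pos t.2.1) * y (pos t.1)) *
      f (Pi.single (pos t.2.2) 1) := by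
  rw [h.apply]
  simp

lemma det_eq_zero_of_span {d : ℕ} (f : Fin (d + 1) → (Fin n → k) →ₗ[k] k)
    (p : Fin (d + 1) → Fin n → k) {e : Fin d → Fin n → k}
    (hp : ∀ j, p j ∈ Submodule.span k (Set.range e)) :
    (Matrix.of fun i j => f i (p j)).det = 0 := by
  have hdep : ¬ LinearIndependent k p := by
    intro hli
    have h1 := finrank_span_eq_card hli
    have h2 := Submodule.finrank_mono (Submodule.span_le.2 (Set.range_subset_iff.2 hp))
    have h3 : finrank k (Submodule.span k (Set.range e)) ≤ Fintype.card (Fin d) :=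
      finrank_range_le_card e
    simp only [Fintype.card_fin] at h1 h3
    omega
  obtain ⟨c, hc, i, hi⟩ := Fintype.not_linearIndependent_iff.1 hdep
  refine Matrix.exists_mulVec_eq_zero_iff.1 ⟨c, fun h0 => hi (by simp [h0]), ?_⟩
  ext i
  have := congrArg (f i) hc
  simpa [Matrix.mulVec, dotProduct, mul_comm] using this

lemma IsTable.sqRankLE (h : IsTable χ pos T) {d : ℕ} (L : Fin d → Fin m)
    (hL : ∀ t ∈ T, ∃ i, L i = t.2.2) : χ.SqRankLE d := by
  intro f x y
  refine det_eq_zero_of_span f _ (e := fun i => Pi.single (pos (L i)) 1) fun j => ?_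
  rw [h.apply]
  refine Submodule.sum_mem _ fun t ht => Submodule.smul_mem _ _ ?_
  obtain ⟨i, hi⟩ := hL t ht
  exact Submodule.subset_span ⟨i, by simp only [hi]⟩

/-- Only the `d` coordinates selected by `L` enter a product. Among `d + 1` vectors some non-trivial
combination has all of these equal to zero; it annihilates everything and gives a relation between
the rows. -/
lemma IsTable.formRankLE (h : IsTable χ pos T) {d : ℕ} (L : Fin d → Fin m)
    (hL : ∀ t ∈ T, (∃ i, L i = t.1) ∧ ∃ i, L i = t.2.1) : χ.FormRankLE d := by
  intro f x y
  have hdep : ¬ LinearIndependent k fun i q => x i (pos (L q)) := by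
    intro hli
    simpa using hli.fintype_card_le_finrank
  obtain ⟨c, hc, i, hi⟩ := Fintype.not_linearIndependent_iff.1 hdep
  refine Matrix.exists_vecMul_eq_zero_iff.1 ⟨c, fun h0 => hi (by simp [h0]), ?_⟩
  have h0 : ∀ z, χ (∑ i, c i • x i) z = 0 := by
    intro z
    have hz : ∀ q, (∑ i, c i • x i) (pos (L q)) = 0 := fun q => by
      simpa using congrFun hc q
    rw [h.apply]
    refine Finset.sum_eq_zero fun t ht => ?_
    obtain ⟨⟨i, hi⟩, ⟨j, hj⟩⟩ := hL t ht
    rw [← hi, ← hj, hz, hz]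
    simp
  ext j
  have := congrArg f (h0 (y j))
  simpa [Matrix.vecMul, dotProduct] using this

/-- If no product position of the table occurs as a factor, then a product has zero coordinates
wherever factors are read off. -/
lemma IsTable.twoStep (h : IsTable χ pos T)
    (hT : ∀ t ∈ T, ∀ t' ∈ T, t.1 ≠ t'.2.2 ∧ t.2.1 ≠ t'.2.2) : χ.TwoStep := by
  intro f x y z
  have hc : ∀ t ∈ T, χ y z (pos t.1) = 0 ∧ χ y z (pos t.2.1) = 0 := by
    intro t ht
    rw [h.apply]
    simp only [Finset.sum_apply, Pi.smul_apply, smul_eq_mul]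
    constructor <;> refine Finset.sum_eq_zero fun t' ht' => ?_
    · rw [Pi.single_eq_of_ne (fun he => (hT t ht t' ht').1 (h.inj he)), mul_zero]
    · rw [Pi.single_eq_of_ne (fun he => (hT t ht t' ht').2 (h.inj he)), mul_zero]
  rw [h.apply x, Finset.sum_eq_zero, map_zero]
  intro t ht
  rw [(hc t ht).1, (hc t ht).2]
  simp

/-- The entries `L` of the table exhibit an identity matrix as the matrix of coordinates of `d + 1`
products. -/
lemma IsTable.not_sqRankLE (h : IsTable χ pos T) {d : ℕ} (L : Fin (d + 1) → Fin m × Fin m × Fin m)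
    (hL : ∀ r s, ((L s).1, (L s).2.1, (L r).2.2) ∈ T ↔ r = s)
    (hL' : ∀ r s, ((L s).2.1, (L s).1, (L r).2.2) ∉ T) : ¬ χ.SqRankLE d := by
  intro hr
  have := hr (fun r => LinearMap.proj (pos (L r).2.2)) (fun s => Pi.single (pos (L s).1) 1)
    (fun s => Pi.single (pos (L s).2.1) 1)
  simp only [LinearMap.proj_apply, h.coord, tableCoeff, hL, hL', if_false] at this
  have h1 : (Matrix.of fun i j : Fin (d + 1) => if i = j then (1 : k) else 0) = 1 := by
    ext i j
    simp [Matrix.one_apply]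
  rw [h1, Matrix.det_one] at this
  exact one_ne_zero this

lemma IsTable.not_leftRankLE (h : IsTable χ pos T) {d : ℕ} (i : Fin m)
    (L : Fin (d + 1) → Fin m × Fin m) (hL : ∀ r s, (i, (L s).1, (L r).2) ∈ T ↔ r = s)
    (hL' : ∀ r s, ((L s).1, i, (L r).2) ∉ T) : ¬ χ.LeftRankLE d := by
  intro hr
  have := hr (fun r => LinearMap.proj (pos (L r).2)) (Pi.single (pos i) 1)
    (fun s => Pi.single (pos (L s).1) 1)
  simp only [LinearMap.proj_apply, h.coord, tableCoeff, hL, hL', if_false] at this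
  have h1 : (Matrix.of fun i j : Fin (d + 1) => if i = j then (1 : k) else 0) = 1 := by
    ext i j
    simp [Matrix.one_apply]
  rw [h1, Matrix.det_one] at this
  exact one_ne_zero this

lemma IsTable.not_formRankLE (h : IsTable χ pos T) {d : ℕ} (l : Fin m)
    (X Y : Fin (d + 1) → Fin m) (h₁ : ∀ r s, (X r, Y s, l) ∈ T ∨ (Y s, X r, l) ∈ T ↔ r = s) :
    ¬ χ.FormRankLE d := by
  intro hr
  have := hr (LinearMap.proj (pos l)) (fun s => Pi.single (pos (X s)) 1)
    (fun s => Pi.single (pos (Y s)) 1)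
  simp only [LinearMap.proj_apply, h.coord] at this
  have h2 : (Matrix.of fun i j : Fin (d + 1) => tableCoeff k T (X i) (Y j) l) =
      Matrix.diagonal fun i => tableCoeff k T (X i) (Y i) l := by
    ext i j
    rw [Matrix.of_apply, Matrix.diagonal_apply]
    split_ifs with hij
    · rw [hij]
    · have := mt (h₁ i j).1 hij
      push Not at this
      simp [tableCoeff, this]
  rw [h2, Matrix.det_diagonal, Finset.prod_eq_zero_iff] at this
  obtain ⟨i, -, hi⟩ := this
  have h3 := (h₁ i i).2 rfl
  unfold tableCoeff at hi
  split_ifs at hi with h4 h5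
  · exact one_ne_zero hi
  · exact one_ne_zero (neg_eq_zero.1 hi)
  · tauto

lemma IsTable.not_twoStep (h : IsTable χ pos T) (a b c d l : Fin m)
    (hbc : ∀ l, ((b, c, l) ∈ T ↔ l = d) ∧ (c, b, l) ∉ T) (had : (a, d, l) ∈ T) : ¬ χ.TwoStep := by
  intro hr
  have := hr (LinearMap.proj (pos l)) (Pi.single (pos a) 1) (Pi.single (pos b) 1)
    (Pi.single (pos c) 1)
  have hd : χ (Pi.single (pos b) 1) (Pi.single (pos c) 1) = (Pi.single (pos d) 1 : Fin n → k) := by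
    rw [h.single_apply]
    simp [tableCoeff, hbc]
  rw [hd, LinearMap.proj_apply, h.coord, tableCoeff, if_pos had] at this
  exact one_ne_zero this

end Criteria

end AlgStr

/-! ### The tables of the structures of level at most four, and their invariants -/

namespace AlgStr

variable {k : Type*} [Field k] {n m : ℕ}

def tabEta1 : Finset (Fin 3 × Fin 3 × Fin 3) := {(0, 1, 2)}

def tabEta2 : Finset (Fin 5 × Fin 5 × Fin 5) := {(0, 1, 4), (2, 3, 4)}

def tabEta3 : Finset (Fin 7 × Fin 7 × Fin 7) := {(0, 1, 6), (2, 3, 6), (4, 5, 6)}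

def tabEta4 : Finset (Fin 9 × Fin 9 × Fin 9) := {(0, 1, 8), (2, 3, 8), (4, 5, 8), (6, 7, 8)}

def tabT22 : Finset (Fin 5 × Fin 5 × Fin 5) := {(0, 1, 3), (0, 2, 4)}

def tabT222 : Finset (Fin 7 × Fin 7 × Fin 7) := {(0, 1, 4), (0, 2, 5), (0, 3, 6)}

def tabT2222 : Finset (Fin 9 × Fin 9 × Fin 9) := {(0, 1, 5), (0, 2, 6), (0, 3, 7), (0, 4, 8)}

/-- Position 3 is idle. It records that the ambient dimension is at least 5, which leaves room for a
degeneration to `tabT22`. -/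
def tabT3 : Finset (Fin 5 × Fin 5 × Fin 5) := {(0, 1, 2), (0, 2, 4)}

def tabT32 : Finset (Fin 6 × Fin 6 × Fin 6) := {(0, 1, 4), (0, 2, 3), (0, 3, 5)}

def tabT4 : Finset (Fin 5 × Fin 5 × Fin 5) := {(0, 1, 2), (0, 2, 3), (0, 3, 4)}

def tabT22eps23 : Finset (Fin 6 × Fin 6 × Fin 6) := {(0, 1, 3), (0, 2, 4), (1, 2, 5)}

def tabT22eps24 : Finset (Fin 6 × Fin 6 × Fin 6) := {(0, 1, 4), (0, 2, 5), (1, 3, 5)}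

def tabT22eps34 : Finset (Fin 6 × Fin 6 × Fin 6) := {(0, 1, 4), (0, 2, 5), (2, 3, 5)}

def tabT3eps23 : Finset (Fin 5 × Fin 5 × Fin 5) := {(0, 1, 2), (0, 2, 4), (1, 2, 3)}

def tabT3eps24 : Finset (Fin 5 × Fin 5 × Fin 5) := {(0, 1, 2), (0, 2, 4), (1, 3, 4)}

def tabT222eps23 : Finset (Fin 7 × Fin 7 × Fin 7) := {(0, 1, 4), (0, 2, 5), (0, 3, 6), (1, 2, 6)}

lemma sum_tabEta1 {M : Type*} [AddCommMonoid M] (F : Fin 3 × Fin 3 × Fin 3 → M) :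
    ∑ t ∈ tabEta1, F t = F (0, 1, 2) := by
  simp [tabEta1]

lemma sum_tabT22 {M : Type*} [AddCommMonoid M] (F : Fin 5 × Fin 5 × Fin 5 → M) :
    ∑ t ∈ tabT22, F t = F (0, 1, 3) + F (0, 2, 4) := by
  simp [tabT22]

lemma sum_tabT222 {M : Type*} [AddCommMonoid M] (F : Fin 7 × Fin 7 × Fin 7 → M) :
    ∑ t ∈ tabT222, F t = F (0, 1, 4) + F (0, 2, 5) + F (0, 3, 6) := by
  simp [tabT222, add_assoc]

lemma sum_tabT2222 {M : Type*} [AddCommMonoid M] (F : Fin 9 × Fin 9 × Fin 9 → M) :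
    ∑ t ∈ tabT2222, F t = F (0, 1, 5) + F (0, 2, 6) + F (0, 3, 7) + F (0, 4, 8) := by
  simp [tabT2222, add_assoc]

lemma sum_tabT3 {M : Type*} [AddCommMonoid M] (F : Fin 5 × Fin 5 × Fin 5 → M) :
    ∑ t ∈ tabT3, F t = F (0, 1, 2) + F (0, 2, 4) := by
  simp [tabT3]

lemma sum_tabT32 {M : Type*} [AddCommMonoid M] (F : Fin 6 × Fin 6 × Fin 6 → M) :
    ∑ t ∈ tabT32, F t = F (0, 1, 4) + F (0, 2, 3) + F (0, 3, 5) := by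
  simp [tabT32, add_assoc]

lemma sum_tabT4 {M : Type*} [AddCommMonoid M] (F : Fin 5 × Fin 5 × Fin 5 → M) :
    ∑ t ∈ tabT4, F t = F (0, 1, 2) + F (0, 2, 3) + F (0, 3, 4) := by
  simp [tabT4, add_assoc]

lemma sum_tabT22eps23 {M : Type*} [AddCommMonoid M] (F : Fin 6 × Fin 6 × Fin 6 → M) :
    ∑ t ∈ tabT22eps23, F t = F (0, 1, 3) + F (0, 2, 4) + F (1, 2, 5) := by
  simp [tabT22eps23, add_assoc]

lemma sum_tabT22eps24 {M : Type*} [AddCommMonoid M] (F : Fin 6 × Fin 6 × Fin 6 → M) :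
    ∑ t ∈ tabT22eps24, F t = F (0, 1, 4) + F (0, 2, 5) + F (1, 3, 5) := by
  simp [tabT22eps24, add_assoc]

lemma sum_tabT3eps23 {M : Type*} [AddCommMonoid M] (F : Fin 5 × Fin 5 × Fin 5 → M) :
    ∑ t ∈ tabT3eps23, F t = F (0, 1, 2) + F (0, 2, 4) + F (1, 2, 3) := by
  simp [tabT3eps23, add_assoc]

lemma sum_tabT3eps24 {M : Type*} [AddCommMonoid M] (F : Fin 5 × Fin 5 × Fin 5 → M) :
    ∑ t ∈ tabT3eps24, F t = F (0, 1, 2) + F (0, 2, 4) + F (1, 3, 4) := by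
  simp [tabT3eps24, add_assoc]

lemma sum_tabT222eps23 {M : Type*} [AddCommMonoid M] (F : Fin 7 × Fin 7 × Fin 7 → M) :
    ∑ t ∈ tabT222eps23, F t = F (0, 1, 4) + F (0, 2, 5) + F (0, 3, 6) + F (1, 2, 6) := by
  simp [tabT222eps23, add_assoc]

lemma fin3_succ : (0 : Fin 3) + 1 = 1 ∧ (1 : Fin 3) + 1 = 2 ∧ (2 : Fin 3) + 1 = 0 := by decide

section Invariants

variable {χ : AlgStr k n}

lemma sqRankLE_Eta1 {pos : Fin 3 → Fin n} (h : IsTable χ pos tabEta1) :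
    χ.SqRankLE 1 :=
  h.sqRankLE ![2] (by
    simp only [tabEta1, Finset.mem_singleton, forall_eq]
    decide)

lemma sqRankLE_Eta2 {pos : Fin 5 → Fin n} (h : IsTable χ pos tabEta2) :
    χ.SqRankLE 1 :=
  h.sqRankLE ![4] (by
    simp only [tabEta2, Finset.mem_insert, Finset.mem_singleton, forall_eq_or_imp, forall_eq]
    decide)

lemma sqRankLE_Eta3 {pos : Fin 7 → Fin n} (h : IsTable χ pos tabEta3) :
    χ.SqRankLE 1 :=
  h.sqRankLE ![6] (by
    simp only [tabEta3, Finset.mem_insert, Finset.mem_singleton, forall_eq_or_imp, forall_eq]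
    decide)

lemma sqRankLE_Eta4 {pos : Fin 9 → Fin n} (h : IsTable χ pos tabEta4) :
    χ.SqRankLE 1 :=
  h.sqRankLE ![8] (by
    simp only [tabEta4, Finset.mem_insert, Finset.mem_singleton, forall_eq_or_imp, forall_eq]
    decide)

lemma sqRankLE_T22 {pos : Fin 5 → Fin n} (h : IsTable χ pos tabT22) :
    χ.SqRankLE 2 :=
  h.sqRankLE ![3, 4] (by
    simp only [tabT22, Finset.mem_insert, Finset.mem_singleton, forall_eq_or_imp, forall_eq]
    decide)

lemma sqRankLE_T3 {pos : Fin 5 → Fin n} (h : IsTable χ pos tabT3) :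
    χ.SqRankLE 2 :=
  h.sqRankLE ![2, 4] (by
    simp only [tabT3, Finset.mem_insert, Finset.mem_singleton, forall_eq_or_imp, forall_eq]
    decide)

lemma sqRankLE_T22eps24 {pos : Fin 6 → Fin n} (h : IsTable χ pos tabT22eps24) :
    χ.SqRankLE 2 :=
  h.sqRankLE ![4, 5] (by
    simp only [tabT22eps24, Finset.mem_insert, Finset.mem_singleton, forall_eq_or_imp, forall_eq]
    decide)

lemma sqRankLE_T22eps34 {pos : Fin 6 → Fin n} (h : IsTable χ pos tabT22eps34) :
    χ.SqRankLE 2 :=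
  h.sqRankLE ![4, 5] (by
    simp only [tabT22eps34, Finset.mem_insert, Finset.mem_singleton, forall_eq_or_imp, forall_eq]
    decide)

lemma sqRankLE_T3eps24 {pos : Fin 5 → Fin n} (h : IsTable χ pos tabT3eps24) :
    χ.SqRankLE 2 :=
  h.sqRankLE ![2, 4] (by
    simp only [tabT3eps24, Finset.mem_insert, Finset.mem_singleton, forall_eq_or_imp, forall_eq]
    decide)

lemma sqRankLE_T222 {pos : Fin 7 → Fin n} (h : IsTable χ pos tabT222) :
    χ.SqRankLE 3 :=
  h.sqRankLE ![4, 5, 6] (by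
    simp only [tabT222, Finset.mem_insert, Finset.mem_singleton, forall_eq_or_imp, forall_eq]
    decide)

lemma sqRankLE_T222eps23 {pos : Fin 7 → Fin n} (h : IsTable χ pos tabT222eps23) :
    χ.SqRankLE 3 :=
  h.sqRankLE ![4, 5, 6] (by
    simp only [tabT222eps23, Finset.mem_insert, Finset.mem_singleton, forall_eq_or_imp, forall_eq]
    decide)

lemma sqRankLE_T32 {pos : Fin 6 → Fin n} (h : IsTable χ pos tabT32) :
    χ.SqRankLE 3 :=
  h.sqRankLE ![3, 4, 5] (by
    simp only [tabT32, Finset.mem_insert, Finset.mem_singleton, forall_eq_or_imp, forall_eq]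
    decide)

lemma formRankLE_Eta2 {pos : Fin 5 → Fin n} (h : IsTable χ pos tabEta2) :
    χ.FormRankLE 4 :=
  h.formRankLE ![0, 1, 2, 3] (by
    simp only [tabEta2, Finset.mem_insert, Finset.mem_singleton, forall_eq_or_imp, forall_eq]
    decide)

lemma formRankLE_Eta3 {pos : Fin 7 → Fin n} (h : IsTable χ pos tabEta3) :
    χ.FormRankLE 6 :=
  h.formRankLE ![0, 1, 2, 3, 4, 5] (by
    simp only [tabEta3, Finset.mem_insert, Finset.mem_singleton, forall_eq_or_imp, forall_eq]
    decide)

lemma formRankLE_T22eps24 {pos : Fin 6 → Fin n} (h : IsTable χ pos tabT22eps24) :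
    χ.FormRankLE 4 :=
  h.formRankLE ![0, 1, 2, 3] (by
    simp only [tabT22eps24, Finset.mem_insert, Finset.mem_singleton, forall_eq_or_imp, forall_eq]
    decide)

lemma formRankLE_T22eps34 {pos : Fin 6 → Fin n} (h : IsTable χ pos tabT22eps34) :
    χ.FormRankLE 4 :=
  h.formRankLE ![0, 1, 2, 3] (by
    simp only [tabT22eps34, Finset.mem_insert, Finset.mem_singleton, forall_eq_or_imp, forall_eq]
    decide)

lemma formRankLE_T3eps24 {pos : Fin 5 → Fin n} (h : IsTable χ pos tabT3eps24) :
    χ.FormRankLE 4 :=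
  h.formRankLE ![0, 1, 2, 3] (by
    simp only [tabT3eps24, Finset.mem_insert, Finset.mem_singleton, forall_eq_or_imp, forall_eq]
    decide)

lemma formRankLE_T222eps23 {pos : Fin 7 → Fin n} (h : IsTable χ pos tabT222eps23) :
    χ.FormRankLE 4 :=
  h.formRankLE ![0, 1, 2, 3] (by
    simp only [tabT222eps23, Finset.mem_insert, Finset.mem_singleton, forall_eq_or_imp, forall_eq]
    decide)

lemma twoStep_T22 {pos : Fin 5 → Fin n} (h : IsTable χ pos tabT22) :
    χ.TwoStep :=
  h.twoStep (by
    simp only [tabT22, Finset.mem_insert, Finset.mem_singleton, forall_eq_or_imp, forall_eq]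
    decide)

lemma twoStep_T22eps23 {pos : Fin 6 → Fin n} (h : IsTable χ pos tabT22eps23) :
    χ.TwoStep :=
  h.twoStep (by
    simp only [tabT22eps23, Finset.mem_insert, Finset.mem_singleton, forall_eq_or_imp, forall_eq]
    decide)

lemma twoStep_T22eps24 {pos : Fin 6 → Fin n} (h : IsTable χ pos tabT22eps24) :
    χ.TwoStep :=
  h.twoStep (by
    simp only [tabT22eps24, Finset.mem_insert, Finset.mem_singleton, forall_eq_or_imp, forall_eq]
    decide)

lemma twoStep_T22eps34 {pos : Fin 6 → Fin n} (h : IsTable χ pos tabT22eps34) :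
    χ.TwoStep :=
  h.twoStep (by
    simp only [tabT22eps34, Finset.mem_insert, Finset.mem_singleton, forall_eq_or_imp, forall_eq]
    decide)

lemma twoStep_T222 {pos : Fin 7 → Fin n} (h : IsTable χ pos tabT222) :
    χ.TwoStep :=
  h.twoStep (by
    simp only [tabT222, Finset.mem_insert, Finset.mem_singleton, forall_eq_or_imp, forall_eq]
    decide)

lemma twoStep_T222eps23 {pos : Fin 7 → Fin n} (h : IsTable χ pos tabT222eps23) :
    χ.TwoStep :=
  h.twoStep (by
    simp only [tabT222eps23, Finset.mem_insert, Finset.mem_singleton, forall_eq_or_imp, forall_eq]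
    decide)

lemma twoStep_T2222 {pos : Fin 9 → Fin n} (h : IsTable χ pos tabT2222) :
    χ.TwoStep :=
  h.twoStep (by
    simp only [tabT2222, Finset.mem_insert, Finset.mem_singleton, forall_eq_or_imp, forall_eq]
    decide)

/-- In this and the following tables every form f ∘ μ is decomposable: either all products share the
factor e₁, or only three coordinates enter. Alternating forms of rank at most 2 have zero Pfaffians.
-/
lemma pfZero_Eta1 {pos : Fin 3 → Fin n} (h : IsTable χ pos tabEta1) :
    χ.PfZero :=
  fun f x y z w => by
    simp only [pf, h.map_apply, sum_tabEta1]
    ring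

lemma pfZero_T22 {pos : Fin 5 → Fin n} (h : IsTable χ pos tabT22) :
    χ.PfZero :=
  fun f x y z w => by
    simp only [pf, h.map_apply, sum_tabT22]
    ring

lemma pfZero_T3 {pos : Fin 5 → Fin n} (h : IsTable χ pos tabT3) :
    χ.PfZero :=
  fun f x y z w => by
    simp only [pf, h.map_apply, sum_tabT3]
    ring

lemma pfZero_T22eps23 {pos : Fin 6 → Fin n} (h : IsTable χ pos tabT22eps23) :
    χ.PfZero :=
  fun f x y z w => by
    simp only [pf, h.map_apply, sum_tabT22eps23]
    ring

lemma pfZero_T222 {pos : Fin 7 → Fin n} (h : IsTable χ pos tabT222) :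
    χ.PfZero :=
  fun f x y z w => by
    simp only [pf, h.map_apply, sum_tabT222]
    ring

lemma pfZero_T3eps23 {pos : Fin 5 → Fin n} (h : IsTable χ pos tabT3eps23) :
    χ.PfZero :=
  fun f x y z w => by
    simp only [pf, h.map_apply, sum_tabT3eps23]
    ring

lemma pfZero_T32 {pos : Fin 6 → Fin n} (h : IsTable χ pos tabT32) :
    χ.PfZero :=
  fun f x y z w => by
    simp only [pf, h.map_apply, sum_tabT32]
    ring

lemma pfZero_T2222 {pos : Fin 9 → Fin n} (h : IsTable χ pos tabT2222) :
    χ.PfZero :=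
  fun f x y z w => by
    simp only [pf, h.map_apply, sum_tabT2222]
    ring

lemma pfZero_T4 {pos : Fin 5 → Fin n} (h : IsTable χ pos tabT4) :
    χ.PfZero :=
  fun f x y z w => by
    simp only [pf, h.map_apply, sum_tabT4]
    ring

/-- If e₁ is a factor of every listed product, then xy = L(x₁y - y₁x) for a linear map L that kills
e₁, where x₁ is the first coordinate. Hence z₁(xy) + x₁(yz) + y₁(zx) = 0, and all three products
vanish if x₁ = y₁ = z₁ = 0. -/
lemma triangleDependent_T222 {pos : Fin 7 → Fin n} (h : IsTable χ pos tabT222) :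
    χ.TriangleDependent :=
  fun f x => by
    simp only [Matrix.det_fin_three, Matrix.of_apply, h.map_apply, sum_tabT222, fin3_succ]
    ring

lemma triangleDependent_T32 {pos : Fin 6 → Fin n} (h : IsTable χ pos tabT32) :
    χ.TriangleDependent :=
  fun f x => by
    simp only [Matrix.det_fin_three, Matrix.of_apply, h.map_apply, sum_tabT32, fin3_succ]
    ring

lemma triangleDependent_T4 {pos : Fin 5 → Fin n} (h : IsTable χ pos tabT4) :
    χ.TriangleDependent :=
  fun f x => by
    simp only [Matrix.det_fin_three, Matrix.of_apply, h.map_apply, sum_tabT4, fin3_succ]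
    ring

/-- The product depends only on the first three coordinates, and left multiplication by x kills x,
so on the three-dimensional quotient its rank is at most 2. -/
lemma leftRankLE_T22eps23 {pos : Fin 6 → Fin n} (h : IsTable χ pos tabT22eps23) :
    χ.LeftRankLE 2 :=
  fun f x y => by
    refine (Matrix.det_fin_three _).trans ?_
    simp only [Matrix.of_apply, h.map_apply, sum_tabT22eps23]
    ring

lemma leftRankLE_T3eps23 {pos : Fin 5 → Fin n} (h : IsTable χ pos tabT3eps23) :
    χ.LeftRankLE 2 :=
  fun f x y => by
    refine (Matrix.det_fin_three _).trans ?_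
    simp only [Matrix.of_apply, h.map_apply, sum_tabT3eps23]
    ring

/-- Only four coordinates occur as factors, so each Pfaffian is a determinant in these coordinates
times the Pfaffian on e₁, …, e₄. The latter is, up to sign, the square of the value of f at the last
vector of the table, so its polarization has zero discriminant. The same holds for the next two
tables. -/
lemma pfSquare_T22eps24 {pos : Fin 6 → Fin n} (h : IsTable χ pos tabT22eps24) :
    χ.PfSquare :=
  fun f g x y z w => by
    simp only [pf, pfPolar, h.map_apply, sum_tabT22eps24]
    ring

lemma pfSquare_T3eps24 {pos : Fin 5 → Fin n} (h : IsTable χ pos tabT3eps24) :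
    χ.PfSquare :=
  fun f g x y z w => by
    simp only [pf, pfPolar, h.map_apply, sum_tabT3eps24]
    ring

lemma pfSquare_T222eps23 {pos : Fin 7 → Fin n} (h : IsTable χ pos tabT222eps23) :
    χ.PfSquare :=
  fun f g x y z w => by
    simp only [pf, pfPolar, h.map_apply, sum_tabT222eps23]
    ring

lemma not_sqRankLE_one_T22 {pos : Fin 5 → Fin n} (h : IsTable χ pos tabT22) :
    ¬ χ.SqRankLE 1 :=
  h.not_sqRankLE ![(0, 1, 3), (0, 2, 4)] (by decide) (by decide)

lemma not_sqRankLE_one_T3 {pos : Fin 5 → Fin n} (h : IsTable χ pos tabT3) :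
    ¬ χ.SqRankLE 1 :=
  h.not_sqRankLE ![(0, 1, 2), (0, 2, 4)] (by decide) (by decide)

lemma not_sqRankLE_one_T22eps23 {pos : Fin 6 → Fin n} (h : IsTable χ pos tabT22eps23) :
    ¬ χ.SqRankLE 1 :=
  h.not_sqRankLE ![(0, 1, 3), (0, 2, 4)] (by decide) (by decide)

lemma not_sqRankLE_one_T22eps24 {pos : Fin 6 → Fin n} (h : IsTable χ pos tabT22eps24) :
    ¬ χ.SqRankLE 1 :=
  h.not_sqRankLE ![(0, 1, 4), (0, 2, 5)] (by decide) (by decide)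

lemma not_sqRankLE_one_T222 {pos : Fin 7 → Fin n} (h : IsTable χ pos tabT222) :
    ¬ χ.SqRankLE 1 :=
  h.not_sqRankLE ![(0, 1, 4), (0, 2, 5)] (by decide) (by decide)

lemma not_sqRankLE_one_T22eps34 {pos : Fin 6 → Fin n} (h : IsTable χ pos tabT22eps34) :
    ¬ χ.SqRankLE 1 :=
  h.not_sqRankLE ![(0, 1, 4), (2, 3, 5)] (by decide) (by decide)

lemma not_sqRankLE_one_T3eps23 {pos : Fin 5 → Fin n} (h : IsTable χ pos tabT3eps23) :
    ¬ χ.SqRankLE 1 :=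
  h.not_sqRankLE ![(0, 1, 2), (0, 2, 4)] (by decide) (by decide)

lemma not_sqRankLE_one_T3eps24 {pos : Fin 5 → Fin n} (h : IsTable χ pos tabT3eps24) :
    ¬ χ.SqRankLE 1 :=
  h.not_sqRankLE ![(0, 1, 2), (0, 2, 4)] (by decide) (by decide)

lemma not_sqRankLE_one_T222eps23 {pos : Fin 7 → Fin n} (h : IsTable χ pos tabT222eps23) :
    ¬ χ.SqRankLE 1 :=
  h.not_sqRankLE ![(0, 1, 4), (0, 2, 5)] (by decide) (by decide)

lemma not_sqRankLE_one_T32 {pos : Fin 6 → Fin n} (h : IsTable χ pos tabT32) :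
    ¬ χ.SqRankLE 1 :=
  h.not_sqRankLE ![(0, 1, 4), (0, 2, 3)] (by decide) (by decide)

lemma not_sqRankLE_one_T2222 {pos : Fin 9 → Fin n} (h : IsTable χ pos tabT2222) :
    ¬ χ.SqRankLE 1 :=
  h.not_sqRankLE ![(0, 1, 5), (0, 2, 6)] (by decide) (by decide)

lemma not_sqRankLE_two_T22eps23 {pos : Fin 6 → Fin n} (h : IsTable χ pos tabT22eps23) :
    ¬ χ.SqRankLE 2 :=
  h.not_sqRankLE ![(0, 1, 3), (0, 2, 4), (1, 2, 5)] (by decide) (by decide)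

lemma not_sqRankLE_two_T222 {pos : Fin 7 → Fin n} (h : IsTable χ pos tabT222) :
    ¬ χ.SqRankLE 2 :=
  h.not_sqRankLE ![(0, 1, 4), (0, 2, 5), (0, 3, 6)] (by decide) (by decide)

lemma not_sqRankLE_two_T3eps23 {pos : Fin 5 → Fin n} (h : IsTable χ pos tabT3eps23) :
    ¬ χ.SqRankLE 2 :=
  h.not_sqRankLE ![(0, 1, 2), (0, 2, 4), (1, 2, 3)] (by decide) (by decide)

lemma not_sqRankLE_two_T222eps23 {pos : Fin 7 → Fin n} (h : IsTable χ pos tabT222eps23) :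
    ¬ χ.SqRankLE 2 :=
  h.not_sqRankLE ![(0, 1, 4), (0, 2, 5), (0, 3, 6)] (by decide) (by decide)

lemma not_sqRankLE_two_T32 {pos : Fin 6 → Fin n} (h : IsTable χ pos tabT32) :
    ¬ χ.SqRankLE 2 :=
  h.not_sqRankLE ![(0, 1, 4), (0, 2, 3), (0, 3, 5)] (by decide) (by decide)

lemma not_sqRankLE_two_T2222 {pos : Fin 9 → Fin n} (h : IsTable χ pos tabT2222) :
    ¬ χ.SqRankLE 2 :=
  h.not_sqRankLE ![(0, 1, 5), (0, 2, 6), (0, 3, 7)] (by decide) (by decide)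

lemma not_sqRankLE_two_T4 {pos : Fin 5 → Fin n} (h : IsTable χ pos tabT4) :
    ¬ χ.SqRankLE 2 :=
  h.not_sqRankLE ![(0, 1, 2), (0, 2, 3), (0, 3, 4)] (by decide) (by decide)

lemma not_sqRankLE_three_T2222 {pos : Fin 9 → Fin n} (h : IsTable χ pos tabT2222) :
    ¬ χ.SqRankLE 3 :=
  h.not_sqRankLE ![(0, 1, 5), (0, 2, 6), (0, 3, 7), (0, 4, 8)] (by decide) (by decide)

lemma not_sqRankLE_zero_Eta1 {pos : Fin 3 → Fin n} (h : IsTable χ pos tabEta1) :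
    ¬ χ.SqRankLE 0 :=
  h.not_sqRankLE ![(0, 1, 2)] (by decide) (by decide)

lemma not_leftRankLE_T222 {pos : Fin 7 → Fin n} (h : IsTable χ pos tabT222) :
    ¬ χ.LeftRankLE 2 :=
  h.not_leftRankLE 0 ![(1, 4), (2, 5), (3, 6)] (by decide) (by decide)

lemma not_leftRankLE_T222eps23 {pos : Fin 7 → Fin n} (h : IsTable χ pos tabT222eps23) :
    ¬ χ.LeftRankLE 2 :=
  h.not_leftRankLE 0 ![(1, 4), (2, 5), (3, 6)] (by decide) (by decide)

lemma not_leftRankLE_T32 {pos : Fin 6 → Fin n} (h : IsTable χ pos tabT32) :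
    ¬ χ.LeftRankLE 2 :=
  h.not_leftRankLE 0 ![(1, 4), (2, 3), (3, 5)] (by decide) (by decide)

lemma not_leftRankLE_T2222 {pos : Fin 9 → Fin n} (h : IsTable χ pos tabT2222) :
    ¬ χ.LeftRankLE 2 :=
  h.not_leftRankLE 0 ![(1, 5), (2, 6), (3, 7)] (by decide) (by decide)

lemma not_leftRankLE_T4 {pos : Fin 5 → Fin n} (h : IsTable χ pos tabT4) :
    ¬ χ.LeftRankLE 2 :=
  h.not_leftRankLE 0 ![(1, 2), (2, 3), (3, 4)] (by decide) (by decide)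

lemma not_formRankLE_Eta3 {pos : Fin 7 → Fin n} (h : IsTable χ pos tabEta3) :
    ¬ χ.FormRankLE 4 :=
  h.not_formRankLE 6 ![0, 1, 2, 3, 4] ![1, 0, 3, 2, 5] (by decide)

lemma not_formRankLE_four_Eta4 {pos : Fin 9 → Fin n} (h : IsTable χ pos tabEta4) :
    ¬ χ.FormRankLE 4 :=
  h.not_formRankLE 8 ![0, 1, 2, 3, 4] ![1, 0, 3, 2, 5] (by decide)

lemma not_formRankLE_six_Eta4 {pos : Fin 9 → Fin n} (h : IsTable χ pos tabEta4) :
    ¬ χ.FormRankLE 6 :=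
  h.not_formRankLE 8 ![0, 1, 2, 3, 4, 5, 6] ![1, 0, 3, 2, 5, 4, 7] (by decide)

lemma not_twoStep_T3 {pos : Fin 5 → Fin n} (h : IsTable χ pos tabT3) :
    ¬ χ.TwoStep :=
  h.not_twoStep 0 0 1 2 4 (by decide) (by decide)

lemma not_twoStep_T3eps23 {pos : Fin 5 → Fin n} (h : IsTable χ pos tabT3eps23) :
    ¬ χ.TwoStep :=
  h.not_twoStep 0 0 1 2 4 (by decide) (by decide)

lemma not_twoStep_T3eps24 {pos : Fin 5 → Fin n} (h : IsTable χ pos tabT3eps24) :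
    ¬ χ.TwoStep :=
  h.not_twoStep 0 0 1 2 4 (by decide) (by decide)

lemma not_twoStep_T32 {pos : Fin 6 → Fin n} (h : IsTable χ pos tabT32) :
    ¬ χ.TwoStep :=
  h.not_twoStep 0 0 2 3 5 (by decide) (by decide)

lemma not_pfZero_Eta2 {pos : Fin 5 → Fin n} (h : IsTable χ pos tabEta2) :
    ¬ χ.PfZero :=
  fun hp => by
    have := hp
      (LinearMap.proj (pos 4))
      (Pi.single (pos 0) 1) (Pi.single (pos 1) 1) (Pi.single (pos 2) 1) (Pi.single (pos 3) 1)
    simp [pf, h.coord, tableCoeff, tabEta2] at this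

lemma not_pfZero_Eta3 {pos : Fin 7 → Fin n} (h : IsTable χ pos tabEta3) :
    ¬ χ.PfZero :=
  fun hp => by
    have := hp
      (LinearMap.proj (pos 6))
      (Pi.single (pos 0) 1) (Pi.single (pos 1) 1) (Pi.single (pos 2) 1) (Pi.single (pos 3) 1)
    simp [pf, h.coord, tableCoeff, tabEta3] at this

lemma not_pfZero_Eta4 {pos : Fin 9 → Fin n} (h : IsTable χ pos tabEta4) :
    ¬ χ.PfZero :=
  fun hp => by
    have := hp
      (LinearMap.proj (pos 8))
      (Pi.single (pos 0) 1) (Pi.single (pos 1) 1) (Pi.single (pos 2) 1) (Pi.single (pos 3) 1)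
    simp [pf, h.coord, tableCoeff, tabEta4] at this

lemma not_pfZero_T22eps24 {pos : Fin 6 → Fin n} (h : IsTable χ pos tabT22eps24) :
    ¬ χ.PfZero :=
  fun hp => by
    have := hp
      (LinearMap.proj (pos 5))
      (Pi.single (pos 0) 1) (Pi.single (pos 2) 1) (Pi.single (pos 1) 1) (Pi.single (pos 3) 1)
    simp [pf, h.coord, tableCoeff, tabT22eps24] at this

lemma not_pfZero_T22eps34 {pos : Fin 6 → Fin n} (h : IsTable χ pos tabT22eps34) :
    ¬ χ.PfZero :=
  fun hp => by
    -- The forms of the two coordinate functionals are decomposable; only a combination of both has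
    -- rank 4.
    have := hp
      ((LinearMap.proj (pos 4) : (Fin n → k) →ₗ[k] k) + (LinearMap.proj (pos 5) : (Fin n → k) →ₗ[k] k))
      (Pi.single (pos 0) 1) (Pi.single (pos 1) 1) (Pi.single (pos 2) 1) (Pi.single (pos 3) 1)
    simp [pf, h.coord, tableCoeff, tabT22eps34] at this

lemma not_pfZero_T3eps24 {pos : Fin 5 → Fin n} (h : IsTable χ pos tabT3eps24) :
    ¬ χ.PfZero :=
  fun hp => by
    have := hp
      (LinearMap.proj (pos 4))
      (Pi.single (pos 0) 1) (Pi.single (pos 2) 1) (Pi.single (pos 1) 1) (Pi.single (pos 3) 1)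
    simp [pf, h.coord, tableCoeff, tabT3eps24] at this

lemma not_pfZero_T222eps23 {pos : Fin 7 → Fin n} (h : IsTable χ pos tabT222eps23) :
    ¬ χ.PfZero :=
  fun hp => by
    have := hp
      (LinearMap.proj (pos 6))
      (Pi.single (pos 0) 1) (Pi.single (pos 3) 1) (Pi.single (pos 1) 1) (Pi.single (pos 2) 1)
    simp [pf, h.coord, tableCoeff, tabT222eps23] at this

/-- On e₁, …, e₄ the Pfaffian of s times one coordinate functional plus t times the other is st,
whose discriminant is 1. This is valid in characteristic 2 as well. -/
lemma not_pfSquare_T22eps34 {pos : Fin 6 → Fin n} (h : IsTable χ pos tabT22eps34) :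
    ¬ χ.PfSquare :=
  fun hp => by
    have := hp (LinearMap.proj (pos 4)) (LinearMap.proj (pos 5)) (Pi.single (pos 0) 1)
      (Pi.single (pos 1) 1) (Pi.single (pos 2) 1) (Pi.single (pos 3) 1)
    simp [pf, pfPolar, h.coord, tableCoeff, tabT22eps34] at this

lemma not_triangleDependent_T22eps23 {pos : Fin 6 → Fin n} (h : IsTable χ pos tabT22eps23) :
    ¬ χ.TriangleDependent :=
  fun hp => by
    have := hp 
      (fun i => (LinearMap.proj (pos (![3, 4, 5] i)) : (Fin n → k) →ₗ[k] k))
      (fun i => Pi.single (pos (![0, 1, 2] i)) 1)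
    simp [Matrix.det_fin_three, fin3_succ, h.coord, tableCoeff, tabT22eps23] at this

lemma not_triangleDependent_T3eps23 {pos : Fin 5 → Fin n} (h : IsTable χ pos tabT3eps23) :
    ¬ χ.TriangleDependent :=
  fun hp => by
    have := hp 
      (fun i => (LinearMap.proj (pos (![2, 3, 4] i)) : (Fin n → k) →ₗ[k] k))
      (fun i => Pi.single (pos (![0, 1, 2] i)) 1)
    simp [Matrix.det_fin_three, fin3_succ, h.coord, tableCoeff, tabT3eps23] at this

end Invariants
end AlgStr

/-! ### Explicit degenerations between the tables -/

namespace AlgStr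

variable {k : Type*} [Field k] {n m : ℕ}

section Degenerations

variable [Infinite k] {μ χ : AlgStr k n}

lemma degenerates_Eta4_Eta3 {pos : Fin 9 → Fin n} {pos' : Fin 7 → Fin n}
    (h : IsTable μ pos tabEta4) (h' : IsTable χ pos' tabEta3) : μ.Degenerates χ :=
  h.degenerates h' ![0, 1, 2, 3, 4, 5, 8] ![1, 1, 1, 1, 1, 1, 2] 2 (by decide) (by decide) (by decide)
    (by decide) (by decide) (by decide)

lemma degenerates_T3eps23_T3 {pos : Fin 5 → Fin n} {pos' : Fin 5 → Fin n}
    (h : IsTable μ pos tabT3eps23) (h' : IsTable χ pos' tabT3) : μ.Degenerates χ :=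
  h.degenerates h' ![0, 1, 2, 3, 4] ![1, 2, 3, 4, 4] 4 (by decide) (by decide) (by decide)
    (by decide) (by decide) (by decide)

lemma degenerates_T3eps24_T3 {pos : Fin 5 → Fin n} {pos' : Fin 5 → Fin n}
    (h : IsTable μ pos tabT3eps24) (h' : IsTable χ pos' tabT3) : μ.Degenerates χ :=
  h.degenerates h' ![0, 1, 2, 3, 4] ![1, 2, 3, 4, 4] 4 (by decide) (by decide) (by decide)
    (by decide) (by decide) (by decide)

lemma degenerates_T222eps23_T222 {pos : Fin 7 → Fin n} {pos' : Fin 7 → Fin n}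
    (h : IsTable μ pos tabT222eps23) (h' : IsTable χ pos' tabT222) : μ.Degenerates χ :=
  h.degenerates h' ![0, 1, 2, 3, 4, 5, 6] ![1, 2, 2, 2, 3, 3, 3] 3 (by decide) (by decide) (by decide)
    (by decide) (by decide) (by decide)

lemma degenerates_T32_T3 {pos : Fin 6 → Fin n} {pos' : Fin 5 → Fin n}
    (h : IsTable μ pos tabT32) (h' : IsTable χ pos' tabT3) : μ.Degenerates χ :=
  h.degenerates h' ![0, 2, 3, 1, 5] ![1, 2, 3, 4, 4] 4 (by decide) (by decide) (by decide)
    (by decide) (by decide) (by decide)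

lemma degenerates_T2222_T222 {pos : Fin 9 → Fin n} {pos' : Fin 7 → Fin n}
    (h : IsTable μ pos tabT2222) (h' : IsTable χ pos' tabT222) : μ.Degenerates χ :=
  h.degenerates h' ![0, 1, 2, 3, 5, 6, 7] ![1, 2, 2, 2, 3, 3, 3] 3 (by decide) (by decide) (by decide)
    (by decide) (by decide) (by decide)

lemma degenerates_T4_T3 {pos : Fin 5 → Fin n} {pos' : Fin 5 → Fin n}
    (h : IsTable μ pos tabT4) (h' : IsTable χ pos' tabT3) : μ.Degenerates χ :=
  h.degenerates h' ![0, 1, 2, 4, 3] ![1, 2, 3, 4, 4] 4 (by decide) (by decide) (by decide)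
    (by decide) (by decide) (by decide)

lemma degenerates_Eta3_Eta2 {pos : Fin 7 → Fin n} {pos' : Fin 5 → Fin n}
    (h : IsTable μ pos tabEta3) (h' : IsTable χ pos' tabEta2) : μ.Degenerates χ :=
  h.degenerates h' ![0, 1, 2, 3, 6] ![1, 1, 1, 1, 2] 2 (by decide) (by decide) (by decide)
    (by decide) (by decide) (by decide)

lemma degenerates_T22eps23_T22 {pos : Fin 6 → Fin n} {pos' : Fin 5 → Fin n}
    (h : IsTable μ pos tabT22eps23) (h' : IsTable χ pos' tabT22) : μ.Degenerates χ :=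
  h.degenerates h' ![0, 1, 2, 3, 4] ![1, 2, 2, 3, 3] 3 (by decide) (by decide) (by decide)
    (by decide) (by decide) (by decide)

lemma degenerates_T22eps24_T22 {pos : Fin 6 → Fin n} {pos' : Fin 5 → Fin n}
    (h : IsTable μ pos tabT22eps24) (h' : IsTable χ pos' tabT22) : μ.Degenerates χ :=
  h.degenerates h' ![0, 1, 2, 4, 5] ![1, 2, 2, 3, 3] 3 (by decide) (by decide) (by decide)
    (by decide) (by decide) (by decide)

lemma degenerates_T222_T22 {pos : Fin 7 → Fin n} {pos' : Fin 5 → Fin n}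
    (h : IsTable μ pos tabT222) (h' : IsTable χ pos' tabT22) : μ.Degenerates χ :=
  h.degenerates h' ![0, 1, 2, 4, 5] ![1, 2, 2, 3, 3] 3 (by decide) (by decide) (by decide)
    (by decide) (by decide) (by decide)

lemma degenerates_Eta2_Eta1 {pos : Fin 5 → Fin n} {pos' : Fin 3 → Fin n}
    (h : IsTable μ pos tabEta2) (h' : IsTable χ pos' tabEta1) : μ.Degenerates χ :=
  h.degenerates h' ![0, 1, 4] ![1, 1, 2] 2 (by decide) (by decide) (by decide)
    (by decide) (by decide) (by decide)

lemma degenerates_T22_Eta1 {pos : Fin 5 → Fin n} {pos' : Fin 3 → Fin n}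
    (h : IsTable μ pos tabT22) (h' : IsTable χ pos' tabEta1) : μ.Degenerates χ :=
  h.degenerates h' ![0, 1, 3] ![1, 1, 2] 2 (by decide) (by decide) (by decide)
    (by decide) (by decide) (by decide)

/-- The string a → b → c → z is cut by adding the idle vector to c: the product ab = c now has
weight 3, while the vector of weight 2 that a sends to z is c plus the idle vector. -/
lemma degenerates_T3_T22 {pos : Fin 5 → Fin n} {pos' : Fin 5 → Fin n}
    (h : IsTable μ pos tabT3) (h' : IsTable χ pos' tabT22) : μ.Degenerates χ := by
  let e : Fin 5 → Fin n → k := fun i => Pi.single (pos i) 1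
  have hs : ∀ i j, μ (e i) (e j) = ∑ l, tableCoeff k tabT3 i j l • e l := h.single_apply
  refine degenerates_of_weights h.alternating h' (v := ![e 0, e 1, e 2 + e 3, e 2, e 4]) ?_
    ![1, 2, 2, 3, 3] 3 (by decide) (by decide) (by decide) ?_
  · have hl : LinearIndependent k e := linearIndependent_single_comp h.inj
    rw [Fintype.linearIndependent_iff] at hl ⊢
    intro g hg
    have h0 := hl ![g 0, g 1, g 2 + g 3, g 2, g 4] (by
      rw [← hg]
      simp [Fin.sum_univ_succ]
      module)
    have h1 : g 2 = 0 := h0 3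
    have h2 : g 2 + g 3 = 0 := h0 2
    intro i
    fin_cases i
    exacts [h0 0, h0 1, h1, by simpa [h1] using h2, h0 4]
  · intro i j hij hle
    fin_cases i <;> fin_cases j <;> first
      | (exfalso; revert hij hle; decide)
      | skip
    all_goals simp [hs, tableCoeff, tabT3, tabT22]

/-- The basis change makes e₂ + e₃ a vector of weight 1. Its products with e₁ and e₄ survive in the
limit, whereas e₃e₄ has weight 4, above the cutoff 3. -/
lemma degenerates_T22eps34_T22eps24 {pos : Fin 6 → Fin n} {pos' : Fin 6 → Fin n}
    (h : IsTable μ pos tabT22eps34) (h' : IsTable χ pos' tabT22eps24) : μ.Degenerates χ := by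
  let e : Fin 6 → Fin n → k := fun i => Pi.single (pos i) 1
  have hs : ∀ i j, μ (e i) (e j) = ∑ l, tableCoeff k tabT22eps34 i j l • e l := h.single_apply
  refine degenerates_of_weights h.alternating h'
    (v := ![e 0, e 1 + e 2, e 2, e 3, e 4 + e 5, e 5]) ?_
    ![1, 1, 2, 2, 2, 3] 3 (by decide) (by decide) (by decide) ?_
  · have hl : LinearIndependent k e := linearIndependent_single_comp h.inj
    rw [Fintype.linearIndependent_iff] at hl ⊢
    intro g hg
    have h0 := hl ![g 0, g 1, g 1 + g 2, g 3, g 4, g 4 + g 5] (by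
      rw [← hg]
      simp [Fin.sum_univ_succ]
      module)
    have h1 : g 1 = 0 := h0 1
    have h2 : g 1 + g 2 = 0 := h0 2
    have h3 : g 4 = 0 := h0 4
    have h4 : g 4 + g 5 = 0 := h0 5
    intro i
    fin_cases i
    exacts [h0 0, h1, by simpa [h1] using h2, h0 3, h3, by simpa [h3] using h4]
  · intro i j hij hle
    fin_cases i <;> fin_cases j <;> first
      | (exfalso; revert hij hle; decide)
      | skip
    all_goals simp [hs, tableCoeff, tabT22eps34, tabT22eps24]

end Degenerations

end AlgStr

/-! ### The list by levels, and degenerations inside the list -/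

namespace AlgStr

variable {k : Type*} [Field k] {n m : ℕ}

/-- `μ` is isomorphic to a structure with the multiplication table `T`. -/
def HasTable (T : Finset (Fin m × Fin m × Fin m)) (μ : AlgStr k n) : Prop :=
  ∃ (χ : AlgStr k n) (pos : Fin m → Fin n), IsTable χ pos T ∧ χ ∈ μ.orbit

lemma exists_isTable (k : Type*) [Field k] (hm : m ≤ n) {T : Finset (Fin m × Fin m × Fin m)}
    (hT : ∀ i j l, (i, j, l) ∈ T → (j, i, l) ∉ T) :
    ∃ (χ : AlgStr k n) (pos : Fin m → Fin n), IsTable χ pos T :=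
  ⟨_, _, isTable_ofTable (Fin.castLE_injective hm) hT rfl⟩

section HasTable

variable {μ ν : AlgStr k n} {T : Finset (Fin m × Fin m × Fin m)} {m' : ℕ}
  {T' : Finset (Fin m' × Fin m' × Fin m')}

lemma IsTable.hasTable {pos : Fin m → Fin n} (h : IsTable μ pos T) : HasTable T μ :=
  ⟨μ, pos, h, mem_orbit_self μ⟩

lemma HasTable.card_le (h : HasTable T μ) : m ≤ n := by
  obtain ⟨χ, pos, h, -⟩ := h
  simpa using Fintype.card_le_of_injective pos h.inj

lemma HasTable.of_mem_orbit (h : HasTable T μ) (h' : μ ∈ ν.orbit) : HasTable T ν := by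
  obtain ⟨χ, pos, h, ho⟩ := h
  exact ⟨χ, pos, h, mem_orbit_trans h' ho⟩

lemma HasTable.mem_orbit (h : HasTable T μ) (h' : HasTable T ν) : ν ∈ μ.orbit := by
  obtain ⟨χ, pos, h, ho⟩ := h
  obtain ⟨χ', pos', h', ho'⟩ := h'
  exact mem_orbit_trans (mem_orbit_trans ho (h.mem_orbit h')) (mem_orbit_symm ho')

lemma HasTable.not_degenerates (hμ : HasTable T μ) (hν : HasTable T' ν)
    {P : AlgStr k n → Prop} (hP : ∀ {χ : AlgStr k n} {pos}, IsTable χ pos T → P χ)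
    (hP' : ∀ {χ : AlgStr k n} {pos}, IsTable χ pos T' → ¬P χ)
    (hd : ∀ {χ χ' : AlgStr k n}, P χ → χ.Degenerates χ' → P χ') : ¬μ.Degenerates ν := by
  intro h
  obtain ⟨χ, pos, h₁, ho⟩ := hμ
  obtain ⟨χ', pos', h₂, ho'⟩ := hν
  exact hP' h₂ (hd (hP h₁) (((degenerates_of_mem_orbit (mem_orbit_symm ho)).trans h).trans
    (degenerates_of_mem_orbit ho')))

lemma HasTable.exists_degeneration (hμ : HasTable T μ) (hm : m' ≤ m)
    (hT : ∀ i j l, (i, j, l) ∈ T' → (j, i, l) ∉ T')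
    (h : ∀ {χ χ' : AlgStr k n} {pos pos'}, IsTable χ pos T → IsTable χ' pos' T' → χ.Degenerates χ')
    {P : AlgStr k n → Prop} (hP : ∀ {χ : AlgStr k n} {pos}, IsTable χ pos T' → P χ)
    (hP' : ∀ {χ : AlgStr k n} {pos}, IsTable χ pos T → ¬P χ)
    (hd : ∀ {χ χ' : AlgStr k n}, P χ → χ.Degenerates χ' → P χ') :
    ∃ ν : AlgStr k n, HasTable T' ν ∧ μ.Degenerates ν ∧ ¬ν.Degenerates μ := by
  obtain ⟨ν, pos', hν⟩ := exists_isTable k (hm.trans hμ.card_le) hT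
  refine ⟨ν, hν.hasTable, ?_, hν.hasTable.not_degenerates hμ hP hP' hd⟩
  obtain ⟨χ, pos, h₁, ho⟩ := hμ
  exact (degenerates_of_mem_orbit ho).trans (h h₁ hν)

end HasTable

/-- The structures of level at most four, by level. -/
def IsLevel (μ : AlgStr k n) : ℕ → Prop
  | 0 => μ = 0
  | 1 => HasTable tabEta1 μ
  | 2 => HasTable tabEta2 μ ∨ HasTable tabT22 μ
  | 3 => HasTable tabEta3 μ ∨ HasTable tabT222 μ ∨ HasTable tabT22eps23 μ ∨
      HasTable tabT22eps24 μ ∨ HasTable tabT3 μ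
  | 4 => HasTable tabEta4 μ ∨ HasTable tabT22eps34 μ ∨ HasTable tabT3eps23 μ ∨
      HasTable tabT3eps24 μ ∨ HasTable tabT222eps23 μ ∨ HasTable tabT32 μ ∨
      HasTable tabT2222 μ ∨ n = 5 ∧ HasTable tabT4 μ
  | _ => False

variable {μ ν : AlgStr k n}

lemma IsLevel.le_four {d : ℕ} (h : μ.IsLevel d) : d ≤ 4 := by
  by_contra! hd
  obtain ⟨d, rfl⟩ := Nat.exists_eq_add_of_lt hd
  rw [show 4 + d + 1 = d + 5 by ring] at h
  exact h

lemma eq_zero_of_mem_orbit (h : μ ∈ (0 : AlgStr k n).orbit) : μ = 0 := by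
  obtain ⟨g, rfl⟩ := h
  ext
  simp

lemma IsLevel.of_mem_orbit {d : ℕ} (h : μ.IsLevel d) (h' : μ ∈ ν.orbit) : ν.IsLevel d := by
  match d with
  | 0 =>
    obtain rfl : μ = 0 := h
    exact eq_zero_of_mem_orbit (mem_orbit_symm h')
  | 1 => exact HasTable.of_mem_orbit h h'
  | 2 => exact Or.imp (·.of_mem_orbit h') (·.of_mem_orbit h') h
  | 3 =>
    rcases h with h | h | h | h | h
    exacts [.inl (h.of_mem_orbit h'), .inr (.inl (h.of_mem_orbit h')),
      .inr (.inr (.inl (h.of_mem_orbit h'))), .inr (.inr (.inr (.inl (h.of_mem_orbit h')))),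
      .inr (.inr (.inr (.inr (h.of_mem_orbit h'))))]
  | 4 =>
    rcases h with h | h | h | h | h | h | h | ⟨hn, h⟩ <;> have := h.of_mem_orbit h' <;>
      simp only [IsLevel] <;> tauto
  | d + 5 => exact h

open HasTable in
-- Isomorphism types of equal level form an antichain: for each ordered pair of different tables
-- some closed condition holds for the source and fails for the target.
lemma IsLevel.mem_orbit_of_degenerates {d : ℕ} (hμ : μ.IsLevel d) (hν : ν.IsLevel d)
    (h : μ.Degenerates ν) : ν ∈ μ.orbit := by
  match d with
  | 0 =>
    obtain rfl : μ = 0 := hμ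
    obtain rfl : ν = 0 := hν
    exact mem_orbit_self _
  | 1 => exact HasTable.mem_orbit hμ hν
  | 2 =>
    rcases hμ with hμ | hμ <;> rcases hν with hν | hν <;> try exact hμ.mem_orbit hν
    · exact absurd h (not_degenerates hμ hν sqRankLE_Eta2 not_sqRankLE_one_T22 (·.of_degenerates))
    · exact absurd h (not_degenerates hμ hν pfZero_T22 not_pfZero_Eta2 (·.of_degenerates))
  | 3 =>
    rcases hμ with hμ | hμ | hμ | hμ | hμ <;> rcases hν with hν | hν | hν | hν | hν <;>
      first
        | exact hμ.mem_orbit hν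
        | refine absurd h ?_
    · exact not_degenerates hμ hν sqRankLE_Eta3 not_sqRankLE_one_T222 (·.of_degenerates)
    · exact not_degenerates hμ hν sqRankLE_Eta3 not_sqRankLE_one_T22eps23 (·.of_degenerates)
    · exact not_degenerates hμ hν sqRankLE_Eta3 not_sqRankLE_one_T22eps24 (·.of_degenerates)
    · exact not_degenerates hμ hν sqRankLE_Eta3 not_sqRankLE_one_T3 (·.of_degenerates)
    · exact not_degenerates hμ hν pfZero_T222 not_pfZero_Eta3 (·.of_degenerates)
    · exact not_degenerates hμ hν triangleDependent_T222 not_triangleDependent_T22eps23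
        (·.of_degenerates)
    · exact not_degenerates hμ hν pfZero_T222 not_pfZero_T22eps24 (·.of_degenerates)
    · exact not_degenerates hμ hν twoStep_T222 not_twoStep_T3 (·.of_degenerates)
    · exact not_degenerates hμ hν pfZero_T22eps23 not_pfZero_Eta3 (·.of_degenerates)
    · exact not_degenerates hμ hν leftRankLE_T22eps23 not_leftRankLE_T222 (·.of_degenerates)
    · exact not_degenerates hμ hν pfZero_T22eps23 not_pfZero_T22eps24 (·.of_degenerates)
    · exact not_degenerates hμ hν twoStep_T22eps23 not_twoStep_T3 (·.of_degenerates)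
    · exact not_degenerates hμ hν formRankLE_T22eps24 not_formRankLE_Eta3 (·.of_degenerates)
    · exact not_degenerates hμ hν sqRankLE_T22eps24 not_sqRankLE_two_T222 (·.of_degenerates)
    · exact not_degenerates hμ hν sqRankLE_T22eps24 not_sqRankLE_two_T22eps23 (·.of_degenerates)
    · exact not_degenerates hμ hν twoStep_T22eps24 not_twoStep_T3 (·.of_degenerates)
    · exact not_degenerates hμ hν pfZero_T3 not_pfZero_Eta3 (·.of_degenerates)
    · exact not_degenerates hμ hν sqRankLE_T3 not_sqRankLE_two_T222 (·.of_degenerates)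
    · exact not_degenerates hμ hν sqRankLE_T3 not_sqRankLE_two_T22eps23 (·.of_degenerates)
    · exact not_degenerates hμ hν pfZero_T3 not_pfZero_T22eps24 (·.of_degenerates)
  | 4 =>
    -- For n = 5, tables on more than five vectors do not occur, so T⁴ need only be compared with
    -- the two T³ structures.
    have hcard : ∀ {m : ℕ} {T : Finset (Fin m × Fin m × Fin m)} {ν : AlgStr k n}, HasTable T ν →
        n = 5 → m ≤ 5 := fun h hn => hn ▸ h.card_le
    rcases hμ with hμ | hμ | hμ | hμ | hμ | hμ | hμ | ⟨hn, hμ⟩ <;>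
      rcases hν with hν | hν | hν | hν | hν | hν | hν | ⟨hn', hν⟩ <;>
      first
        | exact hμ.mem_orbit hν
        | (exfalso; have := hcard hμ hn'; omega)
        | (exfalso; have := hcard hν hn; omega)
        | refine absurd h ?_
    · exact not_degenerates hμ hν sqRankLE_Eta4 not_sqRankLE_one_T22eps34 (·.of_degenerates)
    · exact not_degenerates hμ hν sqRankLE_Eta4 not_sqRankLE_one_T3eps23 (·.of_degenerates)
    · exact not_degenerates hμ hν sqRankLE_Eta4 not_sqRankLE_one_T3eps24 (·.of_degenerates)
    · exact not_degenerates hμ hν sqRankLE_Eta4 not_sqRankLE_one_T222eps23 (·.of_degenerates)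
    · exact not_degenerates hμ hν sqRankLE_Eta4 not_sqRankLE_one_T32 (·.of_degenerates)
    · exact not_degenerates hμ hν sqRankLE_Eta4 not_sqRankLE_one_T2222 (·.of_degenerates)
    · exact not_degenerates hμ hν formRankLE_T22eps34 not_formRankLE_four_Eta4 (·.of_degenerates)
    · exact not_degenerates hμ hν sqRankLE_T22eps34 not_sqRankLE_two_T3eps23 (·.of_degenerates)
    · exact not_degenerates hμ hν twoStep_T22eps34 not_twoStep_T3eps24 (·.of_degenerates)
    · exact not_degenerates hμ hν sqRankLE_T22eps34 not_sqRankLE_two_T222eps23 (·.of_degenerates)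
    · exact not_degenerates hμ hν sqRankLE_T22eps34 not_sqRankLE_two_T32 (·.of_degenerates)
    · exact not_degenerates hμ hν sqRankLE_T22eps34 not_sqRankLE_two_T2222 (·.of_degenerates)
    · exact not_degenerates hμ hν pfZero_T3eps23 not_pfZero_Eta4 (·.of_degenerates)
    · exact not_degenerates hμ hν pfZero_T3eps23 not_pfZero_T22eps34 (·.of_degenerates)
    · exact not_degenerates hμ hν pfZero_T3eps23 not_pfZero_T3eps24 (·.of_degenerates)
    · exact not_degenerates hμ hν leftRankLE_T3eps23 not_leftRankLE_T222eps23 (·.of_degenerates)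
    · exact not_degenerates hμ hν leftRankLE_T3eps23 not_leftRankLE_T32 (·.of_degenerates)
    · exact not_degenerates hμ hν leftRankLE_T3eps23 not_leftRankLE_T2222 (·.of_degenerates)
    · exact not_degenerates hμ hν leftRankLE_T3eps23 not_leftRankLE_T4 (·.of_degenerates)
    · exact not_degenerates hμ hν formRankLE_T3eps24 not_formRankLE_four_Eta4 (·.of_degenerates)
    · exact not_degenerates hμ hν pfSquare_T3eps24 not_pfSquare_T22eps34 (·.of_degenerates)
    · exact not_degenerates hμ hν sqRankLE_T3eps24 not_sqRankLE_two_T3eps23 (·.of_degenerates)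
    · exact not_degenerates hμ hν sqRankLE_T3eps24 not_sqRankLE_two_T222eps23 (·.of_degenerates)
    · exact not_degenerates hμ hν sqRankLE_T3eps24 not_sqRankLE_two_T32 (·.of_degenerates)
    · exact not_degenerates hμ hν sqRankLE_T3eps24 not_sqRankLE_two_T2222 (·.of_degenerates)
    · exact not_degenerates hμ hν sqRankLE_T3eps24 not_sqRankLE_two_T4 (·.of_degenerates)
    · exact not_degenerates hμ hν formRankLE_T222eps23 not_formRankLE_four_Eta4 (·.of_degenerates)
    · exact not_degenerates hμ hν pfSquare_T222eps23 not_pfSquare_T22eps34 (·.of_degenerates)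
    · exact not_degenerates hμ hν twoStep_T222eps23 not_twoStep_T3eps23 (·.of_degenerates)
    · exact not_degenerates hμ hν twoStep_T222eps23 not_twoStep_T3eps24 (·.of_degenerates)
    · exact not_degenerates hμ hν twoStep_T222eps23 not_twoStep_T32 (·.of_degenerates)
    · exact not_degenerates hμ hν sqRankLE_T222eps23 not_sqRankLE_three_T2222 (·.of_degenerates)
    · exact not_degenerates hμ hν pfZero_T32 not_pfZero_Eta4 (·.of_degenerates)
    · exact not_degenerates hμ hν pfZero_T32 not_pfZero_T22eps34 (·.of_degenerates)
    · exact not_degenerates hμ hν triangleDependent_T32 not_triangleDependent_T3eps23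
        (·.of_degenerates)
    · exact not_degenerates hμ hν pfZero_T32 not_pfZero_T3eps24 (·.of_degenerates)
    · exact not_degenerates hμ hν pfZero_T32 not_pfZero_T222eps23 (·.of_degenerates)
    · exact not_degenerates hμ hν sqRankLE_T32 not_sqRankLE_three_T2222 (·.of_degenerates)
    · exact not_degenerates hμ hν pfZero_T2222 not_pfZero_Eta4 (·.of_degenerates)
    · exact not_degenerates hμ hν pfZero_T2222 not_pfZero_T22eps34 (·.of_degenerates)
    · exact not_degenerates hμ hν twoStep_T2222 not_twoStep_T3eps23 (·.of_degenerates)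
    · exact not_degenerates hμ hν pfZero_T2222 not_pfZero_T3eps24 (·.of_degenerates)
    · exact not_degenerates hμ hν pfZero_T2222 not_pfZero_T222eps23 (·.of_degenerates)
    · exact not_degenerates hμ hν twoStep_T2222 not_twoStep_T32 (·.of_degenerates)
    · exact not_degenerates hμ hν triangleDependent_T4 not_triangleDependent_T3eps23
        (·.of_degenerates)
    · exact not_degenerates hμ hν pfZero_T4 not_pfZero_T3eps24 (·.of_degenerates)
  | d + 5 => exact hμ.elim

open HasTable in
-- The target of the degeneration satisfies a closed condition that the source violates, which makes
-- the step irreversible.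
lemma IsLevel.exists_step [Infinite k] {d : ℕ} (h : μ.IsLevel (d + 1)) :
    ∃ ν : AlgStr k n, ν.IsLevel d ∧ μ.Degenerates ν ∧ ¬ν.Degenerates μ := by
  match d with
  | 0 =>
    refine ⟨0, rfl, ?_, fun hd => ?_⟩
    · obtain ⟨χ, pos, h, ho⟩ := h
      -- The zero structure is treated as an empty table on no positions, so that the weight
      -- criterion applies to it.
      have h0 : IsTable (0 : AlgStr k n) (Fin.elim0 : Fin 0 → Fin n) ∅ :=
        ⟨fun i => i.elim0, fun i => i.elim0, fun i => i.elim0, fun a b c h => absurd rfl h⟩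
      exact (degenerates_of_mem_orbit ho).trans (degenerates_of_weights h.alternating h0
        (v := Fin.elim0) linearIndependent_empty_type Fin.elim0 1 le_rfl (fun i => i.elim0)
        (fun i => i.elim0) (fun i => i.elim0))
    · obtain ⟨χ, pos, h, ho⟩ := h
      refine not_sqRankLE_zero_Eta1 h (SqRankLE.of_degenerates (d := 0) ?_
        (hd.trans (degenerates_of_mem_orbit ho)))
      intro f x y
      simp
  | 1 =>
    rcases h with h | h
    · exact exists_degeneration h (by norm_num) (by decide) degenerates_Eta2_Eta1 pfZero_Eta1
        not_pfZero_Eta2 (·.of_degenerates)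
    · exact exists_degeneration h (by norm_num) (by decide) degenerates_T22_Eta1 sqRankLE_Eta1
        not_sqRankLE_one_T22 (·.of_degenerates)
  | 2 =>
    rcases h with h | h | h | h | h
    · obtain ⟨ν, h, h'⟩ := exists_degeneration h (by norm_num) (by decide) degenerates_Eta3_Eta2
        formRankLE_Eta2 not_formRankLE_Eta3 (·.of_degenerates)
      exact ⟨ν, .inl h, h'⟩
    · obtain ⟨ν, h, h'⟩ := exists_degeneration h (by norm_num) (by decide) degenerates_T222_T22
        sqRankLE_T22 not_sqRankLE_two_T222 (·.of_degenerates)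
      exact ⟨ν, .inr h, h'⟩
    · obtain ⟨ν, h, h'⟩ := exists_degeneration h (by norm_num) (by decide) degenerates_T22eps23_T22
        sqRankLE_T22 not_sqRankLE_two_T22eps23 (·.of_degenerates)
      exact ⟨ν, .inr h, h'⟩
    · obtain ⟨ν, h, h'⟩ := exists_degeneration h (by norm_num) (by decide) degenerates_T22eps24_T22
        pfZero_T22 not_pfZero_T22eps24 (·.of_degenerates)
      exact ⟨ν, .inr h, h'⟩
    · obtain ⟨ν, h, h'⟩ := exists_degeneration h (by norm_num) (by decide) degenerates_T3_T22
        twoStep_T22 not_twoStep_T3 (·.of_degenerates)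
      exact ⟨ν, .inr h, h'⟩
  | 3 =>
    rcases h with h | h | h | h | h | h | h | ⟨-, h⟩
    · obtain ⟨ν, h, h'⟩ := exists_degeneration h (by norm_num) (by decide) degenerates_Eta4_Eta3
        formRankLE_Eta3 not_formRankLE_six_Eta4 (·.of_degenerates)
      exact ⟨ν, .inl h, h'⟩
    · obtain ⟨ν, h, h'⟩ := exists_degeneration h (by norm_num) (by decide) degenerates_T22eps34_T22eps24
        pfSquare_T22eps24 not_pfSquare_T22eps34 (·.of_degenerates)
      exact ⟨ν, .inr (.inr (.inr (.inl h))), h'⟩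
    · obtain ⟨ν, h, h'⟩ := exists_degeneration h (by norm_num) (by decide) degenerates_T3eps23_T3
        sqRankLE_T3 not_sqRankLE_two_T3eps23 (·.of_degenerates)
      exact ⟨ν, .inr (.inr (.inr (.inr h))), h'⟩
    · obtain ⟨ν, h, h'⟩ := exists_degeneration h (by norm_num) (by decide) degenerates_T3eps24_T3
        pfZero_T3 not_pfZero_T3eps24 (·.of_degenerates)
      exact ⟨ν, .inr (.inr (.inr (.inr h))), h'⟩
    · obtain ⟨ν, h, h'⟩ := exists_degeneration h (by norm_num) (by decide) degenerates_T222eps23_T222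
        pfZero_T222 not_pfZero_T222eps23 (·.of_degenerates)
      exact ⟨ν, .inr (.inl h), h'⟩
    · obtain ⟨ν, h, h'⟩ := exists_degeneration h (by norm_num) (by decide) degenerates_T32_T3
        sqRankLE_T3 not_sqRankLE_two_T32 (·.of_degenerates)
      exact ⟨ν, .inr (.inr (.inr (.inr h))), h'⟩
    · obtain ⟨ν, h, h'⟩ := exists_degeneration h (by norm_num) (by decide) degenerates_T2222_T222
        sqRankLE_T222 not_sqRankLE_three_T2222 (·.of_degenerates)
      exact ⟨ν, .inr (.inl h), h'⟩
    · obtain ⟨ν, h, h'⟩ := exists_degeneration h (by norm_num) (by decide) degenerates_T4_T3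
        sqRankLE_T3 not_sqRankLE_two_T4 (·.of_degenerates)
      exact ⟨ν, .inr (.inr (.inr (.inr h))), h'⟩
  | d + 4 => exact h.elim

lemma IsLevel.exists_descend [Infinite k] {d e : ℕ} (h : μ.IsLevel (d + e)) :
    ∃ ν : AlgStr k n, ν.IsLevel d ∧ μ.Degenerates ν ∧ (e ≠ 0 → ¬ν.Degenerates μ) := by
  induction e generalizing μ with
  | zero => exact ⟨μ, h, degenerates_of_mem_orbit (mem_orbit_self μ), fun h => absurd rfl h⟩
  | succ e ih =>
    obtain ⟨ν, hν, h₁, h₂⟩ := IsLevel.exists_step h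
    obtain ⟨ξ, hξ, h₃, -⟩ := ih hν
    exact ⟨ξ, hξ, h₁.trans h₃, fun _ h₄ => h₂ (h₃.trans h₄)⟩

/-- If the level increased, then descending from `ν` to the level of `μ` would reach a structure
isomorphic to `μ`, by the antichain property. That structure would degenerate back to `ν`, contrary
to the irreversibility of the descent. -/
lemma IsLevel.le_of_degenerates [Infinite k] {d d' : ℕ} (hμ : μ.IsLevel d) (hν : ν.IsLevel d')
    (h : μ.Degenerates ν) : d' ≤ d := by
  by_contra! hlt
  obtain ⟨e, rfl⟩ := Nat.exists_eq_add_of_lt hlt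
  obtain ⟨ξ, hξ, h₁, h₂⟩ := IsLevel.exists_descend (d := d) (e := e + 1) hν
  refine h₂ e.succ_ne_zero (Degenerates.trans (degenerates_of_mem_orbit (mem_orbit_symm ?_)) h)
  exact hμ.mem_orbit_of_degenerates hξ (h.trans h₁)

end AlgStr

/-! ### Nilpotent operators: no non-zero eigenvalues -/

lemma IsNilpotent.eq_bot_of_le_map {k V : Type*} [Field k] [AddCommGroup V] [Module k V]
    {T : V →ₗ[k] V} (hT : IsNilpotent T) {W : Submodule k V} (hW : W ≤ W.map T) : W = ⊥ := by
  obtain ⟨N, hN⟩ := hT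
  have h : ∀ r : ℕ, W ≤ W.map (T ^ r) := by
    intro r
    induction r with
    | zero => simp [Module.End.one_eq_id]
    | succ r ih =>
      refine hW.trans ((Submodule.map_mono ih).trans ?_)
      rw [← Submodule.map_comp, pow_succ']
      rfl
  simpa [hN] using h N

/-- On the quotient by the invariant subspace `N`, the class of `x` is an eigenvector of a nilpotent
operator. -/
lemma IsNilpotent.eq_zero_of_sub_smul_mem {k V : Type*} [Field k] [AddCommGroup V] [Module k V]
    {T : V →ₗ[k] V} (hT : IsNilpotent T) {N : Submodule k V} (hN : N ≤ N.comap T) {x : V} {c : k}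
    (hx : x ∉ N) (h : T x - c • x ∈ N) : c = 0 := by
  obtain ⟨m, hm⟩ := hT
  have hr : ∀ r : ℕ, (T ^ r) x - c ^ r • x ∈ N := by
    intro r
    induction r with
    | zero => simp
    | succ r ih =>
      have h1 := N.add_mem (hN ih) (N.smul_mem (c ^ r) h)
      convert! h1 using 1
      rw [pow_succ' T, show c ^ (r + 1) = c ^ r * c from _root_.pow_succ c r]
      simp [smul_sub, smul_smul]
  have := hr m
  rw [hm] at this
  by_contra hc
  exact hx ((N.smul_mem_iff (pow_ne_zero m hc)).1 (by simpa using this))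

lemma IsNilpotent.eq_zero_of_apply_eq_smul {k V : Type*} [Field k] [AddCommGroup V] [Module k V]
    {T : V →ₗ[k] V} (hT : IsNilpotent T) {x : V} {c : k} (hx : x ≠ 0) (h : T x = c • x) : c = 0 :=
  hT.eq_zero_of_sub_smul_mem (N := ⊥) bot_le (by simpa using hx) (by simp [h])

/-- A nilpotent operator on a plane with cyclic vector `x` has square zero there. -/
lemma IsNilpotent.apply_eq_zero_of_cyclic {k V : Type*} [Field k] [AddCommGroup V] [Module k V]
    {T : V →ₗ[k] V} (hT : IsNilpotent T) {x y : V} {α β : k} (hxy : LinearIndependent k ![x, y])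
    (h₁ : T x = y) (h₂ : T y = α • x + β • y) : α = 0 ∧ β = 0 := by
  have hα : α = 0 := by
    by_contra hα
    -- If `α` is invertible, x is recovered from the images of x and y, so the plane lies in its own
    -- image under T.
    have := hT.eq_bot_of_le_map (W := Submodule.span k {x, y}) (by
      rw [Submodule.span_le]
      rintro z (rfl | rfl)
      · refine ⟨α⁻¹ • (y - β • z), Submodule.smul_mem _ _ (Submodule.sub_mem _
          (Submodule.subset_span (by simp))
          (Submodule.smul_mem _ _ (Submodule.subset_span (by simp)))), ?_⟩
        simp [h₁, h₂, smul_smul, hα]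
      · exact ⟨x, Submodule.subset_span (by simp), h₁⟩)
    have hx : x ∈ Submodule.span k {x, y} := Submodule.subset_span (by simp)
    rw [this, Submodule.mem_bot] at hx
    exact hxy.ne_zero 0 hx
  refine ⟨hα, hT.eq_zero_of_apply_eq_smul (hxy.ne_zero 1) (c := β) ?_⟩
  simpa [hα] using h₂

/-! ### Generic points of curves, and bounded rank of left multiplications -/

namespace AlgStr

variable {k : Type*} [Field k] {n m : ℕ}

/-- Curves with polynomial coordinates. -/
def IsPolyCurve (f : k → Fin n → k) : Prop :=
  ∃ p : Fin n → Polynomial k, ∀ t i, f t i = (p i).eval t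

namespace IsPolyCurve

variable {f g : k → Fin n → k}

lemma const (x : Fin n → k) : IsPolyCurve (fun _ => x) :=
  ⟨fun i => Polynomial.C (x i), fun t i => by simp⟩

lemma line (x y : Fin n → k) : IsPolyCurve (fun t => x + t • y) :=
  ⟨fun i => Polynomial.C (x i) + Polynomial.C (y i) * Polynomial.X,
    fun t i => by simp [mul_comm t]⟩

lemma apply (μ : AlgStr k n) (hf : IsPolyCurve f) (hg : IsPolyCurve g) :
    IsPolyCurve (fun t => μ (f t) (g t)) := by
  obtain ⟨p, hp⟩ := hf
  obtain ⟨q, hq⟩ := hg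
  refine ⟨fun l => ∑ i, ∑ j, p i * q j * Polynomial.C (μ.coords (i, j, l)), fun t l => ?_⟩
  refine (apply_eq_sum_coords μ _ _ l).trans ?_
  simp [Polynomial.eval_finsetSum, hp, hq]

lemma apply_left (μ : AlgStr k n) (hf : IsPolyCurve f) (y : Fin n → k) :
    IsPolyCurve (fun t => μ (f t) y) :=
  hf.apply μ (const y)

end IsPolyCurve

/-- Composition with a left inverse at t₀ turns independence into the non-vanishing of a
determinant. That determinant is a polynomial in t with value 1 at t₀, so it has finitely many
roots. -/
lemma finite_not_linearIndependent {ι : Type*} [Finite ι] {f : ι → k → Fin n → k}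
    (hf : ∀ i, IsPolyCurve (f i)) (t₀ : k) (h : LinearIndependent k fun i => f i t₀) :
    {t | ¬LinearIndependent k fun i => f i t}.Finite := by
  classical
  have := Fintype.ofFinite ι
  choose p hp using hf
  obtain ⟨φ, hφ⟩ := LinearMap.exists_leftInverse_of_injective
    (Fintype.linearCombination k fun i => f i t₀)
    (LinearMap.ker_eq_bot.2 h.fintypeLinearCombination_injective)
  let M : Matrix ι ι (Polynomial k) := Matrix.of fun i j =>
    ∑ l, p i l * Polynomial.C (φ (Pi.single l 1) j)
  have hM : ∀ t, (Polynomial.evalRingHom t).mapMatrix M = Matrix.of fun i j => φ (f i t) j := by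
    intro t
    ext i j
    have : f i t = ∑ l, f i t l • (Pi.single l 1 : Fin n → k) := by
      ext l
      simp [Pi.single_apply]
    simp only [RingHom.mapMatrix_apply, Matrix.map_apply, Matrix.of_apply, M]
    conv_rhs => rw [this]
    simp [hp]
  have hdet : ∀ t, M.det.eval t = (Matrix.of fun i j => φ (f i t) j).det := by
    intro t
    rw [← hM, ← RingHom.map_det]
    rfl
  have hne : M.det ≠ 0 := by
    intro h0
    have h1 := hdet t₀
    have h2 : (Matrix.of fun i j => φ (f i t₀) j) = (1 : Matrix ι ι k) := by
      ext i j
      have := LinearMap.congr_fun hφ (Pi.single i 1)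
      simp only [LinearMap.comp_apply, Fintype.linearCombination_apply_single, one_smul,
        LinearMap.id_apply] at this
      rw [Matrix.of_apply, this, Matrix.one_apply, Pi.single_apply]
      simp [eq_comm]
    rw [h2, h0] at h1
    simp at h1
  refine (M.det.roots.toFinset.finite_toSet).subset fun t ht => ?_
  simp only [Finset.mem_coe, Multiset.mem_toFinset, Polynomial.mem_roots hne, Polynomial.IsRoot.def]
  by_contra h0
  rw [hdet] at h0
  exact ht (LinearIndependent.of_comp φ (Matrix.linearIndependent_rows_of_det_ne_zero h0))

lemma eventually_linearIndependent {ι : Type*} [Finite ι] {f : ι → k → Fin n → k}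
    (hf : ∀ i, IsPolyCurve (f i)) (t₀ : k) (h : LinearIndependent k fun i => f i t₀) :
    ∀ᶠ t in Filter.cofinite, LinearIndependent k fun i => f i t :=
  finite_not_linearIndependent hf t₀ h

/-- All left multiplications have rank at most `r`. -/
def MulRankLE (r : ℕ) (μ : AlgStr k n) : Prop :=
  ∀ x (y : Fin (r + 1) → Fin n → k), ¬LinearIndependent k fun j => μ x (y j)

variable {μ : AlgStr k n} {r : ℕ}

lemma MulRankLE.apply_mem_span (h : MulRankLE r μ) {a : Fin n → k} {y : Fin r → Fin n → k}
    (hy : LinearIndependent k fun j => μ a (y j)) (z : Fin n → k) :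
    μ a z ∈ Submodule.span k (Set.range fun j => μ a (y j)) := by
  by_contra hz
  refine h a (Fin.snoc y z) ?_
  have := hy.finSnoc hz
  convert! this using 1
  ext j : 1
  refine Fin.lastCases ?_ (fun j => ?_) j <;> simp

/-- First-order variation of a map of maximal rank: (a + tx)u = t · xu, so if xu were outside the
image of left multiplication by a, then a + tx would have rank `r + 1` for generic t ≠ 0. -/
lemma MulRankLE.apply_ker_mem_span [Infinite k] (h : MulRankLE r μ) {a : Fin n → k}
    {y : Fin r → Fin n → k} (hy : LinearIndependent k fun j => μ a (y j)) {u : Fin n → k}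
    (hu : μ a u = 0) (x : Fin n → k) :
    μ x u ∈ Submodule.span k (Set.range fun j => μ a (y j)) := by
  by_contra hz
  have h1 : LinearIndependent k fun j : Fin (r + 1) =>
      (Fin.snoc (fun j t => μ (a + t • x) (y j)) (fun _ => μ x u) :
        Fin (r + 1) → k → Fin n → k) j 0 := by
    convert! hy.finSnoc hz using 1
    ext j : 1
    refine Fin.lastCases ?_ (fun j => ?_) j <;> simp
  have h2 := eventually_linearIndependent (fun j => by
    refine Fin.lastCases ?_ (fun j => ?_) j
    · simpa using IsPolyCurve.const _
    · simpa using (IsPolyCurve.line a x).apply_left μ (y j)) 0 h1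
  obtain ⟨t, ht, ht0⟩ := (h2.and (Filter.eventually_cofinite_ne 0)).exists
  refine h (a + t • x) (Fin.snoc y u) ?_
  have h3 := ht.units_smul (Fin.snoc (fun _ => 1) (Units.mk0 t ht0) : Fin (r + 1) → kˣ)
  convert! h3 using 1
  ext j : 1
  refine Fin.lastCases ?_ (fun j => ?_) j
  · simp [hu]
  · simp

end AlgStr

/-! ### Criteria for degenerating to a structure of level four -/

namespace AlgStr

variable {k : Type*} [Field k] {n m : ℕ}

/-- `μ` degenerates to one of the structures of level four. -/
def DegeneratesToLevelFour (μ : AlgStr k n) : Prop :=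
  ∃ χ : AlgStr k n, χ.IsLevel 4 ∧ μ.Degenerates χ

variable [Infinite k] {μ : AlgStr k n}

lemma degeneratesToLevelFour_of_weights (hμ : ∀ x, μ x x = 0)
    {T : Finset (Fin m × Fin m × Fin m)}
    (hT₄ : ∀ {χ : AlgStr k n} {pos : Fin m → Fin n}, IsTable χ pos T → χ.IsLevel 4)
    (hT₀ : ∀ i j l, (i, j, l) ∈ T → (j, i, l) ∉ T) {v : Fin m → Fin n → k}
    (hv : LinearIndependent k v) (w : Fin m → ℕ) (W : ℕ) (hW : 1 ≤ W)
    (hw : ∀ p, 1 ≤ w p ∧ w p ≤ W) (hT : ∀ i j l, (i, j, l) ∈ T → w l = w i + w j)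
    (h : ∀ i j, i < j → w i + w j ≤ W → μ (v i) (v j) - ∑ l, tableCoeff k T i j l • v l ∈
      Submodule.span k (v '' {r | w r < w i + w j})) : DegeneratesToLevelFour μ := by
  obtain ⟨χ, pos, hχ⟩ := exists_isTable (n := n) k (by simpa using hv.fintype_card_le_finrank) hT₀
  exact ⟨χ, hT₄ hχ, degenerates_of_weights hμ hχ hv w W hW hw hT h⟩

/-- With these weights the sum for two vectors other than a always exceeds the cutoff, so no
condition on their products is needed. The same principle governs the criteria for T⁴ and T²²²². -/
lemma degeneratesToLevelFour_T32 (hμ : ∀ x, μ x x = 0) {a b u u' b' u'' : Fin n → k}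
    (hv : LinearIndependent k ![a, b, u, u', b', u'']) (h₁ : μ a b = b') (h₂ : μ a u = u')
    (h₃ : μ a u' = u'') : DegeneratesToLevelFour μ := by
  refine degeneratesToLevelFour_of_weights (T := tabT32) hμ
    (fun h => .inr (.inr (.inr (.inr (.inr (.inl h.hasTable)))))) (by decide) hv
    ![1, 3, 2, 3, 4, 4] 4 (by decide) (by decide) (by decide) fun i j hij hle => ?_
  fin_cases i <;> fin_cases j <;> first
    | (exfalso; revert hij hle; decide)
    | simp [h₁, h₂, h₃, tableCoeff, tabT32]

lemma degeneratesToLevelFour_T4 (hμ : ∀ x, μ x x = 0) (hn : n = 5) {a u u' u'' u''' : Fin n → k}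
    (hv : LinearIndependent k ![a, u, u', u'', u''']) (h₁ : μ a u = u') (h₂ : μ a u' = u'')
    (h₃ : μ a u'' = u''') : DegeneratesToLevelFour μ := by
  refine degeneratesToLevelFour_of_weights (T := tabT4) hμ
    (fun h => .inr (.inr (.inr (.inr (.inr (.inr (.inr ⟨hn, h.hasTable⟩))))))) (by decide) hv
    ![1, 3, 4, 5, 6] 6 (by decide) (by decide) (by decide) fun i j hij hle => ?_
  fin_cases i <;> fin_cases j <;> first
    | (exfalso; revert hij hle; decide)
    | simp [h₁, h₂, h₃, tableCoeff, tabT4]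

lemma degeneratesToLevelFour_T2222 (hμ : ∀ x, μ x x = 0) {a b₁ b₂ b₃ b₄ : Fin n → k}
    (hv : LinearIndependent k ![a, b₁, b₂, b₃, b₄, μ a b₁, μ a b₂, μ a b₃, μ a b₄]) :
    DegeneratesToLevelFour μ := by
  refine degeneratesToLevelFour_of_weights (T := tabT2222) hμ
    (fun h => .inr (.inr (.inr (.inr (.inr (.inr (.inl h.hasTable))))))) (by decide) hv
    ![1, 2, 2, 2, 2, 3, 3, 3, 3] 3 (by decide) (by decide) (by decide) fun i j hij hle => ?_
  fin_cases i <;> fin_cases j <;> first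
    | (exfalso; revert hij hle; decide)
    | simp [tableCoeff, tabT2222]

lemma degeneratesToLevelFour_T3eps23 (hμ : ∀ x, μ x x = 0) {a b c : Fin n → k}
    (hv : LinearIndependent k ![a, b, c, μ b c, μ a c]) (h : μ a b = c) :
    DegeneratesToLevelFour μ := by
  refine degeneratesToLevelFour_of_weights (T := tabT3eps23) hμ
    (fun h => .inr (.inr (.inl h.hasTable))) (by decide) hv
    ![1, 1, 2, 3, 3] 3 (by decide) (by decide) (by decide) fun i j hij hle => ?_
  fin_cases i <;> fin_cases j <;> first
    | (exfalso; revert hij hle; decide)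
    | simp [h, tableCoeff, tabT3eps23]

/-- The multiples of c in ad and bd have weight 2, below the weight 3 of these products, and
disappear in the limit. The remaining vanishing products serve to prove linear independence. -/
lemma degeneratesToLevelFour_T3eps24 (hμ : ∀ x, μ x x = 0) {a b c d z : Fin n → k} {x y : k}
    (hz : z ≠ 0) (hab : μ a b = c) (hac : μ a c = z) (hbc : μ b c = 0) (had : μ a d = x • c)
    (hbd : μ b d = z + y • c) (hcd : μ c d = 0) (haz : μ a z = 0) (hbz : μ b z = 0)
    (hcz : μ c z = 0) : DegeneratesToLevelFour μ := by
  have hv : LinearIndependent k ![a, b, c, d, z] := by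
    refine Fintype.linearIndependent_iff.2 fun g hg => ?_
    simp [Fin.sum_univ_succ] at hg
    have h₀ : g 0 = 0 := by
      have := congrArg (μ c) hg
      simpa [swap_eq_neg hμ a c, swap_eq_neg hμ b c, hμ, hac, hbc, hcd, hcz, hz] using this
    have h₃ : g 3 = 0 := by
      have h := congrArg (μ b) hg
      simp [h₀, hμ, hbc, hbd, hbz] at h
      have h' := congrArg (μ a) h
      simp only [map_add, map_smul, hac, haz, smul_zero, zero_add, map_zero, smul_eq_zero, hz,
        or_false] at h'
      rcases h' with h' | h'
      · exact h'
      · simpa [h', hz] using h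
    have h₁ : g 1 = 0 := by
      have h := congrArg (μ a) (congrArg (μ a) hg)
      simpa [h₀, h₃, hμ, hab, hac, haz, hz] using h
    have h₂ : g 2 = 0 := by
      have h := congrArg (μ a) hg
      simpa [h₀, h₁, h₃, hac, haz, hz] using h
    have h₄ : g 4 = 0 := by simpa [h₀, h₁, h₂, h₃, hz] using hg
    intro i
    fin_cases i <;> assumption
  refine degeneratesToLevelFour_of_weights (T := tabT3eps24) hμ
    (fun h => .inr (.inr (.inr (.inl h.hasTable)))) (by decide) hv
    ![1, 1, 2, 2, 3] 3 (by decide) (by decide) (by decide) fun i j hij hle => ?_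
  have hc : ∀ x : k, x • c ∈ Submodule.span k
      (![a, b, c, d, z] '' {r | ![1, 1, 2, 2, 3] r < 3}) := fun x =>
    Submodule.smul_mem _ _ (Submodule.subset_span ⟨2, by simp, rfl⟩)
  fin_cases i <;> fin_cases j <;> first
    | (exfalso; revert hij hle; decide)
    | simp [hab, hac, hbc, had, hbd, tableCoeff, tabT3eps24]
  all_goals apply hc

lemma degeneratesToLevelFour_Eta4 (hμ : ∀ x, μ x x = 0) {v : Fin 9 → Fin n → k}
    (hv : LinearIndependent k v)
    (h : ∀ i j, i < j → j < 8 → μ (v i) (v j) = ∑ l, tableCoeff k tabEta4 i j l • v l) :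
    DegeneratesToLevelFour μ := by
  refine degeneratesToLevelFour_of_weights (T := tabEta4) hμ
    (fun h => .inl h.hasTable) (by decide) hv
    ![1, 1, 1, 1, 1, 1, 1, 1, 2] 2 (by decide) (by decide) (by decide) fun i j hij hle => ?_
  have : j < 8 := by revert hij hle; revert i j; decide
  rw [h i j hij this, sub_self]
  exact Submodule.zero_mem _

end AlgStr

section Independent

variable {k V : Type*} [Field k] [AddCommGroup V] [Module k V]

lemma range_vec_two {α : Type*} (x y : α) : Set.range ![x, y] = {x, y} := by
  ext z
  simp [eq_comm]
  tauto

lemma range_vec_three {α : Type*} (x y z : α) : Set.range ![x, y, z] = {x, y, z} := by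
  ext w
  simp [eq_comm]
  tauto

lemma LinearIndependent.triple_of_notMem {x y z : V} (h : LinearIndependent k ![x, y])
    (hz : z ∉ Submodule.span k {x, y}) : LinearIndependent k ![x, y, z] := by
  have := h.finSnoc (x := z) (by rwa [range_vec_two])
  convert! this using 1
  ext i : 1
  fin_cases i <;> rfl

lemma LinearIndependent.quadruple_of_notMem {x y z w : V} (h : LinearIndependent k ![x, y, z])
    (hw : w ∉ Submodule.span k {x, y, z}) : LinearIndependent k ![x, y, z, w] := by
  have := h.finSnoc (x := w) (by rwa [range_vec_three])
  convert! this using 1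
  ext i : 1
  fin_cases i <;> rfl

lemma linearIndependent_triple_iff {x y z : V} : LinearIndependent k ![x, y, z] ↔
    ∀ a b c : k, a • x + b • y + c • z = 0 → a = 0 ∧ b = 0 ∧ c = 0 := by
  rw [Fintype.linearIndependent_iff]
  constructor
  · intro h a b c he
    have := h ![a, b, c] (by simpa [Fin.sum_univ_succ, add_assoc] using he)
    exact ⟨this 0, this 1, this 2⟩
  · intro h g hg
    obtain ⟨h₀, h₁, h₂⟩ := h (g 0) (g 1) (g 2)
      (by simpa [Fin.sum_univ_succ, add_assoc] using hg)
    intro i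
    fin_cases i <;> assumption

lemma linearIndependent_quadruple_iff {x y z w : V} : LinearIndependent k ![x, y, z, w] ↔
    ∀ a b c d : k, a • x + b • y + c • z + d • w = 0 → a = 0 ∧ b = 0 ∧ c = 0 ∧ d = 0 := by
  rw [Fintype.linearIndependent_iff]
  constructor
  · intro h a b c d he
    have := h ![a, b, c, d] (by simpa [Fin.sum_univ_succ, add_assoc] using he)
    exact ⟨this 0, this 1, this 2, this 3⟩
  · intro h g hg
    obtain ⟨h₀, h₁, h₂, h₃⟩ := h (g 0) (g 1) (g 2) (g 3)
      (by simpa [Fin.sum_univ_succ, add_assoc] using hg)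
    intro i
    fin_cases i <;> assumption

end Independent

/-! ### Squares of left multiplications vanish: reduction to two-step nilpotency -/

namespace AlgStr

variable {k : Type*} [Field k] {n m : ℕ} {μ : AlgStr k n}

/-- Anticommutativity turns ay = ca into ya = -ca, an eigenvalue of the nilpotent left
multiplication by y. -/
lemma smul_eq_zero_of_apply_eq_smul (hμ : ∀ x, μ x x = 0) (hnil : ∀ x, IsNilpotent (μ x))
    {a y : Fin n → k} {c : k} (h : μ a y = c • a) : c • a = 0 := by
  by_cases ha : a = 0
  · simp [ha]
  · have := (hnil y).eq_zero_of_apply_eq_smul ha (c := -c) (by rw [swap_eq_neg hμ a y, h]; simp)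
    simp [neg_eq_zero.1 this]

/-- `a` is independent of the image of its left multiplication. -/
lemma eq_zero_of_smul_add_apply (hμ : ∀ x, μ x x = 0) (hnil : ∀ x, IsNilpotent (μ x))
    {a y : Fin n → k} (ha : a ≠ 0) {c : k} (h : c • a + μ a y = 0) : c = 0 := by
  have := smul_eq_zero_of_apply_eq_smul hμ hnil (a := a) (y := y) (c := -c)
    (by rw [neg_smul]; exact eq_neg_of_add_eq_zero_right h)
  simpa [ha] using this

section Square

variable (hμ : ∀ x, μ x x = 0) (hnil : ∀ x, IsNilpotent (μ x))

include hμ hnil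

lemma degeneratesToLevelFour_of_rank_four [Infinite k] (hsq : ∀ x y, μ x (μ x y) = 0)
    {a : Fin n → k}
    {y : Fin 4 → Fin n → k} (hy : LinearIndependent k fun j => μ a (y j)) :
    DegeneratesToLevelFour μ := by
  have ha : a ≠ 0 := by
    rintro rfl
    exact hy.ne_zero 0 (by simp)
  refine degeneratesToLevelFour_T2222 hμ (a := a) (b₁ := y 0) (b₂ := y 1) (b₃ := y 2) (b₄ := y 3)
    (Fintype.linearIndependent_iff.2 fun g hg => ?_)
  simp [Fin.sum_univ_succ] at hg
  rw [Fintype.linearIndependent_iff] at hy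
  have h₁ := hy ![g 1, g 2, g 3, g 4] (by
    have := congrArg (μ a) hg
    simpa [hμ, hsq, Fin.sum_univ_succ] using this)
  have e₁ : g 1 = 0 := h₁ 0
  have e₂ : g 2 = 0 := h₁ 1
  have e₃ : g 3 = 0 := h₁ 2
  have e₄ : g 4 = 0 := h₁ 3
  simp only [e₁, e₂, e₃, e₄, zero_smul, zero_add] at hg
  have e₀ : g 0 = 0 := eq_zero_of_smul_add_apply hμ hnil ha
    (y := g 5 • y 0 + g 6 • y 1 + g 7 • y 2 + g 8 • y 3) (by simpa [add_assoc] using hg)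
  have h₂ := hy ![g 5, g 6, g 7, g 8] (by simpa [e₀, Fin.sum_univ_succ] using hg)
  intro i
  fin_cases i
  exacts [e₀, e₁, e₂, e₃, e₄, h₂ 0, h₂ 1, h₂ 2, h₂ 3]

omit hnil in
-- Polarizing x(xy) = 0 shows that a(bc) is alternating in its three arguments. The products of a,
-- b, c then form a configuration that degenerates to the table `tabT222eps23`.
lemma degeneratesToLevelFour_of_apply_apply_ne_zero [Infinite k]
    (hsq : ∀ x y, μ x (μ x y) = 0) {a b c : Fin n → k}
    (h : μ a (μ b c) ≠ 0) : DegeneratesToLevelFour μ := by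
  have hs : ∀ x y z, μ y (μ x z) = -μ x (μ y z) := by
    intro x y z
    have := hsq (x + y) z
    simp only [map_add, LinearMap.add_apply, hsq, zero_add, add_zero] at this
    exact eq_neg_of_add_eq_zero_left this
  have hsw := swap_eq_neg hμ
  have e₁ : μ b (μ a c) = -μ a (μ b c) := hs a b c
  have e₂ : μ c (μ a b) = μ a (μ b c) := by
    rw [hs a c b, hsw b c]
    simp
  have e₃ : μ a (μ a (μ b c)) = 0 := hsq _ _
  have e₄ : μ b (μ a (μ b c)) = 0 := by rw [hs a b, hsq, map_zero, neg_zero]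
  have e₅ : μ c (μ a (μ b c)) = 0 := by
    rw [hs a c, hsw c b, map_neg, hsq]; simp
  have e₆ : μ c (μ b c) = 0 := by rw [hsw c b, map_neg, hsq, neg_zero]
  have e₇ : μ c (μ a c) = 0 := by rw [hsw c a, map_neg, hsq, neg_zero]
  have e₈ : μ b (μ a b) = 0 := by rw [hsw b a, map_neg, hsq, neg_zero]
  -- The fourth vector e = bc - a(bc) satisfies ae = a(bc), and bc = a(bc) + e. Since e has weight
  -- 3, below the weight 4 of bc, both products have the same leading term, as the table demands.
  have hv : LinearIndependent k
      ![a, b, c, μ b c - μ a (μ b c), μ a b, μ a c, μ a (μ b c)] := by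
    refine Fintype.linearIndependent_iff.2 fun g hg => ?_
    simp [Fin.sum_univ_succ] at hg
    have h₂ : g 2 = 0 := by
      have := congrArg (μ a) (congrArg (μ b) hg)
      simpa [hμ, hsq, e₁, e₄, e₈, h, hsw a b] using this
    have h₀ : g 0 = 0 := by
      have := congrArg (μ b) (congrArg (μ c) hg)
      simpa [hμ, hsq, e₁, e₂, e₃, e₄, e₅, e₆, e₇, e₈, h, hsw a c, hsw b c] using this
    have h₁ : g 1 = 0 := by
      have := congrArg (μ a) (congrArg (μ c) hg)
      simpa [hμ, hsq, e₁, e₂, e₃, e₄, e₅, e₆, e₇, e₈, h, hsw a c, hsw b c] using this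
    have h₃ : g 3 = 0 := by
      have := congrArg (μ a) hg
      simpa [h₀, h₁, h₂, hμ, hsq, h] using this
    have h₄ : g 4 = 0 := by
      have := congrArg (μ c) hg
      simpa [h₀, h₁, h₂, h₃, e₂, e₅, e₇, h] using this
    have h₅ : g 5 = 0 := by
      have := congrArg (μ b) hg
      simpa [h₀, h₁, h₂, h₃, h₄, e₁, e₄, h] using this
    have h₆ : g 6 = 0 := by simpa [h₀, h₁, h₂, h₃, h₄, h₅, h] using hg
    intro i
    fin_cases i <;> assumption
  refine degeneratesToLevelFour_of_weights (T := tabT222eps23) hμ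
    (fun h => .inr (.inr (.inr (.inr (.inl h.hasTable))))) (by decide) hv
    ![1, 2, 2, 3, 3, 3, 4] 4 (by decide) (by decide) (by decide) fun i j hij hle => ?_
  fin_cases i <;> fin_cases j <;> first
    | (exfalso; revert hij hle; decide)
    | simp [hsq, tableCoeff, tabT222eps23]
  exact Submodule.subset_span ⟨3, by simp, rfl⟩

end Square

section TwoStep

variable (hμ : ∀ x, μ x x = 0) (h₂ : ∀ x y z, μ x (μ y z) = 0)

include hμ h₂

omit hμ in
lemma isNilpotent_of_twoStep (x : Fin n → k) : IsNilpotent (μ x) :=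
  ⟨2, LinearMap.ext fun y => by simp [pow_two, h₂]⟩

/-- Two orthogonal hyperbolic pairs with independent values pq and rs are, after a change of basis,
the table `tabT22eps34`. The product qs, the only one not assumed zero, can be removed because it
lies in the span of pq and rs. -/
lemma degeneratesToLevelFour_T22eps34 [Infinite k] {p q r s : Fin n → k}
    (hI : ∀ x y, μ x y ∈ Submodule.span k {μ p q, μ r s})
    (hf : LinearIndependent k ![μ p q, μ r s])
    (hpr : μ p r = 0) (hps : μ p s = 0) (hqr : μ q r = 0) : DegeneratesToLevelFour μ := by
  have hsw := swap_eq_neg hμ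
  wlog hqs : μ q s = 0 generalizing q s with H
  · obtain ⟨x, y, hxy⟩ := Submodule.mem_span_pair.1 (hI q s)
    have h₁ : μ p (q - y • r) = μ p q := by simp [hpr]
    have h₃ : μ r (s + x • p) = μ r s := by simp [hsw p r, hpr]
    refine H (q := q - y • r) (s := s + x • p) ?_ ?_ ?_ ?_ ?_
    · rwa [h₁, h₃]
    · rwa [h₁, h₃]
    · simp [hps, hμ]
    · simp [hqr, hμ]
    · simp [hsw p q, hsw p r, hpr, ← hxy]
  · have h0 : ∀ {α β : k}, α • μ p q + β • μ r s = 0 → α = 0 ∧ β = 0 :=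
      LinearIndependent.pair_iff.1 hf _ _
    -- The vector p - s plays the role of e₁: it sends q to pq and r to rs.
    have hv : LinearIndependent k ![p - s, q, r, s, μ p q, μ r s] := by
      refine Fintype.linearIndependent_iff.2 fun g hg => ?_
      simp [Fin.sum_univ_succ] at hg
      have e₁ : g 1 = 0 := by
        have := congrArg (μ p) hg
        exact (h0 (α := g 1) (β := 0) (by simpa [hμ, h₂, hpr, hps] using this)).1
      have e₀ : g 0 = 0 := by
        have := congrArg (μ q) hg
        have := (h0 (α := -g 0) (β := 0)
          (by simpa [hμ, h₂, hpr, hps, hqr, hqs, hsw p q] using this)).1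
        simpa using this
      have e₂ : g 2 = 0 := by
        have := congrArg (μ s) hg
        have := (h0 (α := 0) (β := -g 2)
          (by simpa [e₀, e₁, hμ, h₂, hpr, hps, hqr, hqs, hsw r s] using this)).2
        simpa using this
      have e₃ : g 3 = 0 := by
        have := congrArg (μ r) hg
        exact (h0 (α := 0) (β := g 3) (by simpa [e₀, e₁, e₂, hμ, h₂] using this)).2
      have := h0 (α := g 4) (β := g 5) (by simpa [e₀, e₁, e₂, e₃] using hg)
      intro i
      fin_cases i
      exacts [e₀, e₁, e₂, e₃, this.1, this.2]
    refine degeneratesToLevelFour_of_weights (T := tabT22eps34) hμ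
      (fun h => .inr (.inl h.hasTable)) (by decide) hv
      ![1, 1, 1, 1, 2, 2] 2 (by decide) (by decide) (by decide) fun i j hij hle => ?_
    fin_cases i <;> fin_cases j <;> first
      | (exfalso; revert hij hle; decide)
      | simp [hμ, hpr, hps, hqr, hqs, hsw q s, hsw r s, tableCoeff, tabT22eps34]

end TwoStep

end AlgStr

/-! ### Two-step structures whose left multiplications have rank at least three -/

namespace AlgStr

variable {k : Type*} [Field k] {n m : ℕ} {μ : AlgStr k n}

lemma hasTable_of_ker (hμ : ∀ x, μ x x = 0) {T : Finset (Fin m × Fin m × Fin m)}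
    (hT₀ : ∀ i j l, (i, j, l) ∈ T → (j, i, l) ∉ T) {v : Fin m → Fin n → k}
    (hv : LinearIndependent k v)
    (hker : ∀ x, ∃ c : Fin m → k, ∀ y, μ (x - ∑ i, c i • v i) y = 0)
    (h : ∀ i j, i < j → μ (v i) (v j) = ∑ l, tableCoeff k T i j l • v l) : HasTable T μ := by
  obtain ⟨χ, pos, hχ⟩ := exists_isTable (n := n) k (by simpa using hv.fintype_card_le_finrank) hT₀
  refine ⟨χ, pos, hχ, mem_orbit_of_table hμ hχ hv (LinearMap.ker μ) ?_ (fun u hu x => ?_) h⟩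
  · rw [eq_top_iff]
    intro x _
    obtain ⟨c, hc⟩ := hker x
    rw [← add_sub_cancel (∑ i, c i • v i) x]
    exact Submodule.add_mem_sup
      (Submodule.sum_mem _ fun i _ => Submodule.smul_mem _ _ (Submodule.subset_span ⟨i, rfl⟩))
      (LinearMap.mem_ker.2 (LinearMap.ext fun y => by simpa using hc y))
  · rw [LinearMap.mem_ker.1 hu, LinearMap.zero_apply]

/-- A structure is determined by the products of the vectors `v` if the vectors that annihilate
them form a complement with zero multiplication. -/
lemma hasTable_of_core (hμ : ∀ x, μ x x = 0) {T : Finset (Fin m × Fin m × Fin m)}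
    (hT₀ : ∀ i j l, (i, j, l) ∈ T → (j, i, l) ∉ T) {v : Fin m → Fin n → k}
    (hv : LinearIndependent k v)
    (hdec : ∀ x, ∃ c : Fin m → k, ∀ j, μ (v j) (x - ∑ i, c i • v i) = 0)
    (hann : ∀ x y, (∀ i, μ (v i) x = 0) → (∀ i, μ (v i) y = 0) → μ x y = 0)
    (h : ∀ i j, i < j → μ (v i) (v j) = ∑ l, tableCoeff k T i j l • v l) : HasTable T μ := by
  refine hasTable_of_ker hμ hT₀ hv (fun x => ?_) h
  obtain ⟨c, hc⟩ := hdec x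
  refine ⟨c, fun y => ?_⟩
  obtain ⟨d, hd⟩ := hdec y
  have h0 := hann _ _ hc hd
  rw [map_sub, sub_eq_zero] at h0
  rw [h0, map_sum]
  refine Finset.sum_eq_zero fun i _ => ?_
  rw [map_smul, swap_eq_neg hμ (v i), hc, neg_zero, smul_zero]

section TwoStep

variable (hμ : ∀ x, μ x x = 0) (h₂ : ∀ x y z, μ x (μ y z) = 0)

include hμ h₂

/-- If bc lies in the span of ab, ac, ad, then bc = ae for some e, and e replaces d. Otherwise bc -
ad is an additional independent vector; it gets weight 3 as an auxiliary vector, so that bc and ad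
agree up to lower weight. -/
lemma degeneratesToLevelFour_T222eps23 [Infinite k] {a b c d : Fin n → k}
    (hf : LinearIndependent k ![μ a b, μ a c, μ a d])
    (hbc : μ b c ∉ Submodule.span k {μ a b, μ a c}) : DegeneratesToLevelFour μ := by
  have hsw := swap_eq_neg hμ
  have hnil := isNilpotent_of_twoStep h₂
  have ha : a ≠ 0 := by
    rintro rfl
    exact hf.ne_zero 0 (by simp)
  have hf₂ : LinearIndependent k ![μ a b, μ a c] := by
    refine LinearIndependent.pair_iff.2 fun s t hst => ?_
    obtain ⟨e₁, e₂, -⟩ := linearIndependent_triple_iff.1 hf s t 0 (by simpa using hst)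
    exact ⟨e₁, e₂⟩
  have hf₃ := hf₂.triple_of_notMem hbc
  by_cases hI : μ b c ∈ Submodule.span k {μ a b, μ a c, μ a d}
  · obtain ⟨x, y, z, hxyz⟩ := Submodule.mem_span_triple.1 hI
    obtain ⟨e, he⟩ : ∃ e, μ a e = μ b c := ⟨x • b + y • c + z • d, by simpa using hxyz⟩
    rw [linearIndependent_triple_iff] at hf₃
    have hv : LinearIndependent k ![a, b, c, e, μ a b, μ a c, μ b c] := by
      refine Fintype.linearIndependent_iff.2 fun g hg => ?_
      simp [Fin.sum_univ_succ] at hg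
      obtain ⟨e₁, e₂, e₃⟩ := hf₃ (g 1) (g 2) (g 3) (by
        have := congrArg (μ a) hg
        simpa [hμ, h₂, he, add_assoc] using this)
      simp only [e₁, e₂, e₃, zero_smul, zero_add] at hg
      have e₀ : g 0 = 0 := eq_zero_of_smul_add_apply hμ hnil ha
        (y := g 4 • b + g 5 • c + g 6 • e) (by simpa [he, add_assoc] using hg)
      obtain ⟨e₄, e₅, e₆⟩ := hf₃ (g 4) (g 5) (g 6) (by simpa [e₀, add_assoc] using hg)
      intro i
      fin_cases i <;> assumption
    refine degeneratesToLevelFour_of_weights (T := tabT222eps23) hμ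
      (fun h => .inr (.inr (.inr (.inr (.inl h.hasTable))))) (by decide) hv
      ![1, 2, 2, 3, 3, 3, 4] 4 (by decide) (by decide) (by decide) fun i j hij hle => ?_
    fin_cases i <;> fin_cases j <;> first
      | (exfalso; revert hij hle; decide)
      | simp [h₂, he, tableCoeff, tabT222eps23]
  · have hf₄ := linearIndependent_quadruple_iff.1 (hf.quadruple_of_notMem hI)
    rw [linearIndependent_triple_iff] at hf
    have hv : LinearIndependent k (Sum.elim ![a, b, c, d, μ a b, μ a c, μ a d]
        (fun _ : Unit => μ b c - μ a d)) := by
      refine Fintype.linearIndependent_iff.2 fun g hg => ?_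
      simp [Fin.sum_univ_succ] at hg
      obtain ⟨e₁, e₂, e₃⟩ := hf (g (.inl 1)) (g (.inl 2)) (g (.inl 3)) (by
        have := congrArg (μ a) hg
        simpa [hμ, h₂, add_assoc] using this)
      simp only [e₁, e₂, e₃, zero_smul, zero_add] at hg
      have e₀ : g (.inl 0) = 0 := by
        by_contra hne
        have hb := congrArg (μ b) hg
        have hc := congrArg (μ c) hg
        simp [h₂, hsw a b, hne] at hb
        simpa using (hf 1 0 0 (by simp [hb])).1
      obtain ⟨e₄, e₅, e₆, e₇⟩ := hf₄ (g (.inl 4)) (g (.inl 5)) (g (.inl 6) - g (.inr ()))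
        (g (.inr ())) (by
          rw [← hg, e₀]
          module)
      rw [e₇, sub_zero] at e₆
      rintro (i | i)
      · fin_cases i <;> assumption
      · exact e₇
    obtain ⟨χ, pos, hχ⟩ := exists_isTable (n := n) (m := 7) (T := tabT222eps23) k (by
        have h := hv.comp Sum.inl Sum.inl_injective
        simpa using h.fintype_card_le_finrank) (by decide)
    refine ⟨χ, .inr (.inr (.inr (.inr (.inl hχ.hasTable)))), degenerates_of_weights' hμ hχ hv
      (Sum.elim ![1, 2, 2, 3, 3, 3, 4] (fun _ => 3)) 4 (by decide) (by decide) (by decide) ?_ ?_ ?_⟩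
    · intro i j hij hle
      fin_cases i <;> fin_cases j <;> first
        | (exfalso; revert hij hle; decide)
        | simp [h₂, tableCoeff, tabT222eps23]
      exact Submodule.subset_span ⟨.inr (), by simp, rfl⟩
    · intro i q hle
      have : μ (![a, b, c, d, μ a b, μ a c, μ a d] i) (μ b c - μ a d) = 0 := by simp [h₂]
      simp [this]
    · intro p q hle
      simp [h₂]

end TwoStep

end AlgStr

section Independent

variable {k V : Type*} [Field k] [AddCommGroup V] [Module k V]

lemma LinearIndependent.exists_notMem_span_pair {x y z : V} (h : LinearIndependent k ![x, y, z])
    (p q : V) : ∃ w ∈ ({x, y, z} : Set V), w ∉ Submodule.span k {p, q} := by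
  classical
  by_contra! hc
  have h₁ := finrank_span_eq_card h
  rw [range_vec_three, Fintype.card_fin] at h₁
  have : Module.Finite k (Submodule.span k ({p, q} : Set V)) :=
    Module.Finite.span_of_finite k (Set.toFinite _)
  have h₂ := Submodule.finrank_mono (Submodule.span_le.2 hc)
  have h₃ := finrank_span_finset_le_card (R := k) ({p, q} : Finset V)
  rw [Finset.coe_pair, Set.finrank] at h₃
  have h₄ := Finset.card_le_two (a := p) (b := q)
  omega

end Independent

namespace AlgStr

variable {k : Type*} [Field k] {n m : ℕ} {μ : AlgStr k n}

variable (hμ : ∀ x, μ x x = 0) (h₂ : ∀ x y z, μ x (μ y z) = 0)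

include hμ h₂

/-- By the hypothesis `H`, the product on the span of b, c, d has the form yz = φ(y) az - φ(z) ay
for a linear functional φ. Replacing y by y - φ(y)a makes these products zero, and the rest of the
space is treated by the same comparison of coefficients. -/
lemma hasTable_T222 (hr : MulRankLE 3 μ) {a b c d : Fin n → k}
    (hf : LinearIndependent k ![μ a b, μ a c, μ a d])
    (H : ∀ y z, LinearIndependent k ![μ a y, μ a z] →
      μ y z ∈ Submodule.span k {μ a y, μ a z}) : HasTable tabT222 μ := by
  have hsw := swap_eq_neg hμ
  have hf₀ := linearIndependent_triple_iff.1 hf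
  have H' : ∀ y z, (∀ s t : k, s • μ a y + t • μ a z = 0 → s = 0 ∧ t = 0) →
      ∃ s t : k, s • μ a y + t • μ a z = μ y z := fun y z h =>
    Submodule.mem_span_pair.1 (H y z (LinearIndependent.pair_iff.2 h))
  wlog hbcd : μ b c = 0 ∧ μ b d = 0 ∧ μ c d = 0 generalizing b c d with IH
  · obtain ⟨x₁, y₁, e₁⟩ := H' b c fun s t h => by
      have := hf₀ s t 0 (by linear_combination (norm := module) h)
      exact ⟨this.1, this.2.1⟩
    obtain ⟨x₂, y₂, e₂⟩ := H' b d fun s t h => by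
      have := hf₀ s 0 t (by linear_combination (norm := module) h)
      exact ⟨this.1, this.2.2⟩
    obtain ⟨x₃, y₃, e₃⟩ := H' c d fun s t h => by
      have := hf₀ 0 s t (by linear_combination (norm := module) h)
      exact ⟨this.2.1, this.2.2⟩
    obtain ⟨x₄, y₄, e₄⟩ := H' b (c + d) fun s t h => by
      have := hf₀ s t t (by rw [map_add] at h; linear_combination (norm := module) h)
      exact ⟨this.1, this.2.2⟩
    obtain ⟨x₅, y₅, e₅⟩ := H' c (b + d) fun s t h => by
      have := hf₀ t s t (by rw [map_add] at h; linear_combination (norm := module) h)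
      exact ⟨this.2.1, this.2.2⟩
    obtain ⟨x₆, y₆, e₆⟩ := H' d (b + c) fun s t h => by
      have := hf₀ t t s (by rw [map_add] at h; linear_combination (norm := module) h)
      exact ⟨this.2.2, this.2.1⟩
    simp only [map_add, hsw b c, hsw b d, hsw c d] at e₄ e₅ e₆
    obtain ⟨-, i₁, i₂⟩ := hf₀ (x₁ + x₂ - x₄) (y₁ - y₄) (y₂ - y₄)
      (by linear_combination (norm := module) e₁ + e₂ - e₄)
    obtain ⟨j₁, -, j₂⟩ := hf₀ (-x₁ - y₅) (x₃ - y₁ - x₅) (y₃ - y₅)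
      (by linear_combination (norm := module) -e₁ + e₃ - e₅)
    obtain ⟨l₁, l₂, -⟩ := hf₀ (-x₂ - y₆) (-x₃ - y₆) (-y₂ - y₃ - x₆)
      (by linear_combination (norm := module) -e₂ - e₃ - e₆)
    have k₁ : y₂ = y₁ := by linear_combination i₂ - i₁
    have k₂ : y₃ = -x₁ := by linear_combination j₂ - j₁
    have k₃ : x₃ = x₂ := by linear_combination l₁ - l₂
    subst k₁ k₂ k₃
    refine IH (b := b - y₂ • a) (c := c + x₁ • a) (d := d + x₃ • a) ?_ ?_ ⟨?_, ?_, ?_⟩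
    · simpa [hμ] using hf
    · simpa [hμ] using hf₀
    · simp only [map_sub, map_add, map_smul, LinearMap.sub_apply, LinearMap.smul_apply, hμ,
        hsw a b, ← e₁]
      module
    · simp only [map_sub, map_add, map_smul, LinearMap.sub_apply, LinearMap.smul_apply, hμ,
        hsw a b, ← e₂]
      module
    · simp only [map_add, map_smul, LinearMap.add_apply, LinearMap.smul_apply, hμ,
        hsw a c, ← e₃]
      module
  obtain ⟨hbc, hbd, hcd⟩ := hbcd
  have hcb : μ c b = 0 := by rw [hsw, hbc, neg_zero]
  have hdb : μ d b = 0 := by rw [hsw, hbd, neg_zero]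
  have hdc : μ d c = 0 := by rw [hsw, hcd, neg_zero]
  have hnil := isNilpotent_of_twoStep h₂
  have ha : a ≠ 0 := by
    rintro rfl
    exact hf.ne_zero 0 (by simp)
  have hv : LinearIndependent k ![a, b, c, d, μ a b, μ a c, μ a d] := by
    refine Fintype.linearIndependent_iff.2 fun g hg => ?_
    simp [Fin.sum_univ_succ] at hg
    obtain ⟨e₁, e₂, e₃⟩ := hf₀ (g 1) (g 2) (g 3) (by
      have := congrArg (μ a) hg
      simpa [hμ, h₂, add_assoc] using this)
    simp only [e₁, e₂, e₃, zero_smul, zero_add] at hg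
    have e₀ : g 0 = 0 := eq_zero_of_smul_add_apply hμ hnil ha
      (y := g 4 • b + g 5 • c + g 6 • d) (by simpa [add_assoc] using hg)
    obtain ⟨e₄, e₅, e₆⟩ := hf₀ (g 4) (g 5) (g 6) (by simpa [e₀, add_assoc] using hg)
    intro i
    fin_cases i <;> assumption
  refine hasTable_of_core hμ (by decide) hv (fun x => ?_) (fun u u' hu hu' => ?_) ?_
  · have hx := hr.apply_mem_span (a := a) (y := ![b, c, d])
      (by convert! hf using 1; ext i : 1; fin_cases i <;> rfl) x
    rw [show (fun j => μ a (![b, c, d] j)) = ![μ a b, μ a c, μ a d] by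
      ext i : 1; fin_cases i <;> rfl, range_vec_three, Submodule.mem_span_triple] at hx
    obtain ⟨β₁, β₂, β₃, hx⟩ := hx
    obtain ⟨u, hxu⟩ : ∃ u, x = u + (β₁ • b + β₂ • c + β₃ • d) := ⟨_, (sub_add_cancel _ _).symm⟩
    have hau : μ a u = 0 := by
      rw [hxu] at hx
      simpa using hx
    -- As au = 0, replacing z by z + u does not change az, so yu lies in the span of ay and az for
    -- every admissible z. Varying z gives that yu is a multiple of ay, and the scalar does not
    -- depend on y; a multiple of a then corrects u.
    have key : ∀ y z, (∀ s t : k, s • μ a y + t • μ a z = 0 → s = 0 ∧ t = 0) →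
        ∃ s t : k, s • μ a y + t • μ a z = μ y z + μ y u := fun y z h => by
      obtain ⟨s, t, h⟩ := H' y (z + u) (by simpa [hau] using h)
      exact ⟨s, t, by simpa [hau] using h⟩
    obtain ⟨p₁, q₁, e₁⟩ := key b c fun s t h => by
      have := hf₀ s t 0 (by linear_combination (norm := module) h)
      exact ⟨this.1, this.2.1⟩
    obtain ⟨p₂, q₂, e₂⟩ := key b d fun s t h => by
      have := hf₀ s 0 t (by linear_combination (norm := module) h)
      exact ⟨this.1, this.2.2⟩
    obtain ⟨p₃, q₃, e₃⟩ := key c b fun s t h => by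
      have := hf₀ t s 0 (by linear_combination (norm := module) h)
      exact ⟨this.2.1, this.1⟩
    obtain ⟨p₄, q₄, e₄⟩ := key c d fun s t h => by
      have := hf₀ 0 s t (by linear_combination (norm := module) h)
      exact ⟨this.2.1, this.2.2⟩
    obtain ⟨p₅, q₅, e₅⟩ := key d b fun s t h => by
      have := hf₀ t 0 s (by linear_combination (norm := module) h)
      exact ⟨this.2.2, this.1⟩
    obtain ⟨p₆, q₆, e₆⟩ := key d c fun s t h => by
      have := hf₀ 0 t s (by linear_combination (norm := module) h)
      exact ⟨this.2.2, this.2.1⟩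
    obtain ⟨p₇, q₇, e₇⟩ := key (b + c) d fun s t h => by
      have := hf₀ s s t (by rw [map_add] at h; linear_combination (norm := module) h)
      exact ⟨this.1, this.2.2⟩
    obtain ⟨p₈, q₈, e₈⟩ := key (b + d) c fun s t h => by
      have := hf₀ s t s (by rw [map_add] at h; linear_combination (norm := module) h)
      exact ⟨this.1, this.2.1⟩
    simp only [map_add, LinearMap.add_apply, hbc, hbd, hcd, hcb, hdb, hdc, zero_add, add_zero]
      at e₁ e₂ e₃ e₄ e₅ e₆ e₇ e₈
    obtain ⟨i₁, i₂, i₃⟩ := hf₀ (p₁ - p₂) q₁ (-q₂) (by linear_combination (norm := module) e₁ - e₂)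
    obtain ⟨i₄, i₅, i₆⟩ := hf₀ q₃ (p₃ - p₄) (-q₄) (by linear_combination (norm := module) e₃ - e₄)
    obtain ⟨i₇, i₈, i₉⟩ := hf₀ q₅ (-q₆) (p₅ - p₆) (by linear_combination (norm := module) e₅ - e₆)
    subst i₂ i₄ i₇
    obtain ⟨j₁, j₂, -⟩ := hf₀ (p₁ - p₇) (p₃ - p₇) (-q₇)
      (by linear_combination (norm := module) e₁ + e₃ - e₇)
    obtain ⟨j₃, -, j₄⟩ := hf₀ (p₁ - p₈) (-q₈) (p₅ - p₈)
      (by linear_combination (norm := module) e₁ + e₅ - e₈)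
    have l₁ : p₃ = p₁ := by linear_combination j₂ - j₁
    have l₂ : p₅ = p₁ := by linear_combination j₄ - j₃
    subst l₁ l₂
    refine ⟨![-p₅, β₁, β₂, β₃, 0, 0, 0], fun j => ?_⟩
    have : x - ∑ i, (![-p₅, β₁, β₂, β₃, 0, 0, 0] : Fin 7 → k) i •
        (![a, b, c, d, μ a b, μ a c, μ a d] : Fin 7 → Fin n → k) i = u + p₅ • a := by
      simp [Fin.sum_univ_succ, hxu]
      module
    rw [this]
    fin_cases j
    · simp [hau, hμ]
    · simp [← e₁, hsw a b]
    · simp [← e₃, hsw a c]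
    · simp [← e₅, hsw a d]
    all_goals simp [hsw _ (μ a _), h₂]
  · have hu₀ : μ a u = 0 := hu 0
    have hub : μ b u = 0 := hu 1
    have huc : μ c u = 0 := hu 2
    have hu₀' : μ a u' = 0 := hu' 0
    have hub' : μ b u' = 0 := hu' 1
    have huc' : μ c u' = 0 := hu' 2
    have hud' : μ d u' = 0 := hu' 3
    -- The product uu' equals (b + u)(c + u') and its two analogues, so it lies in the three
    -- coordinate planes spanned by pairs among ab, ac, ad, whose intersection is zero.
    obtain ⟨p₁, q₁, e₁⟩ := H' (b + u) (c + u') fun s t h => by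
      have := hf₀ s t 0 (by
        simp only [map_add, hu₀, hu₀'] at h
        linear_combination (norm := module) h)
      exact ⟨this.1, this.2.1⟩
    obtain ⟨p₂, q₂, e₂⟩ := H' (b + u) (d + u') fun s t h => by
      have := hf₀ s 0 t (by
        simp only [map_add, hu₀, hu₀'] at h
        linear_combination (norm := module) h)
      exact ⟨this.1, this.2.2⟩
    obtain ⟨p₃, q₃, e₃⟩ := H' (c + u) (d + u') fun s t h => by
      have := hf₀ 0 s t (by
        simp only [map_add, hu₀, hu₀'] at h
        linear_combination (norm := module) h)
      exact ⟨this.2.1, this.2.2⟩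
    have hud : μ d u = 0 := hu 3
    simp only [map_add, LinearMap.add_apply, hu₀, hu₀', hbc, hbd, hcd, hub', huc',
      hsw c u, hsw d u, huc, hud, neg_zero, zero_add, add_zero] at e₁ e₂ e₃
    obtain ⟨-, i₁, -⟩ := hf₀ (p₁ - p₂) q₁ (-q₂) (by linear_combination (norm := module) e₁ - e₂)
    obtain ⟨i₂, -, -⟩ := hf₀ p₁ (q₁ - p₃) (-q₃) (by linear_combination (norm := module) e₁ - e₃)
    rw [← e₁, i₁, i₂]
    simp
  · intro i j hij
    fin_cases i <;> fin_cases j <;> first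
      | (exfalso; revert hij; decide)
      | simp [hbc, hbd, hcd, h₂, tableCoeff, tabT222]

lemma level_of_rank_three [Infinite k] (hr : MulRankLE 3 μ) {a : Fin n → k} {y : Fin 3 → Fin n → k}
    (hf : LinearIndependent k fun j => μ a (y j)) :
    DegeneratesToLevelFour μ ∨ HasTable tabT222 μ := by
  have hf : LinearIndependent k ![μ a (y 0), μ a (y 1), μ a (y 2)] := by
    convert! hf using 1
    ext i : 1
    fin_cases i <;> rfl
  by_cases H : ∀ y z, LinearIndependent k ![μ a y, μ a z] →
      μ y z ∈ Submodule.span k {μ a y, μ a z}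
  · exact .inr (hasTable_T222 hμ h₂ hr hf H)
  · push Not at H
    obtain ⟨b, c, hbc, hn⟩ := H
    obtain ⟨w, hw, hw'⟩ := hf.exists_notMem_span_pair (μ a b) (μ a c)
    obtain ⟨d, rfl⟩ : ∃ d, w = μ a d := by
      rcases hw with h | h | h
      exacts [⟨_, h⟩, ⟨_, h⟩, ⟨_, h⟩]
    exact .inl (degeneratesToLevelFour_T222eps23 hμ h₂ (hbc.triple_of_notMem hw') hn)

end AlgStr

/-! ### Two-step structures of rank two -/

namespace AlgStr

variable {k : Type*} [Field k] {n m : ℕ} {μ : AlgStr k n}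

section Rank

lemma MulRankLE.exists_apply_eq {a b c : Fin n → k} (hr : MulRankLE 2 μ)
    (h : LinearIndependent k ![μ a b, μ a c]) (x : Fin n → k) :
    ∃ s t : k, s • μ a b + t • μ a c = μ a x := by
  have e : (fun j => μ a (![b, c] j)) = ![μ a b, μ a c] := by
    ext i : 1
    fin_cases i <;> rfl
  have := hr.apply_mem_span (a := a) (y := ![b, c]) (by rwa [e]) x
  rwa [e, range_vec_two, Submodule.mem_span_pair] at this

lemma MulRankLE.exists_apply_ker_eq [Infinite k] {a b c : Fin n → k} (hr : MulRankLE 2 μ)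
    (h : LinearIndependent k ![μ a b, μ a c]) {u : Fin n → k} (hu : μ a u = 0) (x : Fin n → k) :
    ∃ s t : k, s • μ a b + t • μ a c = μ x u := by
  have e : (fun j => μ a (![b, c] j)) = ![μ a b, μ a c] := by
    ext i : 1
    fin_cases i <;> rfl
  have := hr.apply_ker_mem_span (a := a) (y := ![b, c]) (by rwa [e]) hu x
  rwa [e, range_vec_two, Submodule.mem_span_pair] at this

end Rank

variable (hμ : ∀ x, μ x x = 0) (h₂ : ∀ x y z, μ x (μ y z) = 0)

include hμ h₂

/-- For u in the kernel of a, maximality of the rank puts every xu into the image of a. Hence bu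
lies in the images of a and of b, which meet in the line of ab, and cu in the line of ac; testing b
+ c shows that the scalars agree, so a multiple of a corrects u. Products of two annihilating
vectors lie in the three images of a, b and c, which have zero intersection. -/
lemma hasTable_T22eps23 [Infinite k] (hr : MulRankLE 2 μ) {a b c : Fin n → k}
    (hf : LinearIndependent k ![μ a b, μ a c])
    (hbc : μ b c ∉ Submodule.span k {μ a b, μ a c}) : HasTable tabT22eps23 μ := by
  have hsw := swap_eq_neg hμ
  have hf₀ := linearIndependent_triple_iff.1 (hf.triple_of_notMem hbc)
  have hb : LinearIndependent k ![μ b a, μ b c] := LinearIndependent.pair_iff.2 fun s t h => by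
    have := hf₀ (-s) 0 t (by rw [hsw a b] at h; linear_combination (norm := module) h)
    exact ⟨neg_eq_zero.1 this.1, this.2.2⟩
  have hc : LinearIndependent k ![μ c a, μ c b] := LinearIndependent.pair_iff.2 fun s t h => by
    have := hf₀ 0 (-s) (-t) (by
      rw [hsw a c, hsw b c] at h
      linear_combination (norm := module) h)
    exact ⟨neg_eq_zero.1 this.2.1, neg_eq_zero.1 this.2.2⟩
  have hs : LinearIndependent k ![μ (b + c) a, μ (b + c) c] :=
    LinearIndependent.pair_iff.2 fun s t h => by
      have := hf₀ (-s) (-s) t (by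
        simp only [map_add, LinearMap.add_apply, hsw a b, hsw a c, hμ] at h
        linear_combination (norm := module) h)
      exact ⟨neg_eq_zero.1 this.1, this.2.2⟩
  have hv : LinearIndependent k ![a, b, c, μ a b, μ a c, μ b c] := by
    refine Fintype.linearIndependent_iff.2 fun g hg => ?_
    simp [Fin.sum_univ_succ] at hg
    obtain ⟨e₁, e₂, -⟩ := hf₀ (g 1) (g 2) 0 (by
      have := congrArg (μ a) hg
      simpa [hμ, h₂, add_assoc] using this)
    obtain ⟨e₀, -, -⟩ := hf₀ (-g 0) 0 0 (by
      have := congrArg (μ b) hg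
      simpa [e₁, e₂, hμ, h₂, hsw a b] using this)
    rw [neg_eq_zero] at e₀
    obtain ⟨e₃, e₄, e₅⟩ := hf₀ (g 3) (g 4) (g 5) (by simpa [e₀, e₁, e₂, add_assoc] using hg)
    intro i
    fin_cases i <;> assumption
  refine hasTable_of_core hμ (by decide) hv (fun x => ?_) (fun u u' hu hu' => ?_) ?_
  · obtain ⟨β₁, β₂, hx⟩ := hr.exists_apply_eq hf x
    obtain ⟨u, hxu⟩ : ∃ u, x = u + (β₁ • b + β₂ • c) := ⟨_, (sub_add_cancel _ _).symm⟩
    have hau : μ a u = 0 := by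
      rw [hxu] at hx
      simpa using hx
    obtain ⟨p₁, q₁, e₁⟩ := hr.exists_apply_ker_eq hf hau b
    obtain ⟨p₂, q₂, e₂⟩ := hr.exists_apply_eq hb u
    obtain ⟨p₃, q₃, e₃⟩ := hr.exists_apply_ker_eq hf hau c
    obtain ⟨p₄, q₄, e₄⟩ := hr.exists_apply_eq hc u
    obtain ⟨p₅, q₅, e₅⟩ := hr.exists_apply_eq hs u
    simp only [map_add, LinearMap.add_apply, hsw a b, hsw a c, hsw b c, hμ] at e₂ e₄ e₅
    obtain ⟨-, i₁, -⟩ := hf₀ (p₁ + p₂) q₁ (-q₂) (by linear_combination (norm := module) e₁ - e₂)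
    obtain ⟨i₂, -, -⟩ := hf₀ p₃ (q₃ + p₄) q₄ (by linear_combination (norm := module) e₃ - e₄)
    subst i₁ i₂
    obtain ⟨j₁, j₂, -⟩ := hf₀ (p₁ + p₅) (q₃ + p₅) (-q₅)
      (by linear_combination (norm := module) e₁ + e₃ - e₅)
    have l : q₃ = p₁ := by linear_combination j₂ - j₁
    subst l
    refine ⟨![-q₃, β₁, β₂, 0, 0, 0], fun j => ?_⟩
    have : x - ∑ i, (![-q₃, β₁, β₂, 0, 0, 0] : Fin 6 → k) i •
        (![a, b, c, μ a b, μ a c, μ b c] : Fin 6 → Fin n → k) i = u + q₃ • a := by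
      simp [Fin.sum_univ_succ, hxu]
    rw [this]
    fin_cases j
    · simp [hau, hμ]
    · simp [← e₁, hsw a b]
    · simp [← e₃, hsw a c]
    all_goals simp [hsw _ (μ _ _), h₂]
  · have hb' : μ b u' = 0 := hu' 1
    have hc' : μ c u' = 0 := hu' 2
    obtain ⟨p₁, q₁, e₁⟩ := hr.exists_apply_ker_eq hf (hu' 0) u
    obtain ⟨p₂, q₂, e₂⟩ := hr.exists_apply_ker_eq hb hb' u
    obtain ⟨p₃, q₃, e₃⟩ := hr.exists_apply_ker_eq hc hc' u
    simp only [hsw a b, hsw a c, hsw b c] at e₂ e₃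
    obtain ⟨-, i₁, -⟩ := hf₀ (p₁ + p₂) q₁ (-q₂) (by linear_combination (norm := module) e₁ - e₂)
    obtain ⟨i₂, -, -⟩ := hf₀ p₁ (q₁ + p₃) q₃ (by linear_combination (norm := module) e₁ - e₃)
    rw [← e₁, i₁, i₂]
    simp
  · intro i j hij
    fin_cases i <;> fin_cases j <;> first
      | (exfalso; revert hij; decide)
      | simp [h₂, tableCoeff, tabT22eps23]

lemma degeneratesToLevelFour_of_pairs [Infinite k] {f₁ f₂ p q r s : Fin n → k}
    (hI : ∀ x y, μ x y ∈ Submodule.span k {f₁, f₂})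
    (hf : LinearIndependent k ![μ p q, μ r s])
    (hpr : μ p r = 0) (hps : μ p s = 0) (hqr : μ q r = 0) : DegeneratesToLevelFour μ := by
  classical
  refine degeneratesToLevelFour_T22eps34 hμ h₂ (fun x y => ?_) hf hpr hps hqr
  have e : Submodule.span k {μ p q, μ r s} = Submodule.span k {f₁, f₂} := by
    refine Submodule.eq_of_le_of_finrank_le ?_ ?_
    · rw [Submodule.span_le]
      rintro z (rfl | rfl) <;> exact hI _ _
    · have h₁ := finrank_span_eq_card hf
      rw [range_vec_two, Fintype.card_fin] at h₁
      have h₃ := finrank_span_finset_le_card (R := k) ({f₁, f₂} : Finset (Fin n → k))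
      rw [Finset.coe_pair, Set.finrank] at h₃
      have h₄ := Finset.card_le_two (a := f₁) (b := f₂)
      omega
  rw [e]
  exact hI x y

/-- The case that left multiplication by `u` is not scalar relative to that by `a`, with distinct
eigenvalues. -/
lemma degeneratesToLevelFour_of_eigenvectors [Infinite k] {f₁ f₂ a b c u : Fin n → k} {y : k}
    (hI : ∀ x y, μ x y ∈ Submodule.span k {f₁, f₂})
    (hf : LinearIndependent k ![μ a b, μ a c]) (hy : y ≠ 0) (hbc : μ b c = 0) (hau : μ a u = 0)
    (hbu : μ b u = 0) (hcu : μ c u = y • μ a c) : DegeneratesToLevelFour μ := by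
  have hsw := swap_eq_neg hμ
  -- The multiple of u is chosen so that the first vector annihilates c; it still sends b to ab,
  -- because bu = 0.
  refine degeneratesToLevelFour_of_pairs hμ h₂ (p := a + y⁻¹ • u) (q := b) (r := c) (s := u) hI
    (LinearIndependent.pair_iff.2 fun s t h => ?_) ?_ ?_ hbc
  · simp only [map_add, map_smul, LinearMap.add_apply, LinearMap.smul_apply, hsw b u, hbu,
      hcu] at h
    have := LinearIndependent.pair_iff.1 hf s (t * y) (by linear_combination (norm := module) h)
    exact ⟨this.1, (mul_eq_zero.1 this.2).resolve_right hy⟩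
  · simp [hsw c u, hcu, hy]
  · simp [hau, hμ]

/-- The non-zero vector vs is not proportional to both ab and ac. Together with an independent one
of them it gives two orthogonal pairs with independent values. -/
lemma degeneratesToLevelFour_of_ker [Infinite k] {f₁ f₂ a b c v s : Fin n → k}
    (hI : ∀ x y, μ x y ∈ Submodule.span k {f₁, f₂})
    (hf : LinearIndependent k ![μ a b, μ a c]) (hav : μ a v = 0) (hbv : μ b v = 0)
    (hcv : μ c v = 0) (has : μ a s = 0) (hvs : μ v s ≠ 0) : DegeneratesToLevelFour μ := by
  by_cases h₁ : LinearIndependent k ![μ a b, μ v s]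
  · exact degeneratesToLevelFour_of_pairs hμ h₂ hI h₁ hav has hbv
  by_cases h₃ : LinearIndependent k ![μ a c, μ v s]
  · exact degeneratesToLevelFour_of_pairs hμ h₂ hI h₃ hav has hcv
  have hb : μ a b ≠ 0 := hf.ne_zero 0
  have hc : μ a c ≠ 0 := hf.ne_zero 1
  rw [LinearIndependent.pair_iff' hb] at h₁
  rw [LinearIndependent.pair_iff' hc] at h₃
  push Not at h₁ h₃
  obtain ⟨x, hx⟩ := h₁
  obtain ⟨y, hy⟩ := h₃
  have := LinearIndependent.pair_iff.1 hf x (-y) (by linear_combination (norm := module) hx - hy)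
  rw [this.1, zero_smul] at hx
  exact absurd hx.symm hvs

end AlgStr

namespace AlgStr

variable {k : Type*} [Field k] {n m : ℕ} {μ : AlgStr k n}

variable (hμ : ∀ x, μ x x = 0) (h₂ : ∀ x y z, μ x (μ y z) = 0)

include hμ h₂

/-- Relative to left multiplication by `a`, left multiplication by `u` on the span of `b` and `c`
is an operator of a plane: it is scalar, or not diagonalizable, or has distinct eigenvalues. -/
lemma scalar_or_exists_jordan_block [IsAlgClosed k] (hr : MulRankLE 2 μ) {f₁ f₂ a b c u : Fin n → k}
    (hI : ∀ x y, μ x y ∈ Submodule.span k {f₁, f₂})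
    (hf : LinearIndependent k ![μ a b, μ a c]) (hbc : μ b c = 0) (hau : μ a u = 0) :
    DegeneratesToLevelFour μ ∨ (∃ l : k, μ b (u + l • a) = 0 ∧ μ c (u + l • a) = 0) ∨
      ∃ b' c' u', LinearIndependent k ![μ a b', μ a c'] ∧ μ b' c' = 0 ∧ μ a u' = 0 ∧
        μ u' b' = μ a c' ∧ μ u' c' = 0 := by
  have : Infinite k := IsAlgClosed.instInfinite
  have hsw := swap_eq_neg hμ
  have hcb : μ c b = 0 := by rw [hsw, hbc, neg_zero]
  have hf₀ := LinearIndependent.pair_iff.1 hf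
  obtain ⟨p₁, q₁, e₁⟩ := hr.exists_apply_ker_eq hf hau b
  obtain ⟨p₂, q₂, e₂⟩ := hr.exists_apply_ker_eq hf hau c
  -- The matrix describes y ↦ yu on the span of b and c, with the image identified with the plane
  -- through y ↦ ay. An eigenvector becomes a vector b' annihilated by u + la.
  obtain ⟨l, hl⟩ := Module.End.exists_eigenvalue (Matrix.toLin' !![p₁, p₂; q₁, q₂])
  obtain ⟨v, hv⟩ := hl.exists_hasEigenvector
  have hv₁ := hv.apply_eq_smul
  have hv₀ := hv.2
  obtain ⟨s, t, rfl⟩ : ∃ s t, v = ![s, t] := ⟨v 0, v 1, by ext i; fin_cases i <;> rfl⟩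
  have i₁ := congrFun hv₁ 0
  have i₂ := congrFun hv₁ 1
  simp [Matrix.toLin'_apply, Matrix.mulVec, dotProduct, Fin.sum_univ_succ] at i₁ i₂
  obtain ⟨c', hf', hbc', hc'⟩ : ∃ c', LinearIndependent k ![μ a (s • b + t • c), μ a c'] ∧
      μ (s • b + t • c) c' = 0 ∧ ∀ w, μ (s • b + t • c) w = 0 → μ c' w = 0 →
        μ b w = 0 ∧ μ c w = 0 := by
    by_cases hs : s = 0
    · subst hs
      have ht : t ≠ 0 := by
        rintro rfl
        apply hv₀
        ext i
        fin_cases i <;> rfl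
      refine ⟨b, LinearIndependent.pair_iff.2 fun x y h => ?_, by simp [hcb], fun w h h' => ?_⟩
      · obtain ⟨j₁, j₂⟩ := hf₀ y (x * t) (by
          simp only [zero_smul, zero_add, map_smul] at h
          linear_combination (norm := module) h)
        exact ⟨(mul_eq_zero.1 j₂).resolve_right ht, j₁⟩
      · exact ⟨h', by simpa [ht] using h⟩
    · refine ⟨c, LinearIndependent.pair_iff.2 fun x y h => ?_, by simp [hbc, hμ],
        fun w h h' => ?_⟩
      · obtain ⟨j₁, j₂⟩ := hf₀ (x * s) (x * t + y) (by
          simp only [map_add, map_smul] at h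
          linear_combination (norm := module) h)
        have hx := (mul_eq_zero.1 j₁).resolve_right hs
        exact ⟨hx, by simpa [hx] using j₂⟩
      · exact ⟨by simpa [h', hs] using h, h'⟩
  have hbu : μ (s • b + t • c) (u + l • a) = 0 := by
    simp only [map_add, map_smul, LinearMap.add_apply, LinearMap.smul_apply, hsw a b, hsw a c,
      ← e₁, ← e₂]
    linear_combination (norm := module) i₁ • μ a b + i₂ • μ a c
  set b' := s • b + t • c
  set u' := u + l • a
  have hau' : μ a u' = 0 := by simp [u', hau, hμ]
  -- In the basis b', c' the operator is upper triangular with diagonal 0, y. If y ≠ 0 the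
  -- eigenvalues are distinct; if y = 0, it is a Jordan block or zero according to x.
  obtain ⟨x, y, hxy⟩ := hr.exists_apply_ker_eq hf' hau' c'
  by_cases hy : y = 0
  · by_cases hx : x = 0
    · exact .inr (.inl ⟨l, hc' u' hbu (by simpa [hx, hy] using hxy.symm)⟩)
    · refine .inr (.inr ⟨c', -x • b', u', LinearIndependent.pair_iff.2 fun s t h => ?_, ?_, hau',
        ?_, ?_⟩)
      · obtain ⟨j₁, j₂⟩ := LinearIndependent.pair_iff.1 hf' (t * x) (-s) (by
          simp only [map_smul] at h
          linear_combination (norm := module) -h)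
        exact ⟨neg_eq_zero.1 j₂, (mul_eq_zero.1 j₁).resolve_right hx⟩
      · simp [hsw b' c', hbc']
      · simp [hsw c' u', ← hxy, hy]
      · simp [hsw b' u', hbu]
  · refine .inl (degeneratesToLevelFour_of_eigenvectors hμ h₂ (a := a) (b := b')
      (c := y • c' + x • b') (u := u') (y := y) hI
      (LinearIndependent.pair_iff.2 fun s t h => ?_) hy ?_ hau' hbu ?_)
    · obtain ⟨j₁, j₂⟩ := LinearIndependent.pair_iff.1 hf' (s + t * x) (t * y) (by
        simp only [map_add, map_smul] at h
        linear_combination (norm := module) h)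
      have ht := (mul_eq_zero.1 j₂).resolve_right hy
      exact ⟨by simpa [ht] using j₁, ht⟩
    · simp [hbc', hμ]
    · simp only [map_add, map_smul, LinearMap.add_apply, LinearMap.smul_apply, hbu, ← hxy]
      module

lemma hasTable_T22eps24 [Infinite k] (hr : MulRankLE 2 μ) {f₁ f₂ a b c u : Fin n → k}
    (hI : ∀ x y, μ x y ∈ Submodule.span k {f₁, f₂})
    (hf : LinearIndependent k ![μ a b, μ a c]) (hbc : μ b c = 0) (hau : μ a u = 0)
    (hub : μ u b = μ a c) (huc : μ u c = 0) :
    DegeneratesToLevelFour μ ∨ HasTable tabT22eps24 μ := by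
  by_cases hP : DegeneratesToLevelFour μ
  · exact .inl hP
  have hsw := swap_eq_neg hμ
  have hf₀ := LinearIndependent.pair_iff.1 hf
  have hbu : μ b u = -μ a c := by rw [hsw, hub]
  have hcu : μ c u = 0 := by rw [hsw, huc, neg_zero]
  have hcb : μ c b = 0 := by rw [hsw, hbc, neg_zero]
  have hv : LinearIndependent k ![a, b, c, -u, μ a b, μ a c] := by
    refine Fintype.linearIndependent_iff.2 fun g hg => ?_
    simp [Fin.sum_univ_succ] at hg
    obtain ⟨e₁, e₂⟩ := hf₀ (g 1) (g 2) (by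
      have := congrArg (μ a) hg
      simpa [hμ, h₂, hau, add_assoc] using this)
    obtain ⟨e₀, e₃⟩ := hf₀ (-g 0) (g 3) (by
      have := congrArg (μ b) hg
      simpa [e₁, e₂, hμ, h₂, hsw a b, hbu] using this)
    rw [neg_eq_zero] at e₀
    obtain ⟨e₄, e₅⟩ := hf₀ (g 4) (g 5) (by simpa [e₀, e₁, e₂, e₃, add_assoc] using hg)
    intro i
    fin_cases i <;> assumption
  refine .inr (hasTable_of_core hμ (by decide) hv (fun x => ?_) (fun y z hy hz => ?_) ?_)
  · obtain ⟨β₁, β₂, hx⟩ := hr.exists_apply_eq hf x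
    obtain ⟨w, hxw⟩ : ∃ w, x = w + (β₁ • b + β₂ • c) := ⟨_, (sub_add_cancel _ _).symm⟩
    have haw : μ a w = 0 := by
      rw [hxw] at hx
      simpa using hx
    obtain ⟨p₁, q₁, e₁⟩ := hr.exists_apply_ker_eq hf haw b
    obtain ⟨p₂, q₂, e₂⟩ := hr.exists_apply_ker_eq hf haw c
    -- The multiples of u and a remove the ac-components of bw and cw. What is left, the
    -- ab-components and then uw', must vanish, since otherwise one of the level-four configurations
    -- appears.
    set w' := w + q₁ • u + q₂ • a with hw'
    have haw' : μ a w' = 0 := by simp [w', haw, hau, hμ]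
    have hbw' : μ b w' = (p₁ - q₂) • μ a b := by
      simp only [w', map_add, map_smul, hsw a b, hbu, ← e₁]
      module
    have hcw' : μ c w' = p₂ • μ a b := by
      simp only [w', map_add, map_smul, hsw a c, hcu, ← e₂]
      module
    have h₁ : p₁ - q₂ = 0 := by
      by_contra hne
      refine hP (degeneratesToLevelFour_of_eigenvectors hμ h₂ (a := a)
        (b := (p₁ - q₂) • c - p₂ • b) (c := b) (u := w') hI
        (LinearIndependent.pair_iff.2 fun s t h => ?_) hne ?_ haw' ?_ hbw')
      · obtain ⟨j₁, j₂⟩ := hf₀ (t - s * p₂) (s * (p₁ - q₂)) (by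
          simp only [map_sub, map_smul] at h
          linear_combination (norm := module) h)
        have hs := (mul_eq_zero.1 j₂).resolve_right hne
        exact ⟨hs, by simpa [hs] using j₁⟩
      · simp [hcb, hμ]
      · simp only [map_sub, map_smul, LinearMap.sub_apply, LinearMap.smul_apply, hbw', hcw']
        module
    rw [h₁, zero_smul] at hbw'
    have h₃ : p₂ = 0 := by
      by_contra hne
      refine hP (degeneratesToLevelFour_of_pairs hμ h₂ (p := b) (q := u) (r := c) (s := w') hI
        (LinearIndependent.pair_iff.2 fun s t h => ?_) hbc hbw' huc)
      rw [hbu, hcw'] at h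
      obtain ⟨j₁, j₂⟩ := hf₀ (t * p₂) (-s) (by linear_combination (norm := module) h)
      exact ⟨neg_eq_zero.1 j₂, (mul_eq_zero.1 j₁).resolve_right hne⟩
    rw [h₃, zero_smul] at hcw'
    have huw' : μ u w' = 0 := by
      by_contra hne
      refine hP (degeneratesToLevelFour_of_ker hμ h₂ hI hf haw' hbw' hcw' hau (s := u) ?_)
      rwa [hsw u, neg_ne_zero]
    refine ⟨![-q₂, β₁, β₂, q₁, 0, 0], fun j => ?_⟩
    have : x - ∑ i, (![-q₂, β₁, β₂, q₁, 0, 0] : Fin 6 → k) i •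
        (![a, b, c, -u, μ a b, μ a c] : Fin 6 → Fin n → k) i = w' := by
      simp [Fin.sum_univ_succ, hxw, hw']
      module
    rw [this]
    fin_cases j
    · exact haw'
    · exact hbw'
    · exact hcw'
    · simp [huw']
    all_goals simp [hsw _ (μ _ _), h₂]
  · by_contra hne
    exact hP (degeneratesToLevelFour_of_ker hμ h₂ hI hf (hy 0) (hy 1) (hy 2) (hz 0) hne)
  · intro i j hij
    fin_cases i <;> fin_cases j <;> first
      | (exfalso; revert hij; decide)
      | simp [h₂, hau, hbc, hbu, hcu, tableCoeff, tabT22eps24]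

lemma level_of_rank_two [IsAlgClosed k] (hr : MulRankLE 2 μ) {a : Fin n → k} {y : Fin 2 → Fin n → k}
    (hf : LinearIndependent k fun j => μ a (y j)) :
    DegeneratesToLevelFour μ ∨ HasTable tabT22eps23 μ ∨ HasTable tabT22eps24 μ ∨
      HasTable tabT22 μ := by
  have : Infinite k := IsAlgClosed.instInfinite
  have hf : LinearIndependent k ![μ a (y 0), μ a (y 1)] := by
    convert! hf using 1
    ext i : 1
    fin_cases i <;> rfl
  have hsw := swap_eq_neg hμ
  generalize y 0 = b at hf
  generalize y 1 = c at hf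
  by_cases hbc : μ b c ∈ Submodule.span k {μ a b, μ a c}
  swap
  · exact .inr (.inl (hasTable_T22eps23 hμ h₂ hr hf hbc))
  wlog hbc₀ : μ b c = 0 generalizing b c with H
  · obtain ⟨s, t, hst⟩ := Submodule.mem_span_pair.1 hbc
    have h₀ : μ (b - t • a) (c + s • a) = 0 := by
      simp only [map_sub, map_add, map_smul, LinearMap.sub_apply, LinearMap.smul_apply, hμ,
        hsw a b, ← hst]
      module
    exact H (b - t • a) (c + s • a) (by simpa [hμ] using hf) (by rw [h₀]; exact zero_mem _) h₀
  -- Modulo b and c every argument lies in the kernel of a, where products fall into the image of a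
  -- by maximality of the rank. Applying this to both arguments leaves only bc = 0.
  have hI : ∀ x y, μ x y ∈ Submodule.span k {μ a b, μ a c} := by
    have key : ∀ x y, (∀ z, μ a z = 0 → μ y z ∈ Submodule.span k {μ a b, μ a c}) →
        μ y b ∈ Submodule.span k {μ a b, μ a c} → μ y c ∈ Submodule.span k {μ a b, μ a c} →
        μ y x ∈ Submodule.span k {μ a b, μ a c} := by
      intro x y h hb hc
      obtain ⟨β₁, β₂, hx⟩ := hr.exists_apply_eq hf x
      have e : μ y x = μ y (x - (β₁ • b + β₂ • c)) + (β₁ • μ y b + β₂ • μ y c) := by simp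
      rw [e]
      exact add_mem (h _ (by simp [← hx])) (add_mem (Submodule.smul_mem _ _ hb)
        (Submodule.smul_mem _ _ hc))
    have hK : ∀ y z, μ a z = 0 → μ y z ∈ Submodule.span k {μ a b, μ a c} := fun y z hz =>
      Submodule.mem_span_pair.2 (hr.exists_apply_ker_eq hf hz y)
    refine fun x y => key y x (hK x) ?_ ?_
    · rw [hsw b x]
      exact neg_mem (key x b (hK b) (by simp [hμ]) (by simp [hbc₀]))
    · rw [hsw c x]
      exact neg_mem (key x c (hK c) (by simp [hsw b c, hbc₀]) (by simp [hμ]))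
  by_cases hP : DegeneratesToLevelFour μ
  · exact .inl hP
  by_cases hG : ∃ b' c' u', LinearIndependent k ![μ a b', μ a c'] ∧ μ b' c' = 0 ∧ μ a u' = 0 ∧
        μ u' b' = μ a c' ∧ μ u' c' = 0
  · obtain ⟨b', c', u', hf', hbc', hau', hub', huc'⟩ := hG
    exact .inr (.inr (.inl
      ((hasTable_T22eps24 hμ h₂ hr hI hf' hbc' hau' hub' huc').resolve_left hP)))
  have hscal : ∀ u, μ a u = 0 → ∃ l : k, μ b (u + l • a) = 0 ∧ μ c (u + l • a) = 0 := fun u hu =>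
    ((scalar_or_exists_jordan_block hμ h₂ hr hI hf hbc₀ hu).resolve_left hP).resolve_right hG
  have hf₀ := LinearIndependent.pair_iff.1 hf
  have hv : LinearIndependent k ![a, b, c, μ a b, μ a c] := by
    refine Fintype.linearIndependent_iff.2 fun g hg => ?_
    simp [Fin.sum_univ_succ] at hg
    obtain ⟨e₁, e₂⟩ := hf₀ (g 1) (g 2) (by
      have := congrArg (μ a) hg
      simpa [hμ, h₂, add_assoc] using this)
    obtain ⟨e₀, -⟩ := hf₀ (-g 0) 0 (by
      have := congrArg (μ b) hg
      simpa [e₁, e₂, hμ, h₂, hsw a b] using this)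
    rw [neg_eq_zero] at e₀
    obtain ⟨e₄, e₅⟩ := hf₀ (g 3) (g 4) (by simpa [e₀, e₁, e₂, add_assoc] using hg)
    intro i
    fin_cases i <;> assumption
  refine .inr (.inr (.inr (hasTable_of_core hμ (by decide) hv (fun x => ?_)
    (fun y z hy hz => ?_) ?_)))
  · obtain ⟨β₁, β₂, hx⟩ := hr.exists_apply_eq hf x
    obtain ⟨w, hxw⟩ : ∃ w, x = w + (β₁ • b + β₂ • c) := ⟨_, (sub_add_cancel _ _).symm⟩
    have haw : μ a w = 0 := by
      rw [hxw] at hx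
      simpa using hx
    obtain ⟨l, hl⟩ := hscal w haw
    refine ⟨![-l, β₁, β₂, 0, 0], fun j => ?_⟩
    have : x - ∑ i, (![-l, β₁, β₂, 0, 0] : Fin 5 → k) i •
        (![a, b, c, μ a b, μ a c] : Fin 5 → Fin n → k) i = w + l • a := by
      simp [Fin.sum_univ_succ, hxw]
    rw [this]
    fin_cases j
    · simp [haw, hμ]
    · exact hl.1
    · exact hl.2
    all_goals simp [hsw _ (μ _ _), h₂]
  · by_contra hne
    exact hP (degeneratesToLevelFour_of_ker hμ h₂ hI hf (hy 0) (hy 1) (hy 2) (hz 0) hne)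
  · intro i j hij
    fin_cases i <;> fin_cases j <;> first
      | (exfalso; revert hij; decide)
      | simp [h₂, hbc₀, tableCoeff, tabT22]

end AlgStr

/-! ### Two-step structures of rank one: alternating forms with values in a line -/

namespace AlgStr

variable {k : Type*} [Field k] {n m : ℕ} {μ : AlgStr k n}

section RankOne

/-- The pairs `p i`, `q i` are orthogonal hyperbolic pairs for a form with values in the line of
`z`. -/
structure IsHyperbolic (μ : AlgStr k n) (z : Fin n → k) {r : ℕ} (p q : Fin r → Fin n → k) :
    Prop where
  apply_pp : ∀ i j, μ (p i) (p j) = 0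
  apply_qq : ∀ i j, μ (q i) (q j) = 0
  apply_pq : ∀ i j, μ (p i) (q j) = if i = j then z else 0
  apply_qp : ∀ i j, μ (q i) (p j) = if i = j then -z else 0

variable (hμ : ∀ x, μ x x = 0) (h₂ : ∀ x y z, μ x (μ y z) = 0) {z : Fin n → k} (hz : z ≠ 0)
  (hI : ∀ x y, ∃ c : k, μ x y = c • z) (hcz : ∀ x, μ x z = 0)

include hI in
lemma IsHyperbolic.exists_sub_mem {r : ℕ} {p q : Fin r → Fin n → k} (h : IsHyperbolic μ z p q)
    (x : Fin n → k) : ∃ c d : Fin r → k, ∀ j,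
      μ (p j) (x - ∑ i, (c i • p i + d i • q i)) = 0 ∧
      μ (q j) (x - ∑ i, (c i • p i + d i • q i)) = 0 := by
  choose c hc using fun i => hI (p i) x
  choose d hd using fun i => hI (q i) x
  refine ⟨fun i => -d i, c, fun j => ⟨?_, ?_⟩⟩
  · simp [Finset.sum_add_distrib, h.apply_pp, h.apply_pq, hc]
  · simp [Finset.sum_add_distrib, h.apply_qp, h.apply_qq, hd]

include hμ hI

lemma IsHyperbolic.exists_extend {r : ℕ} {p q : Fin r → Fin n → k} (h : IsHyperbolic μ z p q) :
    (∀ x y, (∀ i, μ (p i) x = 0) → (∀ i, μ (q i) x = 0) → (∀ i, μ (p i) y = 0) →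
      (∀ i, μ (q i) y = 0) → μ x y = 0) ∨
    ∃ p' q' : Fin (r + 1) → Fin n → k, IsHyperbolic μ z p' q' := by
  by_cases H : ∀ x y, (∀ i, μ (p i) x = 0) → (∀ i, μ (q i) x = 0) → (∀ i, μ (p i) y = 0) →
      (∀ i, μ (q i) y = 0) → μ x y = 0
  · exact .inl H
  push Not at H
  obtain ⟨x, y, hpx, hqx, hpy, hqy, hxy⟩ := H
  obtain ⟨c, hc⟩ := hI x y
  have hc₀ : c ≠ 0 := by
    rintro rfl
    exact hxy (by simpa using hc)
  have hsw := swap_eq_neg hμ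
  refine .inr ⟨Fin.snoc p x, Fin.snoc q (c⁻¹ • y), ?_, ?_, ?_, ?_⟩ <;>
    refine Fin.lastCases (Fin.lastCases ?_ fun j => ?_) fun i => Fin.lastCases ?_ fun j => ?_ <;>
    simp [hμ, h.apply_pp, h.apply_qq, h.apply_pq, h.apply_qp, hpx, hqx, hpy, hqy, hc, hc₀,
      hsw (p _) x, hsw (q _) x, hsw (p _) y, hsw (q _) y, hsw x y, Fin.castSucc_ne_last,
      (Fin.castSucc_ne_last _).symm]

omit hμ hI in
include hz hcz in
lemma IsHyperbolic.linearIndependent {r : ℕ} {p q : Fin r → Fin n → k}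
    (h : IsHyperbolic μ z p q) :
    LinearIndependent k (Sum.elim (Sum.elim p q) fun _ : Unit => z) := by
  refine Fintype.linearIndependent_iff.2 fun g hg => ?_
  simp only [Fintype.sum_sum_type, Sum.elim_inl, Sum.elim_inr, Finset.univ_unique,
    Finset.sum_singleton] at hg
  have e₁ : ∀ i, g (.inl (.inr i)) = 0 := fun i => by
    have := congrArg (μ (p i)) hg
    simpa [h.apply_pp, h.apply_pq, hcz, hz] using this
  have e₂ : ∀ i, g (.inl (.inl i)) = 0 := fun i => by
    have := congrArg (μ (q i)) hg
    simpa [h.apply_qp, h.apply_qq, hcz, hz] using this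
  rintro ((i | i) | i)
  · exact e₂ i
  · exact e₁ i
  · simpa [e₁, e₂, hz] using hg

include hz hcz

/-- Hyperbolic pairs are split off as long as the form on their orthogonal complement is non-zero.
Stopping at one, two or three pairs gives the first three η structures; a fourth pair yields a
degeneration to η₄. -/
lemma level_of_isHyperbolic [Infinite k] {p q : Fin 1 → Fin n → k} (h : IsHyperbolic μ z p q) :
    DegeneratesToLevelFour μ ∨ HasTable tabEta1 μ ∨ HasTable tabEta2 μ ∨ HasTable tabEta3 μ := by
  have hzc : ∀ x, μ z x = 0 := fun x => by rw [swap_eq_neg hμ, hcz, neg_zero]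
  rcases h.exists_extend hμ hI with H | ⟨p', q', h'⟩
  · have hv : LinearIndependent k ![p 0, q 0, z] := by
      convert! (h.linearIndependent hz hcz).comp
        ![.inl (.inl 0), .inl (.inr 0), .inr ()] (by decide) using 1
      ext i : 1
      fin_cases i <;> rfl
    refine .inr (.inl (hasTable_of_core hμ (by decide) hv (fun x => ?_) (fun x y hx hy => ?_) ?_))
    · obtain ⟨c, d, hcd⟩ := h.exists_sub_mem hI x
      refine ⟨![c 0, d 0, 0], ?_⟩
      have : x - ∑ i, (![c 0, d 0, 0] : Fin 3 → k) i • (![p 0, q 0, z] : Fin 3 → Fin n → k) i =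
          x - ∑ i, (c i • p i + d i • q i) := by
        simp [Fin.sum_univ_succ]
      intro j
      rw [this]
      fin_cases j
      exacts [(hcd 0).1, (hcd 0).2, hzc _]
    · refine H x y ?_ ?_ ?_ ?_ <;> intro i <;> fin_cases i
      exacts [hx 0, hx 1, hy 0, hy 1]
    · intro i j hij
      fin_cases i <;> fin_cases j <;> first
        | (exfalso; revert hij; decide)
        | simp [hcz, h.apply_pq, tableCoeff, tabEta1]
  clear h p q
  rcases h'.exists_extend hμ hI with H | ⟨p, q, h⟩
  · have hv : LinearIndependent k ![p' 0, q' 0, p' 1, q' 1, z] := by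
      convert! (h'.linearIndependent hz hcz).comp
        ![.inl (.inl 0), .inl (.inr 0), .inl (.inl 1), .inl (.inr 1), .inr ()] (by decide) using 1
      ext i : 1
      fin_cases i <;> rfl
    refine .inr (.inr (.inl
      (hasTable_of_core hμ (by decide) hv (fun x => ?_) (fun x y hx hy => ?_) ?_)))
    · obtain ⟨c, d, hcd⟩ := h'.exists_sub_mem hI x
      refine ⟨![c 0, d 0, c 1, d 1, 0], ?_⟩
      have : x - ∑ i, (![c 0, d 0, c 1, d 1, 0] : Fin 5 → k) i •
          (![p' 0, q' 0, p' 1, q' 1, z] : Fin 5 → Fin n → k) i =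
          x - ∑ i, (c i • p' i + d i • q' i) := by
        simp [Fin.sum_univ_succ, add_assoc]
      intro j
      rw [this]
      fin_cases j
      exacts [(hcd 0).1, (hcd 0).2, (hcd 1).1, (hcd 1).2, hzc _]
    · refine H x y ?_ ?_ ?_ ?_ <;> intro i <;> fin_cases i
      exacts [hx 0, hx 2, hx 1, hx 3, hy 0, hy 2, hy 1, hy 3]
    · intro i j hij
      fin_cases i <;> fin_cases j <;> first
        | (exfalso; revert hij; decide)
        | simp [hcz, h'.apply_pq, h'.apply_pp, h'.apply_qq, h'.apply_qp, tableCoeff, tabEta2]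
  clear h' p' q'
  rcases h.exists_extend hμ hI with H | ⟨p', q', h'⟩
  · have hv : LinearIndependent k ![p 0, q 0, p 1, q 1, p 2, q 2, z] := by
      convert! (h.linearIndependent hz hcz).comp
        ![.inl (.inl 0), .inl (.inr 0), .inl (.inl 1), .inl (.inr 1), .inl (.inl 2), .inl (.inr 2),
          .inr ()] (by decide) using 1
      ext i : 1
      fin_cases i <;> rfl
    refine .inr (.inr (.inr
      (hasTable_of_core hμ (by decide) hv (fun x => ?_) (fun x y hx hy => ?_) ?_)))
    · obtain ⟨c, d, hcd⟩ := h.exists_sub_mem hI x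
      refine ⟨![c 0, d 0, c 1, d 1, c 2, d 2, 0], ?_⟩
      have : x - ∑ i, (![c 0, d 0, c 1, d 1, c 2, d 2, 0] : Fin 7 → k) i •
          (![p 0, q 0, p 1, q 1, p 2, q 2, z] : Fin 7 → Fin n → k) i =
          x - ∑ i, (c i • p i + d i • q i) := by
        simp [Fin.sum_univ_succ, add_assoc]
      intro j
      rw [this]
      fin_cases j
      exacts [(hcd 0).1, (hcd 0).2, (hcd 1).1, (hcd 1).2, (hcd 2).1, (hcd 2).2, hzc _]
    · refine H x y ?_ ?_ ?_ ?_ <;> intro i <;> fin_cases i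
      exacts [hx 0, hx 2, hx 4, hx 1, hx 3, hx 5, hy 0, hy 2, hy 4, hy 1, hy 3, hy 5]
    · intro i j hij
      fin_cases i <;> fin_cases j <;> first
        | (exfalso; revert hij; decide)
        | simp [hcz, h.apply_pq, h.apply_pp, h.apply_qq, h.apply_qp, tableCoeff, tabEta3]
  · have hv : LinearIndependent k ![p' 0, q' 0, p' 1, q' 1, p' 2, q' 2, p' 3, q' 3, z] := by
      convert! (h'.linearIndependent hz hcz).comp
        ![.inl (.inl 0), .inl (.inr 0), .inl (.inl 1), .inl (.inr 1), .inl (.inl 2), .inl (.inr 2),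
          .inl (.inl 3), .inl (.inr 3), .inr ()] (by decide) using 1
      ext i : 1
      fin_cases i <;> rfl
    refine .inl (degeneratesToLevelFour_Eta4 hμ hv fun i j hij hj => ?_)
    fin_cases i <;> fin_cases j <;> first
      | (exfalso; revert hij hj; decide)
      | simp [h'.apply_pq, h'.apply_pp, h'.apply_qq, h'.apply_qp, tableCoeff, tabEta4]

omit hI hz hcz in
include h₂ in
lemma level_of_rank_one [Infinite k] (hr : MulRankLE 1 μ) {a b : Fin n → k} (hab : μ a b ≠ 0) :
    DegeneratesToLevelFour μ ∨ HasTable tabEta1 μ ∨ HasTable tabEta2 μ ∨ HasTable tabEta3 μ := by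
  have hsw := swap_eq_neg hμ
  have hspan : ∀ {a b : Fin n → k}, μ a b ≠ 0 → ∀ x, ∃ c : k, c • μ a b = μ a x := by
    intro a b hab x
    have := hr.apply_mem_span (a := a) (y := fun _ => b)
      (linearIndependent_unique_iff.2 hab) x
    rwa [Set.range_const, Submodule.mem_span_singleton] at this
  have hker : ∀ {u}, μ a u = 0 → ∀ x, ∃ c : k, c • μ a b = μ x u := by
    intro u hu x
    have := hr.apply_ker_mem_span (a := a) (y := fun _ => b)
      (linearIndependent_unique_iff.2 hab) hu x
    rwa [Set.range_const, Submodule.mem_span_singleton] at this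
  have hI : ∀ x y, ∃ c : k, μ x y = c • μ a b := by
    intro x y
    obtain ⟨β, hβ⟩ := hspan hab y
    obtain ⟨c, hc⟩ := hker (u := y - β • b) (by simp [hβ]) x
    obtain ⟨d, hd⟩ := hspan (a := b) (b := a) (by rwa [hsw, neg_ne_zero]) x
    refine ⟨c + β * d, ?_⟩
    rw [map_sub, map_smul, hsw b x, ← hd, hsw a b] at hc
    linear_combination (norm := module) -hc
  refine level_of_isHyperbolic hμ hab hI (fun x => h₂ _ _ _) (p := fun _ => a) (q := fun _ => b)
    ⟨fun i j => hμ _, fun i j => hμ _, fun i j => ?_, fun i j => ?_⟩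
  · rw [if_pos (Subsingleton.elim _ _)]
  · rw [if_pos (Subsingleton.elim _ _), hsw]

end RankOne

lemma eq_zero_of_mulRankLE_zero (h : MulRankLE 0 μ) : μ = 0 := by
  by_contra hne
  obtain ⟨x, hx⟩ := DFunLike.ne_iff.1 hne
  obtain ⟨y, hy⟩ := DFunLike.ne_iff.1 hx
  exact h x (fun _ => y)
    (show LinearIndependent k fun _ : Fin 1 => μ x y from linearIndependent_unique_iff.2 hy)

/-- The classification of the structures in which the squares of left multiplications vanish. -/
lemma level_of_square_zero [IsAlgClosed k] (hμ : ∀ x, μ x x = 0) (hnil : ∀ x, IsNilpotent (μ x))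
    (hsq : ∀ x y, μ x (μ x y) = 0) : DegeneratesToLevelFour μ ∨ ∃ d ≤ 3, μ.IsLevel d := by
  have : Infinite k := IsAlgClosed.instInfinite
  by_cases h₂ : ∀ x y z, μ x (μ y z) = 0
  swap
  · push Not at h₂
    obtain ⟨x, y, z, h⟩ := h₂
    exact .inl (degeneratesToLevelFour_of_apply_apply_ne_zero hμ hsq h)
  by_cases h₄ : MulRankLE 3 μ
  swap
  · unfold MulRankLE at h₄
    push Not at h₄
    obtain ⟨a, y, hy⟩ := h₄
    exact .inl (degeneratesToLevelFour_of_rank_four hμ hnil hsq hy)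
  by_cases h₃ : MulRankLE 2 μ
  swap
  · unfold MulRankLE at h₃
    push Not at h₃
    obtain ⟨a, y, hy⟩ := h₃
    exact (level_of_rank_three hμ h₂ h₄ hy).imp_right fun h => ⟨3, le_rfl, .inr (.inl h)⟩
  by_cases h₁ : MulRankLE 1 μ
  swap
  · unfold MulRankLE at h₁
    push Not at h₁
    obtain ⟨a, y, hy⟩ := h₁
    rcases level_of_rank_two hμ h₂ h₃ hy with h | h | h | h
    exacts [.inl h, .inr ⟨3, le_rfl, .inr (.inr (.inl h))⟩,
      .inr ⟨3, le_rfl, .inr (.inr (.inr (.inl h)))⟩, .inr ⟨2, by norm_num, .inr h⟩]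
  by_cases h₀ : MulRankLE 0 μ
  · exact .inr ⟨0, by norm_num, eq_zero_of_mulRankLE_zero h₀⟩
  · unfold MulRankLE at h₀
    push Not at h₀
    obtain ⟨a, y, hy⟩ := h₀
    rcases level_of_rank_one hμ h₂ h₁ (hy.ne_zero 0) with h | h | h | h
    exacts [.inl h, .inr ⟨1, by norm_num, h⟩, .inr ⟨2, by norm_num, .inl h⟩,
      .inr ⟨3, le_rfl, .inl h⟩]

end AlgStr

/-! ### A left multiplication with non-zero square and rank at least three -/

namespace AlgStr

variable {k : Type*} [Field k] {n m : ℕ} {μ : AlgStr k n}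

/-- Both properties are open along the line through a and b, and each holds at one point of it, so
they hold together at some other point. -/
lemma exists_apply_apply_ne_zero_and_rank [Infinite k] {r : ℕ} {a b x : Fin n → k}
    (ha : μ a (μ a x) ≠ 0) {y : Fin r → Fin n → k} (hb : LinearIndependent k fun j => μ b (y j)) :
    ∃ c, μ c (μ c x) ≠ 0 ∧ LinearIndependent k fun j => μ c (y j) := by
  have hc := IsPolyCurve.line a (b - a)
  have h₁ := eventually_linearIndependent (f := fun (_ : Unit) t =>
    μ (a + t • (b - a)) (μ (a + t • (b - a)) x)) (fun _ => hc.apply μ (hc.apply_left μ x)) 0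
    (linearIndependent_unique_iff.2 (by simpa using ha))
  have h₂ := eventually_linearIndependent (f := fun j t => μ (a + t • (b - a)) (y j))
    (fun j => hc.apply_left μ (y j)) 1 (by simpa using hb)
  obtain ⟨t, ht₁, ht₂⟩ := (h₁.and h₂).exists
  exact ⟨_, ht₁.ne_zero (), ht₂⟩

variable (hμ : ∀ x, μ x x = 0) (hnil : ∀ x, IsNilpotent (μ x))

include hμ hnil

/-- In dimension 5 the string is T⁴ itself. A further vector z allows b = a(au) + tz as a second
starting vector: for generic t, the product ab, which is a(a(au)) + t · az, is independent of the
shortened string u, au, a(au), as T³² requires. -/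
lemma degeneratesToLevelFour_of_string [Infinite k] (hn : 5 ≤ n) {a u : Fin n → k}
    (h₃ : μ a (μ a (μ a u)) ≠ 0) (h₄ : μ a (μ a (μ a (μ a u))) = 0) :
    DegeneratesToLevelFour μ := by
  have ha : a ≠ 0 := by
    rintro rfl
    exact h₃ (by simp)
  have hv : LinearIndependent k ![a, u, μ a u, μ a (μ a u), μ a (μ a (μ a u))] := by
    refine Fintype.linearIndependent_iff.2 fun g hg => ?_
    simp [Fin.sum_univ_succ] at hg
    have e₁ : g 1 = 0 := by
      have := congrArg (μ a) (congrArg (μ a) (congrArg (μ a) hg))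
      simpa [hμ, h₄, h₃] using this
    have e₂ : g 2 = 0 := by
      have := congrArg (μ a) (congrArg (μ a) hg)
      simpa [e₁, hμ, h₄, h₃] using this
    have e₃ : g 3 = 0 := by
      have := congrArg (μ a) hg
      simpa [e₁, e₂, hμ, h₄, h₃] using this
    have e₀ : g 0 = 0 := eq_zero_of_smul_add_apply hμ hnil ha (y := g 4 • μ a (μ a u))
      (by simpa [e₁, e₂, e₃] using hg)
    have e₄ : g 4 = 0 := by simpa [e₀, e₁, e₂, e₃, h₃] using hg
    intro i
    fin_cases i <;> assumption
  rcases hn.eq_or_lt with hn | hn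
  · exact degeneratesToLevelFour_T4 hμ hn.symm hv rfl rfl rfl
  obtain ⟨z, hz⟩ : ∃ z, z ∉ Submodule.span k
      (Set.range ![a, u, μ a u, μ a (μ a u), μ a (μ a (μ a u))]) := by
    by_contra! h
    have h₁ := finrank_span_eq_card hv
    rw [(Submodule.eq_top_iff'.2 h), finrank_top] at h₁
    simp at h₁
    omega
  have hv' := hv.finSnoc hz
  have hlin := eventually_linearIndependent (f := fun (j : Fin 6) t =>
      (![a, z, u, μ a u, μ a (μ a (μ a u)) + t • μ a z, μ a (μ a u)] : Fin 6 → Fin n → k) j)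
    (fun j => by
      fin_cases j
      exacts [.const _, .const _, .const _, .const _, .line _ _, .const _]) 0 (by
      convert! hv'.comp ![0, 5, 1, 2, 4, 3] (by decide) using 1
      ext i : 1
      fin_cases i <;> simp)
  obtain ⟨t, ht, ht₀⟩ := (hlin.and (Filter.eventually_cofinite_ne 0)).exists
  refine degeneratesToLevelFour_T32 hμ (a := a) (b := μ a (μ a u) + t • z) (u := u)
    (b' := μ a (μ a (μ a u)) + t • μ a z) ?_ (by simp) rfl rfl
  rw [Fintype.linearIndependent_iff] at ht ⊢
  intro g hg
  simp [Fin.sum_univ_succ] at hg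
  have h := ht ![g 0, t * g 1, g 2, g 3, g 4, g 5 + g 1] (by
    rw [← hg]
    simp [Fin.sum_univ_succ]
    module)
  have e₁ : g 1 = 0 := (mul_eq_zero.1 (h 1)).resolve_left ht₀
  have e₅ : g 5 + g 1 = 0 := h 5
  intro i
  fin_cases i
  exacts [h 0, e₁, h 2, h 3, h 4, by simpa [e₁] using e₅]

lemma degeneratesToLevelFour_of_rank_three [Infinite k] (hn : 5 ≤ n) {a x : Fin n → k}
    (hx : μ a (μ a x) ≠ 0) {y : Fin 3 → Fin n → k}
    (hy : LinearIndependent k fun j => μ a (y j)) : DegeneratesToLevelFour μ := by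
  have ha : a ≠ 0 := by
    rintro rfl
    exact hx (by simp)
  by_cases h₃ : ∀ u, μ a (μ a (μ a u)) = 0
  swap
  · push Not at h₃
    obtain ⟨u, hu⟩ := h₃
    have hex : ∃ N, (μ a ^ N) u = 0 := by
      obtain ⟨N, hN⟩ := hnil a
      exact ⟨N, by simp [hN]⟩
    classical
    obtain ⟨N, hN⟩ : ∃ N, Nat.find hex = N + 4 := by
      refine Nat.exists_eq_add_of_le' (Nat.succ_le_of_lt (Nat.lt_of_not_le fun h => hu ?_))
      have : (μ a ^ 3) u = 0 := by
        rw [← Nat.sub_add_cancel h, pow_add, Module.End.mul_apply, Nat.find_spec hex, map_zero]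
      simpa [pow_succ] using this
    have e : ∀ r v, (μ a ^ (N + r)) v = (μ a ^ r) ((μ a ^ N) v) := fun r v => by
      rw [add_comm, pow_add, Module.End.mul_apply]
    -- Starting at the `N`-th iterate leaves exactly four vectors of the string before it reaches
    -- zero.
    refine degeneratesToLevelFour_of_string hμ hnil hn (a := a) (u := (μ a ^ N) u) ?_ ?_
    · have := Nat.find_min hex (m := N + 3) (by omega)
      rw [e] at this
      simpa [pow_succ] using this
    · have := Nat.find_spec hex
      rw [hN, e] at this
      simpa [pow_succ] using this
  have hf : LinearIndependent k ![μ a x, μ a (μ a x)] := LinearIndependent.pair_iff.2 fun s t h => by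
    have hs : s = 0 := by
      have := congrArg (μ a) h
      simpa [h₃, hx] using this
    exact ⟨hs, by simpa [hs, hx] using h⟩
  obtain ⟨b, hb⟩ : ∃ b, μ a b ∉ Submodule.span k {μ a x, μ a (μ a x)} := by
    have hy : LinearIndependent k ![μ a (y 0), μ a (y 1), μ a (y 2)] := by
      convert! hy using 1
      ext i : 1
      fin_cases i <;> rfl
    obtain ⟨w, hw, hw'⟩ := hy.exists_notMem_span_pair (μ a x) (μ a (μ a x))
    rcases hw with rfl | rfl | rfl
    exacts [⟨_, hw'⟩, ⟨_, hw'⟩, ⟨_, hw'⟩]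
  -- A second Jordan chain is needed. If a(ab) is a multiple of a(ax), a multiple of x is subtracted
  -- from b; otherwise ab takes the place of b, its second image being zero since the cube vanishes.
  wlog hb₂ : μ a (μ a b) = 0 generalizing b with H
  · by_cases hm : μ a (μ a b) ∈ Submodule.span k {μ a (μ a x)}
    · obtain ⟨c, hc⟩ := Submodule.mem_span_singleton.1 hm
      refine H (b - c • x) (fun h => hb ?_) (by simp [hc])
      rw [map_sub, map_smul] at h
      exact (Submodule.sub_mem_iff_left _
        (Submodule.smul_mem _ _ (Submodule.subset_span (by simp)))).1 h
    · refine H (μ a b) (fun h => hm ?_) (h₃ b)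
      obtain ⟨s, t, hst⟩ := Submodule.mem_span_pair.1 h
      have hs : s = 0 := by
        have := congrArg (μ a) hst
        simpa [h₃, hx] using this
      rw [← hst, hs]
      exact Submodule.mem_span_singleton.2 ⟨t, by simp⟩
  have hf₃ := linearIndependent_triple_iff.1 (hf.triple_of_notMem hb)
  have hv : LinearIndependent k ![a, b, x, μ a x, μ a b, μ a (μ a x)] := by
    refine Fintype.linearIndependent_iff.2 fun g hg => ?_
    simp [Fin.sum_univ_succ] at hg
    obtain ⟨e₂, e₃, e₁⟩ := hf₃ (g 2) (g 3) (g 1) (by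
      have := congrArg (μ a) hg
      simp only [map_add, map_smul, hμ, hb₂, h₃, map_zero, smul_zero, add_zero, zero_add] at this
      linear_combination (norm := module) this)
    have e₀ : g 0 = 0 := eq_zero_of_smul_add_apply hμ hnil ha (y := g 4 • b + g 5 • μ a x)
      (by simpa [e₁, e₂, e₃] using hg)
    obtain ⟨-, e₅, e₄⟩ := hf₃ 0 (g 5) (g 4) (by
      simp only [e₀, e₁, e₂, e₃] at hg
      linear_combination (norm := module) hg)
    intro i
    fin_cases i <;> assumption
  exact degeneratesToLevelFour_T32 hμ hv rfl rfl rfl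

end AlgStr

/-! ### A left multiplication with non-zero square, and rank at most two -/

namespace AlgStr

variable {k : Type*} [Field k] {n m : ℕ} {μ : AlgStr k n}

lemma degeneratesToLevelFour_of_product_notMem_center [Infinite k] (hμ : ∀ x, μ x x = 0)
    {a b c d z : Fin n → k} (hz : z ≠ 0) (hbd : μ b d = c) (hac : μ a c = z) (hab : μ a b = 0)
    (had : μ a d = 0) (hbc : μ b c = 0) (hdc : μ d c = 0) (hcz : ∀ x, μ x z = 0) :
    DegeneratesToLevelFour μ := by
  have hsw := swap_eq_neg hμ
  have hzc : ∀ x, μ z x = 0 := fun x => by rw [hsw x z, hcz, neg_zero]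
  refine degeneratesToLevelFour_T3eps24 hμ (a := a - d) (b := b + c) (c := c + z) (d := -d)
    (z := z) (x := 0) (y := -1) hz ?_ ?_ ?_ ?_ ?_ ?_ (hcz _) (hcz _) (hcz _)
  · simp [hab, hac, hsw b d, hbd, hdc, add_comm]
  · simp [hac, hcz, hdc]
  · simp [hbc, hcz, hμ]
  · simp [had, hμ]
  · simp [hbd, hsw d c, hdc]
  · simp [hsw d c, hdc, hzc]

lemma degeneratesToLevelFour_of_product_mem_center [Infinite k] (hμ : ∀ x, μ x x = 0)
    {a b d e z : Fin n → k} {s t ω β δ : k} (hz : z ≠ 0) (hae : μ a e = z) (hbe : μ b e = 0)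
    (hde : μ d e = 0) (hab : ω • e + β • z = μ a b) (hω : ω ≠ 0) (hbd : μ b d = δ • z) (hδ : δ ≠ 0)
    (had : s • e + t • z = μ a d) (hcz : ∀ x, μ x z = 0) : DegeneratesToLevelFour μ := by
  have hsw := swap_eq_neg hμ
  have hzc : ∀ x, μ z x = 0 := fun x => by rw [hsw x z, hcz, neg_zero]
  have hed : μ e d = 0 := by rw [hsw d e, hde, neg_zero]
  -- The factor `ω * δ⁻¹` normalizes bd to ω z, and the multiple of ab subtracted from d makes ad
  -- proportional to ab.
  refine degeneratesToLevelFour_T3eps24 hμ (a := a) (b := b) (c := μ a b)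
    (d := (ω * δ⁻¹) • (d - ((t - s * ω⁻¹ * β) * ω⁻¹) • μ a b))
    (z := ω • z) (x := δ⁻¹ * s) (y := 0) (smul_ne_zero hω hz) rfl ?_ ?_ ?_ ?_ ?_ ?_ ?_ ?_
  · simp [← hab, hae, hcz]
  · simp [← hab, hbe, hcz]
  · simp only [← hab, map_add, map_sub, map_smul, ← had, hae, hcz]
    match_scalars <;> field_simp
    ring
  · simp only [← hab, map_add, map_sub, map_smul, hbd, hbe, hcz, smul_zero, sub_zero, add_zero]
    match_scalars <;> field_simp
    all_goals ring
  · simp [← hab, hed, hzc, hcz, hμ]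
  · simp [hcz]
  · simp [hcz]
  · simp [hcz]

variable (hμ : ∀ x, μ x x = 0) (hnil : ∀ x, IsNilpotent (μ x))

section Center

variable {a b c z : Fin n → k} (hz : z ≠ 0) (hab : μ a b = c) (hac : μ a c = z)
  (hf : LinearIndependent k ![c, z])
  (hI : ∀ x y, ∃ s t : k, s • c + t • z = μ x y)
  (hcz : ∀ x, μ x z = 0) (hφ : ∀ x, ∃ s : k, μ x c = s • z)

include hμ hz hab hac hf hI hcz hφ

omit hab hf hφ in
-- Since pq has a non-zero c-component, pq can take the place of c. Correcting a by p and q, and p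
-- and q by multiples of pq, removes all other products.
lemma degeneratesToLevelFour_of_notMem_center [Infinite k] {p q : Fin n → k} (hp : μ p c = 0)
    (hq : μ q c = 0) (hpq : ∀ t : k, μ p q ≠ t • z) : DegeneratesToLevelFour μ := by
  have hsw := swap_eq_neg hμ
  obtain ⟨ω, β, hg⟩ := hI p q
  have hω : ω ≠ 0 := by
    rintro rfl
    exact hpq β (by simpa using hg.symm)
  have hag : μ a (μ p q) = ω • z := by simp [← hg, hac, hcz]
  have hpg : μ p (μ p q) = 0 := by simp [← hg, hp, hcz]
  have hqg : μ q (μ p q) = 0 := by simp [← hg, hq, hcz]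
  have key : ∀ x, ∃ s t : k, s • μ p q + t • ω • z = μ a x := by
    intro x
    obtain ⟨s, t, hst⟩ := hI a x
    refine ⟨s * ω⁻¹, (t - s * ω⁻¹ * β) * ω⁻¹, ?_⟩
    rw [← hg, ← hst]
    match_scalars <;> field_simp
    ring
  obtain ⟨ω₁, β₁, h₁⟩ := key p
  obtain ⟨ω₂, β₂, h₂⟩ := key q
  have hgp : μ (μ p q) p = 0 := by rw [hsw p, hpg, neg_zero]
  have hgq : μ (μ p q) q = 0 := by rw [hsw q, hqg, neg_zero]
  refine degeneratesToLevelFour_of_product_notMem_center hμ (a := a - ω₂ • p + ω₁ • q)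
    (b := p - β₁ • μ p q) (c := μ p q) (d := q - β₂ • μ p q) (z := ω • z) (smul_ne_zero hω hz)
    ?_ ?_ ?_ ?_ ?_ ?_ ?_
  · simp [hpg, hgq, hμ]
  · simp [hag, hpg, hqg]
  · simp only [map_sub, map_add, map_smul, LinearMap.sub_apply, LinearMap.add_apply,
      LinearMap.smul_apply, hμ, hag, hpg, hqg, hsw p q, ← h₁]
    module
  · simp only [map_sub, map_add, map_smul, LinearMap.sub_apply, LinearMap.add_apply,
      LinearMap.smul_apply, hμ, hag, hpg, hqg, ← h₂]
    module
  · simp [hpg, hμ]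
  · simp [hqg, hμ]
  · simp [hcz]

omit hφ in
-- When the products of annihilators of c are all multiples of z, a pair x, y of them with xy ≠ 0
-- and ax outside the line of z yields level four. Such a pair exists among b, p, q and b + p,
-- because ab = c is not a multiple of z.
lemma degeneratesToLevelFour_of_mem_center [Infinite k] (hbc : μ b c = 0) {p q : Fin n → k}
    (hp : μ p c = 0) (hq : μ q c = 0) (hpq : μ p q ≠ 0) : DegeneratesToLevelFour μ := by
  by_cases H : ∃ x y, μ x c = 0 ∧ μ y c = 0 ∧ ∀ t : k, μ x y ≠ t • z
  · obtain ⟨x, y, hx, hy, hxy⟩ := H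
    exact degeneratesToLevelFour_of_notMem_center hμ hz hac hI hcz hx hy hxy
  push Not at H
  have hf₀ := LinearIndependent.pair_iff.1 hf
  have key : ∀ {x y}, μ x c = 0 → μ y c = 0 → (∀ t : k, μ a x ≠ t • z) → μ x y ≠ 0 →
      DegeneratesToLevelFour μ := by
    intro x y hx hy hax hxy
    obtain ⟨ω, β, h₁⟩ := hI a x
    obtain ⟨s, t, h₂⟩ := hI a y
    obtain ⟨δ, h₃⟩ := H x y hx hy
    refine degeneratesToLevelFour_of_product_mem_center hμ hz hac hx hy h₁ ?_ h₃ ?_ h₂ hcz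
    · rintro rfl
      exact hax β (by simpa using h₁.symm)
    · rintro rfl
      exact hxy (by simpa using h₃)
  have hb : ∀ t : k, μ a b ≠ t • z := by
    intro t ht
    have := (hf₀ 1 (-t) (by rw [hab] at ht; simp [ht])).1
    exact one_ne_zero this
  by_cases h₁ : μ b p = 0
  swap
  · exact key hbc hp hb h₁
  by_cases h₂ : μ b q = 0
  swap
  · exact key hbc hq hb h₂
  by_cases h₃ : ∃ t : k, μ a p = t • z
  swap
  · push Not at h₃
    exact key hp hq h₃ hpq
  obtain ⟨s, hs⟩ := h₃
  refine key (x := b + p) (y := q) (by simp [hbc, hp]) hq (fun t ht => hb (t - s) ?_)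
    (by simpa [h₂] using hpq)
  rw [map_add, hs] at ht
  linear_combination (norm := module) ht

omit hz hf in
-- A combination of a, b, c moves any vector into the annihilator of both c and a. By `H` and the
-- fact that a sends c to z, such a vector annihilates everything. The dimension bound provides one
-- more annihilating vector for the idle position of the table.
lemma hasTable_T3 (hn : 5 ≤ n) (hbc : μ b c = 0) (hv : LinearIndependent k ![a, b, c, z])
    (H : ∀ p q, μ p c = 0 → μ q c = 0 → μ p q = 0) : HasTable tabT3 μ := by
  have hsw := swap_eq_neg hμ
  have hdec : ∀ x, ∃ s t r : k, μ (x - (s • a + t • b + r • c)) c = 0 ∧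
      μ a (x - (s • a + t • b + r • c)) = 0 := by
    intro x
    obtain ⟨s, hs⟩ := hφ x
    obtain ⟨t, r, htr⟩ := hI a x
    exact ⟨s, t, r, by simp [hs, hac, hbc, hμ], by simp [hab, hac, hμ, htr]⟩
  have hker : ∀ x, μ x c = 0 → μ a x = 0 → ∀ y, μ x y = 0 := by
    intro x h₁ h₂ y
    obtain ⟨s, hs⟩ := hφ y
    have := H x (y - s • a) h₁ (by simp [hs, hac])
    simpa [hsw a x, h₂] using this
  obtain ⟨x, hx⟩ : ∃ x, x ∉ Submodule.span k (Set.range ![a, b, c, z]) := by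
    by_contra! h
    have h₁ := finrank_span_eq_card hv
    rw [(Submodule.eq_top_iff'.2 h), finrank_top] at h₁
    simp at h₁
    omega
  obtain ⟨s, t, r, h₁, h₂⟩ := hdec x
  set d := x - (s • a + t • b + r • c) with hd
  have hd' : d ∉ Submodule.span k (Set.range ![a, b, c, z]) := by
    intro h
    refine hx ((Submodule.sub_mem_iff_left _ ?_).1 h)
    have hm : ∀ i, ![a, b, c, z] i ∈ Submodule.span k (Set.range ![a, b, c, z]) := fun i =>
      Submodule.subset_span ⟨i, rfl⟩
    exact add_mem (add_mem (Submodule.smul_mem _ _ (hm 0)) (Submodule.smul_mem _ _ (hm 1)))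
      (Submodule.smul_mem _ _ (hm 2))
  have hv' : LinearIndependent k ![a, b, c, d, z] := by
    convert! (hv.finSnoc hd').comp ![0, 1, 2, 4, 3] (by decide) using 1
    ext i : 1
    fin_cases i <;> simp
  have hdx := hker d h₁ h₂
  refine hasTable_of_ker hμ (by decide) hv' (fun x => ?_) ?_
  · obtain ⟨s, t, r, h₁, h₂⟩ := hdec x
    refine ⟨![s, t, r, 0, 0], fun y => ?_⟩
    have e : x - ∑ i, (![s, t, r, 0, 0] : Fin 5 → k) i •
        (![a, b, c, d, z] : Fin 5 → Fin n → k) i = x - (s • a + t • b + r • c) := by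
      simp [Fin.sum_univ_succ, add_assoc]
    rw [e]
    exact hker _ h₁ h₂ y
  · intro i j hij
    fin_cases i <;> fin_cases j <;> first
      | (exfalso; revert hij; decide)
      | simp [hab, hac, hbc, hcz, hdx, hsw d, tableCoeff, tabT3]

end Center

include hμ hnil

lemma level_of_rank_two_of_square_ne_zero [Infinite k] (hn : 5 ≤ n) (hr : MulRankLE 2 μ)
    {a b : Fin n → k} (hz : μ a (μ a b) ≠ 0) : DegeneratesToLevelFour μ ∨ HasTable tabT3 μ := by
  have hsw := swap_eq_neg hμ
  obtain ⟨c, hab⟩ : ∃ c, μ a b = c := ⟨_, rfl⟩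
  obtain ⟨z, hac⟩ : ∃ z, μ a c = z := ⟨_, rfl⟩
  rw [hab, hac] at hz
  have hc : c ≠ 0 := by
    rintro rfl
    exact hz (by simp [← hac])
  have ha : a ≠ 0 := by
    rintro rfl
    exact hz (by simp [← hac])
  have hf : LinearIndependent k ![c, z] := by
    rw [LinearIndependent.pair_iff' hc]
    intro s hs
    have := (hnil a).eq_zero_of_apply_eq_smul hc (hac.trans hs.symm)
    exact hz (by simp [← hs, this])
  have hf₀ := LinearIndependent.pair_iff.1 hf
  have hf' : LinearIndependent k ![μ a b, μ a c] := by rwa [hab, hac]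
  have haz : μ a z = 0 := by
    obtain ⟨s, t, h⟩ := hr.exists_apply_eq hf' z
    rw [hab, hac] at h
    obtain ⟨rfl, rfl⟩ := (hnil a).apply_eq_zero_of_cyclic hf hac h.symm
    simpa using h.symm
  have hK : ∀ {u}, μ a u = 0 → ∀ x, ∃ s t : k, s • c + t • z = μ x u := by
    intro u hu x
    have := hr.exists_apply_ker_eq hf' hu x
    rwa [hab, hac] at this
  have hczs : c ∉ Submodule.span k {z} := by
    intro h
    obtain ⟨t, ht⟩ := Submodule.mem_span_singleton.1 h
    exact one_ne_zero (hf₀ 1 (-t) (by simp [ht])).1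
  have hv : LinearIndependent k ![a, b, c, z] := by
    rw [linearIndependent_quadruple_iff]
    intro α β γ δ h
    obtain ⟨rfl, rfl⟩ := hf₀ β γ (by
      have := congrArg (μ a) h
      simpa [hμ, hab, hac, haz] using this)
    have hα := eq_zero_of_smul_add_apply hμ hnil ha (c := α) (y := δ • c)
      (by simpa [hac] using h)
    exact ⟨hα, rfl, rfl, by simpa [hα, hz] using h⟩
  have hv₀ := linearIndependent_quadruple_iff.1 hv
  -- The c-component of cz is, up to sign, an eigenvalue of z modulo the line of z; once it
  -- vanishes, the z-component is an eigenvalue of c.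
  have hcz₀ : μ c z = 0 := by
    obtain ⟨p, q, h⟩ := hK haz c
    have hp := (hnil z).eq_zero_of_sub_smul_mem (N := Submodule.span k {z}) (x := c) (c := -p)
      (by
        rw [Submodule.span_singleton_le_iff_mem, Submodule.mem_comap, hμ]
        exact zero_mem _) hczs
      (by
        rw [hsw c z, ← h]
        exact Submodule.mem_span_singleton.2 ⟨-q, by module⟩)
    rw [neg_eq_zero] at hp
    have hq := (hnil c).eq_zero_of_apply_eq_smul hz (c := q) (by simpa [hp] using h.symm)
    rw [← h, hp, hq]
    simp
  -- If bc is independent of a, b, c, z, the vectors a, b, c, bc, ac give T³(ε₂₃). Otherwise bc lies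
  -- in their span, and nilpotency of the multiplications by c, b and a + b forces it into the span
  -- of c and z.
  by_cases hbc : ∃ s t : k, s • c + t • z = μ b c
  swap
  · left
    by_contra hP
    have hmem : μ b c ∈ Submodule.span k (Set.range ![a, b, c, z]) := by
      by_contra hw
      refine hP (degeneratesToLevelFour_T3eps23 hμ (a := a) (b := b) (c := c) ?_ hab)
      convert! (hv.finSnoc hw).comp ![0, 1, 2, 4, 3] (by decide) using 1
      ext i : 1
      fin_cases i <;> simp [hac]
    obtain ⟨g, hg⟩ := (Submodule.mem_span_range_iff_exists_fun k).1 hmem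
    obtain ⟨α, β, γ, δ, hw⟩ : ∃ α β γ δ : k, α • a + β • b + γ • c + δ • z = μ b c :=
      ⟨g 0, g 1, g 2, g 3, by rw [← hg]; simp [Fin.sum_univ_succ, add_assoc]⟩
    have hβ : β = 0 := by
      have := (hnil c).eq_zero_of_sub_smul_mem (N := Submodule.span k {a, c, z}) (x := b) (c := -β)
        (by
          rw [Submodule.span_le]
          rintro y (rfl | rfl | rfl)
          · rw [SetLike.mem_coe, Submodule.mem_comap, hsw y, hac]
            exact neg_mem (Submodule.subset_span (by simp))
          · simp [hμ]
          · simp [hcz₀])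
        (fun h => by
          obtain ⟨s, t, r, h⟩ := Submodule.mem_span_triple.1 h
          have := (hv₀ s (-1) t r (by rw [← h]; module)).2.1
          simp at this)
        (by
          rw [hsw b c, ← hw]
          refine Submodule.mem_span_triple.2 ⟨-α, -γ, -δ, ?_⟩
          module)
      simpa using this
    subst hβ
    have hcw : LinearIndependent k ![c, μ b c] := by
      rw [LinearIndependent.pair_iff' hc]
      intro s hs
      exact hbc ⟨s, 0, by simp [hs]⟩
    have hba : LinearIndependent k ![μ b a, μ b c] := LinearIndependent.pair_iff.2 fun s t h => by
      have := LinearIndependent.pair_iff.1 hcw (-s) t (by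
        rw [hsw a b, hab] at h
        linear_combination (norm := module) h)
      exact ⟨neg_eq_zero.1 this.1, this.2⟩
    obtain ⟨p, q, hpq⟩ := hK haz b
    obtain ⟨s, t, hst⟩ := hr.exists_apply_eq hba z
    rw [hsw a b, hab] at hst
    have ht : t = 0 := by
      by_contra ht
      refine hbc ⟨t⁻¹ * (p + s), t⁻¹ * q, ?_⟩
      have : t • μ b c = (p + s) • c + q • z := by
        linear_combination (norm := module) hst - hpq
      rw [mul_smul, mul_smul, ← smul_add, ← this, smul_smul, inv_mul_cancel₀ ht, one_smul]
    subst ht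
    have hq : q = 0 := (hf₀ (p + s) q (by linear_combination (norm := module) hpq - hst)).2
    subst hq
    -- Since bz = pc, multiplication by b preserves the plane of c and bc, where it is cyclic; its
    -- characteristic coefficients vanish.
    obtain ⟨h₁, rfl⟩ := (hnil b).apply_eq_zero_of_cyclic hcw (α := δ * p - α) (β := γ) rfl (by
      conv_lhs => rw [← hw]
      simp only [map_add, map_smul, hsw a b, hab, ← hpq]
      module)
    have hbw : μ b (μ b c) = 0 := by
      conv_lhs => rw [← hw]
      simp only [map_add, map_smul, hsw a b, hab, ← hpq]
      linear_combination (norm := module) h₁ • c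
    have haw : μ a (μ b c) = 0 := by simp [← hw, hμ, haz]
    have hzw : LinearIndependent k ![c, z + μ b c] := by
      rw [LinearIndependent.pair_iff' hc]
      intro s hs
      exact hbc ⟨s, -1, by rw [hs]; module⟩
    -- The sum a + b sends c to z + bc and this back to pc, so p = 0, and bc reduces to a multiple
    -- of z.
    obtain ⟨h₃, -⟩ := (hnil (a + b)).apply_eq_zero_of_cyclic hzw (α := p) (β := 0)
      (by simp [hac]) (by simp [haz, haw, hbw, ← hpq])
    rw [h₃, mul_zero, zero_sub, neg_eq_zero] at h₁
    exact hbc ⟨0, δ, by rw [← hw, h₁]; simp⟩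
  have hI : ∀ x y, ∃ s t : k, s • c + t • z = μ x y := by
    have hmem : ∀ {y : Fin n → k}, (∃ s t : k, s • c + t • z = y) ↔
      y ∈ Submodule.span k {c, z} := Submodule.mem_span_pair.symm
    simp only [hmem] at hK hbc ⊢
    have key : ∀ x y, μ y b ∈ Submodule.span k {c, z} → μ y c ∈ Submodule.span k {c, z} →
        μ y x ∈ Submodule.span k {c, z} := by
      intro x y hb hc
      obtain ⟨β₁, β₂, hx⟩ := hr.exists_apply_eq hf' x
      have e : μ y x = μ y (x - (β₁ • b + β₂ • c)) + (β₁ • μ y b + β₂ • μ y c) := by simp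
      rw [e]
      exact add_mem (hK (by simp [← hx]) _) (add_mem (Submodule.smul_mem _ _ hb)
        (Submodule.smul_mem _ _ hc))
    refine fun x y => key y x ?_ ?_
    · rw [hsw b x]
      exact neg_mem (key x b (by simp [hμ]) hbc)
    · rw [hsw c x]
      refine neg_mem (key x c ?_ (by simp [hμ]))
      rw [hsw b c]
      exact neg_mem hbc
  have hcz : ∀ x, μ x z = 0 := by
    intro x
    obtain ⟨p, q, hpq⟩ := hI x z
    -- If p ≠ 0, then z and xz span the plane of all products and x(xz) = 0. But a + x sends z to xz
    -- and xz to pz, which is not nilpotent.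
    have hp : p = 0 := by
      by_contra hp
      have hzy : LinearIndependent k ![z, μ x z] := LinearIndependent.pair_iff.2 fun s t h => by
        rw [← hpq] at h
        obtain ⟨h₁, h₂⟩ := hf₀ (t * p) (s + t * q) (by linear_combination (norm := module) h)
        have ht := (mul_eq_zero.1 h₁).resolve_right hp
        exact ⟨by simpa [ht] using h₂, ht⟩
      obtain ⟨r, s, hrs⟩ := hI x c
      obtain ⟨h₁, h₂⟩ := (hnil x).apply_eq_zero_of_cyclic hzy
        (α := p * s - r * q) (β := r + q) rfl (by
          conv_lhs => rw [← hpq]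
          simp only [map_add, map_smul, ← hrs, ← hpq]
          module)
      have hxy : μ x (μ x z) = 0 := by
        conv_lhs => rw [← hpq]
        simp only [map_add, map_smul, ← hrs, ← hpq]
        linear_combination (norm := module) h₁ • z + h₂ • (p • c + q • z)
      have hay : μ a (μ x z) = p • z := by simp [← hpq, hac, haz]
      exact hp ((hnil (a + x)).apply_eq_zero_of_cyclic hzy (α := p) (β := 0)
        (by simp [haz]) (by simp [hxy, hay])).1
    have hq := (hnil x).eq_zero_of_apply_eq_smul hz (c := q) (by simpa [hp] using hpq.symm)
    rw [← hpq, hp, hq]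
    simp
  have hφ : ∀ x, ∃ s : k, μ x c = s • z := by
    intro x
    obtain ⟨r, s, hrs⟩ := hI x c
    have := (hnil x).eq_zero_of_sub_smul_mem (N := Submodule.span k {z}) (x := c) (c := r)
      (by
        rw [Submodule.span_singleton_le_iff_mem, Submodule.mem_comap, hcz]
        exact zero_mem _) hczs
      (by
        rw [← hrs]
        exact Submodule.mem_span_singleton.2 ⟨s, by module⟩)
    exact ⟨s, by rw [← hrs, this]; simp⟩
  clear hbc hf'
  obtain ⟨s, hs⟩ := hφ b
  have hab' : μ a (b - s • a) = c := by simp [hab, hμ]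
  have hbc' : μ (b - s • a) c = 0 := by simp [hs, hac]
  by_cases H : ∃ p q, μ p c = 0 ∧ μ q c = 0 ∧ μ p q ≠ 0
  · obtain ⟨p, q, hp, hq, hpq⟩ := H
    exact .inl (degeneratesToLevelFour_of_mem_center hμ hz hab' hac hf hI hcz hbc' hp hq hpq)
  push Not at H
  refine .inr (hasTable_T3 hμ hab' hac hI hcz hφ hn hbc' ?_ H)
  rw [linearIndependent_quadruple_iff]
  intro α β γ δ h
  obtain ⟨h₀, h₁, h₂, h₃⟩ := hv₀ (α - β * s) β γ δ (by linear_combination (norm := module) h)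
  exact ⟨by simpa [h₁] using h₀, h₁, h₂, h₃⟩

end AlgStr

/-! ### Exhaustion, chains of degenerations and the level -/

namespace AlgStr

variable {k : Type*} [Field k] {n m : ℕ} {μ ν : AlgStr k n}

lemma level_of_nilpotent [IsAlgClosed k] (hn : 5 ≤ n) (hμ : ∀ x, μ x x = 0)
    (hnil : ∀ x, IsNilpotent (μ x)) : DegeneratesToLevelFour μ ∨ ∃ d ≤ 3, μ.IsLevel d := by
  have : Infinite k := IsAlgClosed.instInfinite
  by_cases hsq : ∀ x y, μ x (μ x y) = 0
  · exact level_of_square_zero hμ hnil hsq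
  push Not at hsq
  obtain ⟨a, b, hab⟩ := hsq
  by_cases hr : MulRankLE 2 μ
  · rcases level_of_rank_two_of_square_ne_zero hμ hnil hn hr hab with h | h
    · exact .inl h
    · exact .inr ⟨3, le_rfl, .inr (.inr (.inr (.inr h)))⟩
  · unfold MulRankLE at hr
    push Not at hr
    obtain ⟨c, y, hy⟩ := hr
    obtain ⟨c', h₁, h₂⟩ := exists_apply_apply_ne_zero_and_rank hab hy
    exact .inl (degeneratesToLevelFour_of_rank_three hμ hnil hn h₁ h₂)

/-- Squares are zero, and the `r`-th powers of the left multiplications are zero. -/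
def IsAlternatingEngel (r : ℕ) (μ : AlgStr k n) : Prop :=
  (∀ x, μ x x = 0) ∧ ∀ x, μ x ^ r = 0

lemma IsPoly.pow_apply (x y : Fin n → k) (r : ℕ) (i : Fin n) :
    IsPoly fun ν : AlgStr k n => (ν x ^ r) y i := by
  induction r generalizing i with
  | zero => simpa using IsPoly.const (y i)
  | succ r ih =>
    have key : (fun ν : AlgStr k n => (ν x ^ (r + 1)) y i) =
        fun ν => ∑ l, (ν x ^ r) y l * ν x (Pi.single l 1) i := by
      ext ν
      rw [pow_succ', Module.End.mul_apply]
      conv_lhs => rw [pi_eq_sum_univ' ((ν x ^ r) y)]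
      simp [Finset.sum_apply, mul_comm]
    rw [key]
    exact .sum _ fun l => (ih l).mul (.apply (LinearMap.proj i) x (Pi.single l 1))

lemma IsAlternatingEngel.of_mem_orbit {r : ℕ} (h : μ.IsAlternatingEngel r) (h' : ν ∈ μ.orbit) :
    ν.IsAlternatingEngel r := by
  obtain ⟨g, rfl⟩ := h'
  refine ⟨fun x => by simp [h.1], fun x => LinearMap.ext fun y => ?_⟩
  have key : ∀ s, (act g μ x ^ s) y = g ((μ (g.symm x) ^ s) (g.symm y)) := by
    intro s
    induction s with
    | zero => simp
    | succ s ih => simp [pow_succ', ih]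
  simp [key, h.2]

/-- For a fixed exponent both conditions are polynomial in the structure constants. The intermediate
structures of a chain are arbitrary, and this is what keeps the classification applicable to them.
-/
lemma IsAlternatingEngel.of_degenerates {r : ℕ} (h : μ.IsAlternatingEngel r)
    (h' : μ.Degenerates ν) : ν.IsAlternatingEngel r := by
  refine ⟨fun x => funext fun i => ?_, fun x => LinearMap.ext fun y => funext fun i => ?_⟩
  · exact h'.eq_zero (.apply (LinearMap.proj i) x x) fun χ hχ => by
      simp [(h.of_mem_orbit hχ).1]
  · exact h'.eq_zero (.pow_apply x y r i) fun χ hχ => by simp [(h.of_mem_orbit hχ).2]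

lemma IsAlternatingEngel.level [IsAlgClosed k] {r : ℕ} (h : μ.IsAlternatingEngel r) (hn : 5 ≤ n) :
    DegeneratesToLevelFour μ ∨ ∃ d ≤ 3, μ.IsLevel d :=
  level_of_nilpotent hn h.1 fun x => ⟨r, h.2 x⟩

/-- There is a sequence of `m` proper degenerations that starts at `μ`. -/
def HasChain : ℕ → AlgStr k n → Prop
  | 0, _ => True
  | m + 1, μ => ∃ ν, μ.ProperlyDegenerates ν ∧ HasChain m ν

lemma hasChain_iff : HasChain m μ ↔ ∃ f : Fin (m + 1) → AlgStr k n,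
    f 0 = μ ∧ ∀ i : Fin m, (f i.castSucc).ProperlyDegenerates (f i.succ) := by
  induction m generalizing μ with
  | zero => exact ⟨fun _ => ⟨fun _ => μ, rfl, fun i => i.elim0⟩, fun _ => trivial⟩
  | succ m ih =>
    constructor
    · rintro ⟨ν, h, hν⟩
      obtain ⟨f, rfl, hf⟩ := ih.1 hν
      refine ⟨Fin.cons μ f, rfl, fun i => ?_⟩
      induction i using Fin.cases with
      | zero => exact h
      | succ i => exact hf i
    · rintro ⟨f, rfl, hf⟩
      exact ⟨f 1, hf 0, ih.2 ⟨fun i => f i.succ, rfl, fun i => hf i.succ⟩⟩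

lemma HasChain.of_mem_orbit (h : HasChain m μ) (h' : μ ∈ ν.orbit) : HasChain m ν := by
  cases m with
  | zero => trivial
  | succ m =>
    obtain ⟨χ, ⟨h₁, h₂⟩, h₃⟩ := h
    exact ⟨χ, ⟨(degenerates_of_mem_orbit h').trans h₁,
      fun h => h₂ (mem_orbit_trans (mem_orbit_symm h') h)⟩, h₃⟩

lemma IsLevel.hasChain [Infinite k] {d : ℕ} (h : μ.IsLevel d) : HasChain d μ := by
  induction d generalizing μ with
  | zero => trivial
  | succ d ih =>
    obtain ⟨ν, h₁, h₂, h₃⟩ := h.exists_step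
    exact ⟨ν, ⟨h₂, fun h' => h₃ (degenerates_of_mem_orbit (mem_orbit_symm h'))⟩, ih h₁⟩

/-- Let `ν` be the next member of the chain. If `ν` degenerates to a level-four structure, then so
does `μ`; hence d = 4, that structure is isomorphic to `μ`, and `ν` degenerates back to `μ`,
contrary to antisymmetry. Otherwise `ν` is listed with a smaller level, and induction applies. -/
lemma IsLevel.le_of_hasChain [IsAlgClosed k] (hn : 5 ≤ n) {d r : ℕ} (h : μ.IsLevel d)
    (hμ : μ.IsAlternatingEngel r) (hm : HasChain m μ) : m ≤ d := by
  have : Infinite k := IsAlgClosed.instInfinite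
  induction m generalizing μ d with
  | zero => exact Nat.zero_le _
  | succ m ih =>
    obtain ⟨ν, ⟨hν, hν'⟩, hc⟩ := hm
    have hE := hμ.of_degenerates hν
    rcases hE.level hn with ⟨χ, hχ, hχ'⟩ | ⟨e, -, he⟩
    · have hle := h.le_of_degenerates hχ (hν.trans hχ')
      obtain rfl : d = 4 := le_antisymm h.le_four hle
      have h₁ := mem_orbit_symm (h.mem_orbit_of_degenerates hχ (hν.trans hχ'))
      exact absurd (hν.mem_orbit (hχ'.trans (degenerates_of_mem_orbit h₁))) hν'
    · have hle := h.le_of_degenerates he hν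
      have hne : e ≠ d := by
        rintro rfl
        exact hν' (h.mem_orbit_of_degenerates he hν)
      have := ih he hE hc
      omega

lemma isLevel_four_iff [IsAlgClosed k] (hn : 5 ≤ n) {r : ℕ} (hμ : μ.IsAlternatingEngel r) :
    μ.IsLevel 4 ↔ IsGreatest {l | HasChain l μ} 4 := by
  have : Infinite k := IsAlgClosed.instInfinite
  refine ⟨fun h => ⟨h.hasChain, fun l hl => h.le_of_hasChain hn hμ hl⟩, fun h => ?_⟩
  rcases hμ.level hn with ⟨χ, hχ, hχ'⟩ | ⟨d, hd, hd'⟩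
  · by_contra hne
    -- A structure outside the list degenerates properly to a level-four one, which prolongs a chain
    -- of length 4 to length 5.
    have : HasChain 5 μ := ⟨χ, ⟨hχ', fun h' => hne (hχ.of_mem_orbit h')⟩, hχ.hasChain⟩
    have := h.2 (show 5 ∈ {l | HasChain l μ} from this)
    omega
  · have := hd'.le_of_hasChain hn hμ h.1
    omega

/-! ### Translation to algebras, and the named structures as tables -/

section Represented

variable {A : Type*} [NonUnitalNonAssocRing A] [Module k A]

lemma isRepresentedBy_iff_of_isRepresentedBy (h : IsRepresentedBy A μ) :
    IsRepresentedBy A ν ↔ ν ∈ μ.orbit := by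
  obtain ⟨e, he⟩ := h
  constructor
  · rintro ⟨f, hf⟩
    refine ⟨e.symm.trans f, LinearMap.ext₂ fun x y => ?_⟩
    have := hf (f.symm x) (f.symm y)
    have h₂ := he (f.symm x) (f.symm y)
    simp only [LinearEquiv.apply_symm_apply] at this
    simp [← h₂, this]
  · rintro ⟨g, rfl⟩
    exact ⟨e.trans g, fun a b => by simp [he]⟩

lemma exists_isRepresentedBy [SMulCommClass k A A] [IsScalarTower k A A] [FiniteDimensional k A]
    (hn : finrank k A = n) : ∃ μ : AlgStr k n, IsRepresentedBy A μ := by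
  let e : A ≃ₗ[k] (Fin n → k) := LinearEquiv.ofFinrankEq _ _ (by simp [hn])
  exact ⟨((LinearMap.mul k A).compl₁₂ e.symm.toLinearMap e.symm.toLinearMap).compr₂ e.toLinearMap,
    e, fun a b => by simp⟩

lemma hasLevel_iff (hn : finrank k A = n) (h : IsRepresentedBy A μ) :
    HasLevel k A m ↔ IsGreatest {l | HasChain l μ} m := by
  subst hn
  have : ∀ l, HasDegenerationChain k A l ↔ HasChain l μ := by
    intro l
    rw [hasChain_iff]
    constructor
    · rintro ⟨f, hf, hf'⟩
      exact hasChain_iff.1 ((hasChain_iff.2 ⟨f, rfl, hf'⟩).of_mem_orbit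
        ((isRepresentedBy_iff_of_isRepresentedBy h).1 hf))
    · rintro ⟨f, rfl, hf⟩
      exact ⟨f, h, hf⟩
  simp only [HasLevel, this]

lemma IsRepresentedBy.isAlternatingEngel [SMulCommClass k A A] [IsScalarTower k A A]
    (h : IsRepresentedBy A μ) (hanti : IsAnticommutative A) (hE : IsEngel k A) :
    ∃ r, μ.IsAlternatingEngel r := by
  obtain ⟨e, he⟩ := h
  obtain ⟨r, -, hr⟩ := hE
  have key : ∀ (s : ℕ) a b, e ((LinearMap.mulLeft k a ^ s) b) = (μ (e a) ^ s) (e b) := by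
    intro s a b
    induction s with
    | zero => simp
    | succ s ih => simp [pow_succ', he, ih]
  refine ⟨r, fun x => ?_, fun x => LinearMap.ext fun y => ?_⟩
  · simpa [hanti _] using (he (e.symm x) (e.symm x)).symm
  · simpa [hr] using (key r (e.symm x) (e.symm y)).symm

lemma IsTable.isRepresentedBy_iff {pos : Fin m → Fin n} {T : Finset (Fin m × Fin m × Fin m)}
    (hν : IsTable ν pos T) (h : IsRepresentedBy A μ) : IsRepresentedBy A ν ↔ HasTable T μ := by
  rw [isRepresentedBy_iff_of_isRepresentedBy h]
  exact ⟨fun h' => ⟨ν, pos, hν, h'⟩, fun h' => h'.mem_orbit hν.hasTable⟩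

end Represented

lemma isTable_eta4 (hn : 9 ≤ n) : IsTable (eta4 k n) (fun i : Fin 9 => i.castLE hn) tabEta4 :=
  isTable_ofTable (Fin.castLE_injective hn) (by decide) (by simp [tabEta4])

lemma isTable_T4 : IsTable (T4 k) id tabT4 :=
  isTable_ofTable Function.injective_id (by decide) (by simp [tabT4])

lemma isTable_T3eps23 (hn : 5 ≤ n) : IsTable (T3eps23 k n) ![⟨0, by omega⟩, ⟨1, by omega⟩,
    ⟨2, by omega⟩, ⟨n - 2, by omega⟩, ⟨n - 1, by omega⟩] tabT3eps23 := by
  refine isTable_ofTable (fun i j h => ?_) (by decide) ?_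
  · fin_cases i <;> fin_cases j <;> simp at h ⊢ <;> omega
  · obtain ⟨n, rfl⟩ := Nat.exists_eq_add_of_le' hn
    simp [tabT3eps23]

lemma isTable_T3eps24 (hn : 5 ≤ n) : IsTable (T3eps24 k n) ![⟨0, by omega⟩, ⟨1, by omega⟩,
    ⟨2, by omega⟩, ⟨3, by omega⟩, ⟨n - 1, by omega⟩] tabT3eps24 := by
  refine isTable_ofTable (fun i j h => ?_) (by decide) ?_
  · fin_cases i <;> fin_cases j <;> simp at h ⊢ <;> omega
  · obtain ⟨n, rfl⟩ := Nat.exists_eq_add_of_le' hn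
    simp [tabT3eps24]

lemma isTable_T22eps34 (hn : 6 ≤ n) : IsTable (T22eps34 k n) ![⟨0, by omega⟩, ⟨1, by omega⟩,
    ⟨2, by omega⟩, ⟨3, by omega⟩, ⟨n - 2, by omega⟩, ⟨n - 1, by omega⟩] tabT22eps34 := by
  refine isTable_ofTable (fun i j h => ?_) (by decide) ?_
  · fin_cases i <;> fin_cases j <;> simp at h ⊢ <;> omega
  · obtain ⟨n, rfl⟩ := Nat.exists_eq_add_of_le' hn
    simp [tabT22eps34]

lemma isTable_T32 (hn : 6 ≤ n) : IsTable (T32 k n) ![⟨0, by omega⟩, ⟨1, by omega⟩,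
    ⟨2, by omega⟩, ⟨3, by omega⟩, ⟨n - 2, by omega⟩, ⟨n - 1, by omega⟩] tabT32 := by
  refine isTable_ofTable (fun i j h => ?_) (by decide) ?_
  · fin_cases i <;> fin_cases j <;> simp at h ⊢ <;> omega
  · obtain ⟨n, rfl⟩ := Nat.exists_eq_add_of_le' hn
    simp [tabT32]

lemma isTable_T222eps23 (hn : 7 ≤ n) : IsTable (T222eps23 k n) ![⟨0, by omega⟩, ⟨1, by omega⟩,
    ⟨2, by omega⟩, ⟨3, by omega⟩, ⟨n - 3, by omega⟩, ⟨n - 2, by omega⟩, ⟨n - 1, by omega⟩]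
    tabT222eps23 := by
  refine isTable_ofTable (fun i j h => ?_) (by decide) ?_
  · fin_cases i <;> fin_cases j <;> simp at h ⊢ <;> omega
  · obtain ⟨n, rfl⟩ := Nat.exists_eq_add_of_le' hn
    simp [tabT222eps23]

lemma isTable_T2222 (hn : 9 ≤ n) : IsTable (T2222 k n) ![⟨0, by omega⟩, ⟨1, by omega⟩,
    ⟨2, by omega⟩, ⟨3, by omega⟩, ⟨4, by omega⟩, ⟨n - 4, by omega⟩, ⟨n - 3, by omega⟩,
    ⟨n - 2, by omega⟩, ⟨n - 1, by omega⟩] tabT2222 := by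
  refine isTable_ofTable (fun i j h => ?_) (by decide) ?_
  · fin_cases i <;> fin_cases j <;> simp at h ⊢ <;> omega
  · obtain ⟨n, rfl⟩ := Nat.exists_eq_add_of_le' hn
    simp [tabT2222]

end AlgStr

open AlgStr in
theorem theorem2 {k : Type*} [Field k] [IsAlgClosed k]
    {A : Type*} [NonUnitalNonAssocRing A] [Module k A] [SMulCommClass k A A]
    [IsScalarTower k A A] [FiniteDimensional k A]
    (n : ℕ) (hn : finrank k A = n)
    (hanti : IsAnticommutative A) (hEngel : IsEngel k A) :
    (n = 5 →
      (HasLevel k A 4 ↔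
        IsRepresentedBy A (T3eps23 k 5) ∨ IsRepresentedBy A (T3eps24 k 5) ∨
          IsRepresentedBy A (T4 k))) ∧
    (n = 6 →
      (HasLevel k A 4 ↔
        IsRepresentedBy A (T22eps34 k 6) ∨ IsRepresentedBy A (T3eps23 k 6) ∨
          IsRepresentedBy A (T3eps24 k 6) ∨ IsRepresentedBy A (T32 k 6))) ∧
    (n = 7 ∨ n = 8 →
      (HasLevel k A 4 ↔
        IsRepresentedBy A (T22eps34 k n) ∨ IsRepresentedBy A (T3eps23 k n) ∨
          IsRepresentedBy A (T3eps24 k n) ∨ IsRepresentedBy A (T222eps23 k n) ∨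
          IsRepresentedBy A (T32 k n))) ∧
    (9 ≤ n →
      (HasLevel k A 4 ↔
        IsRepresentedBy A (eta4 k n) ∨ IsRepresentedBy A (T22eps34 k n) ∨
          IsRepresentedBy A (T3eps23 k n) ∨ IsRepresentedBy A (T3eps24 k n) ∨
          IsRepresentedBy A (T222eps23 k n) ∨ IsRepresentedBy A (T32 k n) ∨
          IsRepresentedBy A (T2222 k n))) := by
  obtain ⟨μ, hμ⟩ := exists_isRepresentedBy hn
  obtain ⟨r, hr⟩ := hμ.isAlternatingEngel hanti hEngel
  have key : 5 ≤ n → (HasLevel k A 4 ↔ μ.IsLevel 4) := fun h => by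
    rw [hasLevel_iff hn hμ, isLevel_four_iff h hr]
  -- A table on more than n vectors cannot occur in dimension n; this removes the surplus
  -- alternatives for small n.
  have hlt : ∀ {m : ℕ} (T : Finset (Fin m × Fin m × Fin m)), n < m → (HasTable T μ ↔ False) :=
    fun T h => iff_false_intro fun h' => absurd h'.card_le (by omega)
  refine ⟨?_, ?_, ?_, ?_⟩
  · rintro rfl
    rw [key le_rfl, (isTable_T3eps23 le_rfl).isRepresentedBy_iff hμ,
      (isTable_T3eps24 le_rfl).isRepresentedBy_iff hμ, isTable_T4.isRepresentedBy_iff hμ]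
    simp [IsLevel, hlt]
  · rintro rfl
    rw [key (by omega), (isTable_T22eps34 le_rfl).isRepresentedBy_iff hμ,
      (isTable_T3eps23 (by omega)).isRepresentedBy_iff hμ,
      (isTable_T3eps24 (by omega)).isRepresentedBy_iff hμ,
      (isTable_T32 le_rfl).isRepresentedBy_iff hμ]
    simp [IsLevel, hlt]
  · intro h
    rw [key (by omega), (isTable_T22eps34 (by omega)).isRepresentedBy_iff hμ,
      (isTable_T3eps23 (by omega)).isRepresentedBy_iff hμ,
      (isTable_T3eps24 (by omega)).isRepresentedBy_iff hμ,
      (isTable_T222eps23 (by omega)).isRepresentedBy_iff hμ,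
      (isTable_T32 (by omega)).isRepresentedBy_iff hμ]
    simp [IsLevel, hlt tabEta4 (by omega), hlt tabT2222 (by omega), show n ≠ 5 by omega]
  · intro h
    rw [key (by omega), (isTable_eta4 h).isRepresentedBy_iff hμ,
      (isTable_T22eps34 (by omega)).isRepresentedBy_iff hμ,
      (isTable_T3eps23 (by omega)).isRepresentedBy_iff hμ,
      (isTable_T3eps24 (by omega)).isRepresentedBy_iff hμ,
      (isTable_T222eps23 (by omega)).isRepresentedBy_iff hμ,
      (isTable_T32 (by omega)).isRepresentedBy_iff hμ,
      (isTable_T2222 h).isRepresentedBy_iff hμ]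
    simp [IsLevel, show n ≠ 5 by omega]
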